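/- Let $n\ge 2$, let $(N,g)$ be a smooth $n$-dimensional Riemannian manifold, and let $M$ be an (immersed) $C^2$ hypersurface in the product manifold $(N\times\mathbb{R},\,g+dt^2)$, with induced metric $g^M$. Write $\langle\cdot,\cdot\rangle=g+dt^2$. Let $\varepsilon$ be a regular value of the height function $t|_M$ and let $\Sigma=M\cap\{t=\varepsilon\}$, a $C^2$ submanifold of $M$ and a $C^2$ hypersurface in $(N\times\{\varepsilon\},g)$. Let $\nu$ be a unit normal to $M$ in $N\times\mathbb{R}$ and $\eta$ a unit normal to $\Sigma$ in $N\times\{\varepsilon\}$. The shape operators $A$ of $M$ (with respect to $\nu$) and $A_\Sigma$ of $\Sigma\subset N\times\{\varepsilon\}$ (with respect to $\eta$) are given in a coordinate frame $(e_i)$ by $A^i_j=\sum_k (g^M)^{ik}\langle\nu,\nabla_{e_k}e_j\rangle$, and likewise for $\Sigma$ with its induced metric and $\eta$, where $\nabla$ is the Levi-Civita connection of the ambient manifold; $H=\operatorname{tr}A$ and $H_\Sigma=\operatorname{tr}A_\Sigma$ are the mean curvatures. Let $R(g)$ and $\mathrm{Ric}_g$ be the scalar and Ricci curvature of $(N,g)$,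 and $R(g^M)$ the scalar curvature of $g^M$. (As $g^M$ is in general only $C^1$, $R(g^M)$ is understood as the continuous function which represents the scalar curvature of $g^M$ in the sense of distributions; this function exists and is unique.) Then at every point of $\Sigma$ $$\langle\nu,\eta\rangle\,H\,H_\Sigma\;\ge\;\tfrac12R(g^M)-\tfrac12R(g)+\langle\nu,\eta\rangle^2\,\mathrm{Ric}_g(\eta,\eta)+\frac{n}{2(n-1)}\,\langle\nu,\eta\rangle^2H_\Sigma^2 .$$ Equality holds at a point of $\Sigma$ if and only if, at that point, (i) $\Sigma$ is umbilic in $N\times\{\varepsilon\}$, i.e. $A_\Sigma=\kappa\,\mathrm{Id}$ for some $\kappa\in\mathbb{R}$, and (ii) $\langle\nu,\eta\rangle\kappa$ is a principal curvature of $M\subset N\times\mathbb{R}$, i.e. an eigenvalue of $A$, with multiplicity at least $n-1$. -/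

import Mathlib

open scoped Manifold ContDiff Topology Bundle
open MeasureTheory

noncomputable section

namespace HypersurfaceGeometry

section Tensors

variable {E : Type*} [NormedAddCommGroup E] [NormedSpace ℝ E]
  {H : Type*} [TopologicalSpace H]
  {E' : Type*} [NormedAddCommGroup E'] [NormedSpace ℝ E']
  {H' : Type*} [TopologicalSpace H']

/-- A field of (bilinear) forms on the tangent spaces of a manifold, such as a metric tensor. -/
abbrev FormField (I : ModelWithCorners ℝ E H) (Q : Type*) [TopologicalSpace Q]
    [ChartedSpace H Q] : Type _ :=
  ∀ x : Q, TangentSpace I x → TangentSpace I x → ℝ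

/-- The pull-back `f^* g`; for an immersion `f` this is the induced metric. -/
def pullbackForm (I : ModelWithCorners ℝ E H) (I' : ModelWithCorners ℝ E' H')
    {S : Type*} [TopologicalSpace S] [ChartedSpace H S]
    {Q : Type*} [TopologicalSpace Q] [ChartedSpace H' Q]
    (g : FormField I' Q) (f : S → Q) : FormField I S :=
  fun x v w => g (f x) (mfderiv I I' f x v) (mfderiv I I' f x w)

/-- The expression of a metric tensor in the coordinates given by the preferred chart at `q`:
the function `z ↦ g (a^i ∂_i, b^j ∂_j)` at the point with coordinates `z`. -/
def coordForm (I : ModelWithCorners ℝ E H) {Q : Type*} [TopologicalSpace Q] [ChartedSpace H Q]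
    (g : FormField I Q) (q : Q) (z a b : E) : ℝ :=
  g ((extChartAt I q).symm z)
    (mfderiv 𝓘(ℝ, E) I (extChartAt I q).symm z a)
    (mfderiv 𝓘(ℝ, E) I (extChartAt I q).symm z b)

/-- Christoffel symbols of the first kind of a metric given in coordinates,
`⟨∇_a b, c⟩ = (∂_a G(b,c) + ∂_b G(a,c) - ∂_c G(a,b)) / 2` for coordinate-constant `a, b, c`. -/
def christoffelFirst (G : E → E → E → ℝ) (z a b c : E) : ℝ :=
  (fderiv ℝ (fun y => G y b c) z a + fderiv ℝ (fun y => G y a c) z b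
    - fderiv ℝ (fun y => G y a b) z c) / 2

/-- The scalar second fundamental form `⟨ξ, ∇_u v⟩` at `p` of a map `f : S → Q` into a manifold
with metric `g`, with respect to a vector `ξ` at `f p`. The arguments `u`, `v` are coordinate
vectors in the preferred chart of `S` at `p`, and `∇` is the Levi-Civita connection of `g`:
in coordinates `∇_u v` is `∂_u ∂_v x + Γ(∂_u x, ∂_v x)`, where `x` is the coordinate expression
of `f`. -/
def secondFundamentalForm (I : ModelWithCorners ℝ E H) (I' : ModelWithCorners ℝ E' H')
    {S : Type*} [TopologicalSpace S] [ChartedSpace H S]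
    {Q : Type*} [TopologicalSpace Q] [ChartedSpace H' Q]
    (g : FormField I' Q) (f : S → Q) (p : S) (ξ : TangentSpace I' (f p)) (u v : E) : ℝ :=
  let x : E → E' := fun y => extChartAt I' (f p) (f ((extChartAt I p).symm y))
  let y₀ : E := extChartAt I p p
  let z₀ : E' := extChartAt I' (f p) (f p)
  let ζ : E' := mfderiv I' 𝓘(ℝ, E') (extChartAt I' (f p)) (f p) ξ
  let G := coordForm I' g (f p)
  G z₀ (fderiv ℝ (fderiv ℝ x) y₀ u v) ζ
    + christoffelFirst G z₀ (fderiv ℝ x y₀ u) (fderiv ℝ x y₀ v) ζ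

/-- `ξ` is a unit vector at `f p` which is orthogonal to the image of the differential of `f`. -/
def IsUnitNormal (I : ModelWithCorners ℝ E H) (I' : ModelWithCorners ℝ E' H')
    {S : Type*} [TopologicalSpace S] [ChartedSpace H S]
    {Q : Type*} [TopologicalSpace Q] [ChartedSpace H' Q]
    (g : FormField I' Q) (f : S → Q) (p : S) (ξ : TangentSpace I' (f p)) : Prop :=
  g (f p) ξ ξ = 1 ∧ ∀ v : TangentSpace I p, g (f p) ξ (mfderiv I I' f p v) = 0

/-- `f` is an immersion of class `C^2`. -/
def IsC2Immersion (I : ModelWithCorners ℝ E H) (I' : ModelWithCorners ℝ E' H')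
    {S : Type*} [TopologicalSpace S] [ChartedSpace H S]
    {Q : Type*} [TopologicalSpace Q] [ChartedSpace H' Q] (f : S → Q) : Prop :=
  ContMDiff I I' 2 f ∧ ∀ p, Function.Injective (mfderiv I I' f p)

/-- The differential `dt` of the height function `t : N × ℝ → ℝ`. -/
def heightForm (I : ModelWithCorners ℝ E H) {N : Type*} [TopologicalSpace N] [ChartedSpace H N]
    (p : N × ℝ) (v : TangentSpace (I.prod 𝓘(ℝ, ℝ)) p) : ℝ :=
  mfderiv (I.prod 𝓘(ℝ, ℝ)) 𝓘(ℝ, ℝ) (Prod.snd : N × ℝ → ℝ) p v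

/-- The product metric `g + dt²` on `N × ℝ`. -/
def productForm (I : ModelWithCorners ℝ E H) {N : Type*} [TopologicalSpace N] [ChartedSpace H N]
    (g : FormField I N) : FormField (I.prod 𝓘(ℝ, ℝ)) (N × ℝ) :=
  fun p v w =>
    g p.1 (mfderiv (I.prod 𝓘(ℝ, ℝ)) I Prod.fst p v) (mfderiv (I.prod 𝓘(ℝ, ℝ)) I Prod.fst p w)
      + heightForm I p v * heightForm I p w

/-- A tangent vector of the slice `N × {p.2}` at `p`, as a tangent vector of `N × ℝ`. -/
def sliceVector (I : ModelWithCorners ℝ E H) {N : Type*} [TopologicalSpace N] [ChartedSpace H N]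
    (p : N × ℝ) (η : TangentSpace I p.1) : TangentSpace (I.prod 𝓘(ℝ, ℝ)) p :=
  mfderiv I (I.prod 𝓘(ℝ, ℝ)) (fun x : N => (x, p.2)) p.1 η

/-- The metric tensor of a smooth Riemannian metric. -/
def metricForm (I : ModelWithCorners ℝ E H) {N : Type*} [TopologicalSpace N] [ChartedSpace H N]
    [IsManifold I ∞ N]
    (g : Bundle.ContMDiffRiemannianMetric I ∞ E (fun x : N => TangentSpace I x)) :
    FormField I N :=
  fun x v w => g.inner x v w

end Tensors

section ShapeOperator

variable (m : ℕ) {E' : Type*} [NormedAddCommGroup E'] [NormedSpace ℝ E']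
  {H' : Type*} [TopologicalSpace H']

/-- The shape operator `A^i_j = ∑ k, g^{ik} ⟨ξ, ∇_{e_k} e_j⟩` at `p` of an immersed hypersurface
with respect to the unit normal vector `ξ`, as a matrix in the coordinate frame `e_1, …, e_m` of
the preferred chart at `p`; here `g^{ik}` is the inverse of the induced metric. -/
def shapeOperator (I' : ModelWithCorners ℝ E' H')
    {S : Type*} [TopologicalSpace S] [ChartedSpace (EuclideanSpace ℝ (Fin m)) S]
    {Q : Type*} [TopologicalSpace Q] [ChartedSpace H' Q]
    (g : FormField I' Q) (f : S → Q) (p : S) (ξ : TangentSpace I' (f p)) :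
    Matrix (Fin m) (Fin m) ℝ :=
  (Matrix.of fun i k => coordForm (𝓡 m) (pullbackForm (𝓡 m) I' g f) p (extChartAt (𝓡 m) p p)
      (EuclideanSpace.single i 1) (EuclideanSpace.single k 1))⁻¹
    * Matrix.of fun k j => secondFundamentalForm (𝓡 m) I' g f p ξ
      (EuclideanSpace.single k 1) (EuclideanSpace.single j 1)

/-- The mean curvature, the trace of the shape operator. -/
def meanCurvature (I' : ModelWithCorners ℝ E' H')
    {S : Type*} [TopologicalSpace S] [ChartedSpace (EuclideanSpace ℝ (Fin m)) S]
    {Q : Type*} [TopologicalSpace Q] [ChartedSpace H' Q]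
    (g : FormField I' Q) (f : S → Q) (p : S) (ξ : TangentSpace I' (f p)) : ℝ :=
  (shapeOperator m I' g f p ξ).trace

end ShapeOperator

section Curvature

variable {n : ℕ}

/-- Partial derivative of a function of `n` real variables. -/
def partialDeriv (i : Fin n) (u : EuclideanSpace ℝ (Fin n) → ℝ) (z : EuclideanSpace ℝ (Fin n)) :
    ℝ :=
  fderiv ℝ u z (EuclideanSpace.single i 1)

/-- The entries `G^{jk}` of the inverse of a metric in coordinates. -/
def inverseMetric
    (G : EuclideanSpace ℝ (Fin n) → EuclideanSpace ℝ (Fin n) → EuclideanSpace ℝ (Fin n) → ℝ)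
    (j k : Fin n) (z : EuclideanSpace ℝ (Fin n)) : ℝ :=
  (Matrix.of fun a b => G z (EuclideanSpace.single a 1) (EuclideanSpace.single b 1))⁻¹ j k

/-- The Christoffel symbols `Γ^k_{ij}`. -/
def christoffel
    (G : EuclideanSpace ℝ (Fin n) → EuclideanSpace ℝ (Fin n) → EuclideanSpace ℝ (Fin n) → ℝ)
    (k i j : Fin n) (z : EuclideanSpace ℝ (Fin n)) : ℝ :=
  ∑ l, inverseMetric G k l z * christoffelFirst G z
    (EuclideanSpace.single i 1) (EuclideanSpace.single j 1) (EuclideanSpace.single l 1)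

/-- The quadratic part `∑ i l, (Γ^i_{il} Γ^l_{jk} - Γ^i_{jl} Γ^l_{ik})` of the Ricci tensor. -/
def ricciQuadratic
    (G : EuclideanSpace ℝ (Fin n) → EuclideanSpace ℝ (Fin n) → EuclideanSpace ℝ (Fin n) → ℝ)
    (j k : Fin n) (z : EuclideanSpace ℝ (Fin n)) : ℝ :=
  ∑ i, ∑ l, (christoffel G i i l z * christoffel G l j k z
    - christoffel G i j l z * christoffel G l i k z)

/-- The components `Ric_{jk} = ∑ i, (∂_i Γ^i_{jk} - ∂_j Γ^i_{ik})
+ ∑ i l, (Γ^i_{il} Γ^l_{jk} - Γ^i_{jl} Γ^l_{ik})` of the Ricci tensor of a metric in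
coordinates. -/
def ricciCoord
    (G : EuclideanSpace ℝ (Fin n) → EuclideanSpace ℝ (Fin n) → EuclideanSpace ℝ (Fin n) → ℝ)
    (j k : Fin n) (z : EuclideanSpace ℝ (Fin n)) : ℝ :=
  ∑ i, (partialDeriv i (christoffel G i j k) z - partialDeriv j (christoffel G i i k) z)
    + ricciQuadratic G j k z

/-- The Ricci curvature `Ric_g (v, w)` at `q`. -/
def ricciCurvature {N : Type*} [TopologicalSpace N] [ChartedSpace (EuclideanSpace ℝ (Fin n)) N]
    (g : FormField (𝓡 n) N) (q : N) (v w : TangentSpace (𝓡 n) q) : ℝ :=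
  let a : EuclideanSpace ℝ (Fin n) :=
    mfderiv (𝓡 n) 𝓘(ℝ, EuclideanSpace ℝ (Fin n)) (extChartAt (𝓡 n) q) q v
  let b : EuclideanSpace ℝ (Fin n) :=
    mfderiv (𝓡 n) 𝓘(ℝ, EuclideanSpace ℝ (Fin n)) (extChartAt (𝓡 n) q) q w
  ∑ j, ∑ k, ricciCoord (coordForm (𝓡 n) g q) j k (extChartAt (𝓡 n) q q) * a j * b k

/-- The scalar curvature `R(g)` at `q` of a metric that is at least `C^2` in coordinates. -/
def scalarCurvature {N : Type*} [TopologicalSpace N] [ChartedSpace (EuclideanSpace ℝ (Fin n)) N]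
    (g : FormField (𝓡 n) N) (q : N) : ℝ :=
  ∑ j, ∑ k, inverseMetric (coordForm (𝓡 n) g q) j k (extChartAt (𝓡 n) q q)
    * ricciCoord (coordForm (𝓡 n) g q) j k (extChartAt (𝓡 n) q q)

/-- `ρ` is on the open set `U` the scalar curvature, in the sense of distributions, of the metric
`G` (which has to be only `C^1`): the identity `ρ = ∑ j k, G^{jk} Ric_{jk}` is tested against
`φ ∈ C_c^∞(U)`, and the derivatives of the Christoffel symbols are moved to `φ G^{jk}` by
integration by parts. -/
def IsDistributionalScalarCurvatureOn
    (G : EuclideanSpace ℝ (Fin n) → EuclideanSpace ℝ (Fin n) → EuclideanSpace ℝ (Fin n) → ℝ)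
    (U : Set (EuclideanSpace ℝ (Fin n))) (ρ : EuclideanSpace ℝ (Fin n) → ℝ) : Prop :=
  ∀ φ : EuclideanSpace ℝ (Fin n) → ℝ, ContDiff ℝ ∞ φ → HasCompactSupport φ → tsupport φ ⊆ U →
    ∫ z, ρ z * φ z
      = ∫ z, ∑ j, ∑ k,
          (∑ i, (partialDeriv j (fun y => φ y * inverseMetric G j k y) z * christoffel G i i k z
              - partialDeriv i (fun y => φ y * inverseMetric G j k y) z * christoffel G i j k z)
            + φ z * inverseMetric G j k z * ricciQuadratic G j k z)

/-- The metric `g`, of class `C^1` in coordinates, has scalar curvature `r` at `p`: near `p` its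
distributional scalar curvature is a continuous function, whose value at `p` is `r`. For metrics
of class `C^2` this is the usual scalar curvature. The metric induced on a `C^2` hypersurface is
in general only `C^1`. -/
def HasScalarCurvatureAt {M : Type*} [TopologicalSpace M]
    [ChartedSpace (EuclideanSpace ℝ (Fin n)) M]
    (g : FormField (𝓡 n) M) (p : M) (r : ℝ) : Prop :=
  ∃ U : Set (EuclideanSpace ℝ (Fin n)), IsOpen U ∧ extChartAt (𝓡 n) p p ∈ U ∧
    U ⊆ (extChartAt (𝓡 n) p).target ∧
    ∃ ρ : EuclideanSpace ℝ (Fin n) → ℝ, ContinuousOn ρ U ∧ ρ (extChartAt (𝓡 n) p p) = r ∧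
      IsDistributionalScalarCurvatureOn (coordForm (𝓡 n) g p) U ρ

end Curvature

end HypersurfaceGeometry

end

/-! At a point of Σ write ν = c η + τ ∂_t with c = ⟨ν, η⟩ and c² + τ² = 1. Regularity of ε gives c ≠
0, since otherwise dt would vanish on the tangent space of M. An orthonormal frame of Σ is completed
by e = -τ η + c ∂_t to an orthonormal frame of M (`exists_adapted_frame`). In this frame A is a
bordered matrix with some corner d, some border b, and lower right block c A_Σ. The block has this
form because the slices N × {ε} are totally geodesic (`hessianForm_productBilin`).

The contracted Gauss equation reads R(g^M) = R(g) - 2c² Ric(η, η) + H² - |A|². Indeed ∂_t is a flat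
direction, so e enters the ambient curvature only through -τ η (`frameCurvature_productBilin`,
`sum_frameCurvature_eq`). After substitution all curvature terms cancel. The difference of the two
sides of the inequality is then ½ c² |A_Σ°|² + |b|², where A_Σ° is the trace-free part
(`trace_mul_trace_sub_eq`). Equality therefore means A_Σ = κ Id and b = 0, and for umbilic Σ the
condition b = 0 is the statement on the multiplicity of c κ
(`le_finrank_eigenspace_borderedMatrix_iff`).

The analytic difficulty is that g^M is only C^1. If x is the immersion in coordinates, the lowered
Christoffel symbols of g^M are ⟨∇_a x_b, x_c⟩ and merely continuous. In the curvature combination of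
their derivatives the third derivatives of x cancel formally. The rigorous version is the identity ∫
∂_v f ∂_w g = ∫ ∂_w f ∂_v g for C^1 functions (`integral_fderiv_mul_fderiv_comm`). What remains
involves second derivatives of x only. Hence the distributional scalar curvature is the continuous
function `weakScalarCurvature`, it is unique by `HasScalarCurvatureAt.unique`, and the Gauss
equation for it is pointwise algebra (`IsPullbackOn.weakScalarCurvature_eq`). -/

/-! ### Integration by parts and commutation of weak derivatives for `C^1` functions. -/

section WeakDerivatives

variable {E : Type*} [NormedAddCommGroup E] [NormedSpace ℝ E]

/-- Near a point outside the support of `φ` the product vanishes identically, so `f` may be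
arbitrary off `U`. In this way coordinate expressions, regular only on a chart domain, become
globally regular integrands. -/
theorem contDiff_mul_of_tsupport_subset {k : ℕ∞} {φ f : E → ℝ} {U : Set E} (hU : IsOpen U)
    (hφ : ContDiff ℝ k φ) (hs : tsupport φ ⊆ U) (hf : ContDiffOn ℝ k f U) :
    ContDiff ℝ k (fun z => φ z * f z) := by
  rw [contDiff_iff_contDiffAt]
  intro z
  by_cases hz : z ∈ tsupport φ
  · exact hφ.contDiffAt.mul (hf.contDiffAt (hU.mem_nhds (hs hz)))
  · have h0 : φ =ᶠ[𝓝 z] 0 := notMem_tsupport_iff_eventuallyEq.1 hz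
    have h1 : (fun z => φ z * f z) =ᶠ[𝓝 z] fun _ => 0 := by
      filter_upwards [h0] with y hy
      simp [hy]
    exact contDiffAt_const.congr_of_eventuallyEq h1

theorem continuous_mul_of_tsupport_subset {φ f : E → ℝ} {U : Set E} (hU : IsOpen U)
    (hφ : Continuous φ) (hs : tsupport φ ⊆ U) (hf : ContinuousOn f U) :
    Continuous (fun z => φ z * f z) := by
  have := contDiff_mul_of_tsupport_subset (k := 0) hU (contDiff_zero.2 hφ) hs (contDiffOn_zero.2 hf)
  exact this.continuous

theorem fderiv_eq_zero_of_notMem_tsupport {F : Type*} [NormedAddCommGroup F] [NormedSpace ℝ F]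
    {φ : E → F} {z : E} (hz : z ∉ tsupport φ) : fderiv ℝ φ z = 0 := by
  have h0 : φ =ᶠ[𝓝 z] fun _ => 0 := notMem_tsupport_iff_eventuallyEq.1 hz
  rw [h0.fderiv_eq]
  simp

theorem tsupport_fderiv_apply_subset_tsupport (φ : E → ℝ) (v : E) :
    tsupport (fun z => fderiv ℝ φ z v) ⊆ tsupport φ := by
  refine closure_minimal ?_ (isClosed_tsupport φ)
  intro z hz
  by_contra h
  exact hz (by simp [fderiv_eq_zero_of_notMem_tsupport h])

theorem HasCompactSupport.fderiv_apply_const {φ : E → ℝ} (h : HasCompactSupport φ) (v : E) :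
    HasCompactSupport (fun z => fderiv ℝ φ z v) :=
  h.mono' (subset_closure.trans (tsupport_fderiv_apply_subset_tsupport φ v))

variable [FiniteDimensional ℝ E]

/-- The value 1 is taken on a neighbourhood of each point of `K`, so multiplication by `χ` preserves
derivatives there and not only values. -/
theorem exists_contDiff_hasCompactSupport_eventuallyEq_one {K U : Set E} (hK : IsCompact K)
    (hU : IsOpen U) (hKU : K ⊆ U) :
    ∃ χ : E → ℝ, ContDiff ℝ ∞ χ ∧ HasCompactSupport χ ∧ tsupport χ ⊆ U ∧
      ∀ z ∈ K, χ =ᶠ[𝓝 z] fun _ => 1 := by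
  obtain ⟨L, hL, hKL, hLU⟩ := exists_compact_between hK hU hKU
  obtain ⟨χ, h0, h1, -⟩ := exists_contMDiffMap_zero_one_nhds_of_isClosed 𝓘(ℝ, E) (n := ⊤)
    (s := (interior L)ᶜ) (t := K) isOpen_interior.isClosed_compl hK.isClosed
    (Set.disjoint_left.2 fun z hz hz' => hz (hKL hz'))
  have hsub : Function.support χ ⊆ L := by
    intro z hz
    by_contra hzL
    exact hz (h0.self_of_nhdsSet z (fun h => hzL (interior_subset h)))
  have ht : tsupport χ ⊆ L := closure_minimal hsub hL.isClosed
  refine ⟨χ, χ.contMDiff.contDiff, HasCompactSupport.of_support_subset_isCompact hL hsub,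
    ht.trans hLU, fun z hz => ?_⟩
  exact Filter.Eventually.filter_mono (nhds_le_nhdsSet hz) h1

variable [MeasurableSpace E] [BorelSpace E]
  (μ : Measure E) [μ.IsAddHaarMeasure]

theorem integral_fderiv_eq_zero {f : E → ℝ} (hf : ContDiff ℝ 1 f) (hs : HasCompactSupport f)
    (v : E) : ∫ z, fderiv ℝ f z v ∂μ = 0 := by
  have hc : Continuous (fun z => fderiv ℝ f z v) :=
    (hf.continuous_fderiv (by norm_num)).clm_apply continuous_const
  have i1 := hc.integrable_of_hasCompactSupport (μ := μ) (hs.fderiv_apply_const v)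
  have i2 := hf.continuous.integrable_of_hasCompactSupport (μ := μ) hs
  have h := integral_mul_fderiv_eq_neg_fderiv_mul_of_integrable (μ := μ) (f := fun _ : E => (1 : ℝ))
    (g := f) (v := v) (by simp) (by simpa using i1) (by simpa using i2)
    (fun x _ => by fun_prop) (fun x _ => (hf.differentiable (by norm_num)) x)
  simpa using h

/-- Formally both sides are `-∫ f ∂_v ∂_w g`, but `g` has only one derivative. A difference quotient
in direction `v` is used in place of `∂_v f`: for a fixed step it is `C^1`, so one can integrate by
parts in `w` and then move the difference to `g` by translation invariance. Only afterwards does the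
step tend to zero. -/
theorem integral_fderiv_mul_fderiv_comm_of_hasCompactSupport {f g : E → ℝ} (hf : ContDiff ℝ 1 f)
    (hfs : HasCompactSupport f) (hg : ContDiff ℝ 1 g) (hgs : HasCompactSupport g) (v w : E) :
    ∫ z, fderiv ℝ f z v * fderiv ℝ g z w ∂μ = ∫ z, fderiv ℝ f z w * fderiv ℝ g z v ∂μ := by
  obtain ⟨Cf, hCf⟩ := hf.lipschitzWith_of_hasCompactSupport hfs (by norm_num)
  obtain ⟨Cg, hCg⟩ := hg.lipschitzWith_of_hasCompactSupport hgs (by norm_num)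
  have hdf : Differentiable ℝ f := hf.differentiable (by norm_num)
  have hdg : Differentiable ℝ g := hg.differentiable (by norm_num)
  have cf : ∀ v, Continuous (fun z => fderiv ℝ f z v) := fun v =>
    (hf.continuous_fderiv (by norm_num)).clm_apply continuous_const
  have cg : ∀ v, Continuous (fun z => fderiv ℝ g z v) := fun v =>
    (hg.continuous_fderiv (by norm_num)).clm_apply continuous_const
  have A := LipschitzWith.integral_inv_smul_sub_mul_tendsto_integral_lineDeriv_mul (μ := μ) hCf
    ((cg w).integrable_of_hasCompactSupport (hgs.fderiv_apply_const w)) v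
  have B := LipschitzWith.integral_inv_smul_sub_mul_tendsto_integral_lineDeriv_mul (μ := μ) hCg
    ((cf w).integrable_of_hasCompactSupport (hfs.fderiv_apply_const w)) (-v)
  have key : ∀ t : ℝ, ∫ x, (t⁻¹ • (f (x + t • v) - f x)) * fderiv ℝ g x w ∂μ
      = - ∫ x, (t⁻¹ • (g (x + t • (-v)) - g x)) * fderiv ℝ f x w ∂μ := by
    intro t
    have hft : ContDiff ℝ 1 (fun x => f (x + t • v)) := hf.comp (by fun_prop)
    have hfts : HasCompactSupport (fun x => f (x + t • v)) :=
      hfs.comp_homeomorph (Homeomorph.addRight (t • v))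
    have hder : ∀ x, fderiv ℝ (fun x => f (x + t • v)) x w = fderiv ℝ f (x + t • v) w := by
      intro x
      rw [fderiv_comp_add_right]
    have ibp : ∀ F : E → ℝ, ContDiff ℝ 1 F → HasCompactSupport F →
        ∫ x, F x * fderiv ℝ g x w ∂μ = - ∫ x, fderiv ℝ F x w * g x ∂μ := by
      intro F hF hFs
      have cF : Continuous (fun z => fderiv ℝ F z w) :=
        (hF.continuous_fderiv (by norm_num)).clm_apply continuous_const
      refine integral_mul_fderiv_eq_neg_fderiv_mul_of_integrable
        ((cF.mul hg.continuous).integrable_of_hasCompactSupport hgs.mul_left)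
        ((hF.continuous.mul (cg w)).integrable_of_hasCompactSupport hFs.mul_right)
        ((hF.continuous.mul hg.continuous).integrable_of_hasCompactSupport hFs.mul_right)
        (fun x _ => hF.differentiable (by norm_num) x) (fun x _ => hdg x)
    have i1 : Integrable (fun x => f (x + t • v) * fderiv ℝ g x w) μ :=
      (hft.continuous.mul (cg w)).integrable_of_hasCompactSupport hfts.mul_right
    have i2 : Integrable (fun x => f x * fderiv ℝ g x w) μ :=
      (hf.continuous.mul (cg w)).integrable_of_hasCompactSupport hfs.mul_right
    have hgt : Continuous (fun x => g (x + t • (-v))) := hg.continuous.comp (by fun_prop)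
    have i3 : Integrable (fun x => g (x + t • (-v)) * fderiv ℝ f x w) μ :=
      (hgt.mul (cf w)).integrable_of_hasCompactSupport (hfs.fderiv_apply_const w).mul_left
    have i4 : Integrable (fun x => g x * fderiv ℝ f x w) μ :=
      (hg.continuous.mul (cf w)).integrable_of_hasCompactSupport (hfs.fderiv_apply_const w).mul_left
    have e1 := ibp _ hft hfts
    have e2 := ibp _ hf hfs
    have e3 : ∫ x, fderiv ℝ f (x + t • v) w * g x ∂μ
        = ∫ x, fderiv ℝ f x w * g (x + t • (-v)) ∂μ := by
      rw [← integral_add_right_eq_self (μ := μ) _ (t • (-v))]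
      simp
    simp only [hder] at e1
    simp only [smul_eq_mul, mul_assoc, integral_const_mul, sub_mul, ← mul_neg]
    rw [integral_sub i1 i2, integral_sub i3 i4, e1, e2, e3]
    simp only [mul_comm (fderiv ℝ f _ w)]
    ring
  simp only [key] at A
  -- The limit on the right is a derivative in direction `-v`, whose sign cancels the one from the
  -- integration by parts.
  have C := tendsto_nhds_unique A B.neg
  simp only [(hdf _).lineDeriv_eq_fderiv, (hdg _).lineDeriv_eq_fderiv, map_neg, neg_mul,
    integral_neg, neg_neg] at C
  rw [C]
  simp only [mul_comm]

/-- A cut-off equal to 1 near the support of `f` makes `g` global and compactly supported without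
changing the integrands. -/
theorem integral_fderiv_mul_fderiv_comm {U : Set E} (hU : IsOpen U) {f g : E → ℝ}
    (hf : ContDiff ℝ 1 f) (hfs : HasCompactSupport f) (hfU : tsupport f ⊆ U)
    (hg : ContDiffOn ℝ 1 g U) (v w : E) :
    ∫ z, fderiv ℝ f z v * fderiv ℝ g z w ∂μ = ∫ z, fderiv ℝ f z w * fderiv ℝ g z v ∂μ := by
  obtain ⟨χ, hχ, hχs, hχU, hχ1⟩ := exists_contDiff_hasCompactSupport_eventuallyEq_one hfs hU hfU
  have hG : ContDiff ℝ 1 (fun z => χ z * g z) :=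
    contDiff_mul_of_tsupport_subset (k := 1) hU (hχ.of_le (by norm_cast)) hχU hg
  have h := integral_fderiv_mul_fderiv_comm_of_hasCompactSupport μ hf hfs hG hχs.mul_right v w
  have e : ∀ v w z, fderiv ℝ f z v * fderiv ℝ (fun z => χ z * g z) z w
      = fderiv ℝ f z v * fderiv ℝ g z w := by
    intro v w z
    by_cases hz : z ∈ tsupport f
    · have : (fun z => χ z * g z) =ᶠ[𝓝 z] g := by
        filter_upwards [hχ1 z hz] with y hy
        simp [hy]
      rw [this.fderiv_eq]
    · simp [fderiv_eq_zero_of_notMem_tsupport hz]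
  simpa only [e] using h

/-- Commutation of weak derivatives, for the pairing of a compactly supported `C^1` field of
linear forms with a `C^1` vector-valued function. -/
theorem integral_fderiv_apply_fderiv_comm {F : Type*} [NormedAddCommGroup F] [NormedSpace ℝ F]
    [FiniteDimensional ℝ F] {U : Set E} (hU : IsOpen U) {Ψ : E → F →L[ℝ] ℝ} {u : E → F}
    (hΨ : ContDiff ℝ 1 Ψ) (hs : HasCompactSupport Ψ) (hsU : tsupport Ψ ⊆ U)
    (hu : ContDiffOn ℝ 1 u U) (v w : E) :
    ∫ z, fderiv ℝ Ψ z v (fderiv ℝ u z w) ∂μ = ∫ z, fderiv ℝ Ψ z w (fderiv ℝ u z v) ∂μ := by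
  -- In a basis of `F` the pairing is a finite sum of products of scalar functions, to which the
  -- scalar identity applies.
  let b := Module.finBasis ℝ F
  let P : ∀ i, F →L[ℝ] ℝ := fun i => LinearMap.toContinuousLinearMap (b.coord i)
  have hΨi : ∀ i, ContDiff ℝ 1 (fun z => Ψ z (b i)) := fun i => hΨ.clm_apply contDiff_const
  have hts : ∀ i, tsupport (fun z => Ψ z (b i)) ⊆ tsupport Ψ := by
    intro i
    refine closure_mono fun z hz hz' => hz ?_
    simp [hz']
  have hui : ∀ i, ContDiffOn ℝ 1 (fun z => P i (u z)) U := fun i =>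
    (P i).contDiff.comp_contDiffOn hu
  have hsi : ∀ i, HasCompactSupport (fun z => Ψ z (b i)) := fun i =>
    hs.mono' (subset_closure.trans (hts i))
  have hexp : ∀ v w z, fderiv ℝ Ψ z v (fderiv ℝ u z w)
      = ∑ i, fderiv ℝ (fun z => Ψ z (b i)) z v * fderiv ℝ (fun z => P i (u z)) z w := by
    intro v w z
    by_cases hz : z ∈ tsupport Ψ
    · have hd : DifferentiableAt ℝ u z :=
        (hu.contDiffAt (hU.mem_nhds (hsU hz))).differentiableAt (by norm_num)
      have hdΨ : DifferentiableAt ℝ Ψ z := hΨ.differentiable (by norm_num) z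
      have e1 : ∀ i, fderiv ℝ (fun z => Ψ z (b i)) z v = fderiv ℝ Ψ z v (b i) := by
        intro i
        have := (hdΨ.hasFDerivAt.clm_apply (hasFDerivAt_const (b i) z)).fderiv
        rw [this]
        simp
      have e2 : ∀ i, fderiv ℝ (fun z => P i (u z)) z w = b.coord i (fderiv ℝ u z w) := by
        intro i
        have := ((P i).hasFDerivAt.comp z hd.hasFDerivAt).fderiv
        change fderiv ℝ (P i ∘ u) z w = _
        rw [this]
        simp [P]
      simp only [e1, e2]
      conv_lhs => rw [← b.sum_repr (fderiv ℝ u z w)]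
      rw [map_sum]
      refine Finset.sum_congr rfl fun i _ => ?_
      rw [map_smul, smul_eq_mul, mul_comm, Module.Basis.coord_apply]
    · have : ∀ i, z ∉ tsupport (fun z => Ψ z (b i)) := fun i h => hz (hts i h)
      simp [fderiv_eq_zero_of_notMem_tsupport hz, fderiv_eq_zero_of_notMem_tsupport (this _)]
  have hint : ∀ v w i, Integrable (fun z => fderiv ℝ (fun z => Ψ z (b i)) z v
      * fderiv ℝ (fun z => P i (u z)) z w) μ := by
    intro v w i
    refine Continuous.integrable_of_hasCompactSupport ?_ ((hsi i).fderiv_apply_const v).mul_right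
    refine continuous_mul_of_tsupport_subset hU
      (((hΨi i).continuous_fderiv (by norm_num)).clm_apply continuous_const)
      (((tsupport_fderiv_apply_subset_tsupport _ v).trans (hts i)).trans hsU) ?_
    exact ((hui i).continuousOn_fderiv_of_isOpen hU (by norm_num)).clm_apply continuousOn_const
  simp only [hexp]
  rw [integral_finsetSum _ fun i _ => hint v w i, integral_finsetSum _ fun i _ => hint w v i]
  exact Finset.sum_congr rfl fun i _ =>
    integral_fderiv_mul_fderiv_comm μ hU (hΨi i) (hsi i) ((hts i).trans hsU) (hui i) v w

end WeakDerivatives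

/-! ### Regularity and derivative of the inverse of a matrix function. -/

section MatrixInverse

variable {E : Type*} [NormedAddCommGroup E] [NormedSpace ℝ E] {ι : Type*} [Fintype ι]
  [DecidableEq ι]

theorem contDiffAt_matrix_det {k : ℕ∞ω} {M : E → Matrix ι ι ℝ} {z : E}
    (hM : ∀ i j, ContDiffAt ℝ k (fun y => M y i j) z) :
    ContDiffAt ℝ k (fun y => (M y).det) z := by
  simp only [Matrix.det_apply]
  refine ContDiffAt.sum fun σ _ => ?_
  exact (contDiffAt_prod fun i _ => hM _ _).const_smul _

theorem contDiffAt_matrix_inv_apply {k : ℕ∞ω} {M : E → Matrix ι ι ℝ} {z : E}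
    (hM : ∀ i j, ContDiffAt ℝ k (fun y => M y i j) z) (hdet : (M z).det ≠ 0) (i j : ι) :
    ContDiffAt ℝ k (fun y => (M y)⁻¹ i j) z := by
  simp only [Matrix.inv_def, Ring.inverse_eq_inv, Matrix.smul_apply, smul_eq_mul,
    Matrix.adjugate_apply]
  refine ((contDiffAt_matrix_det hM).inv hdet).mul (contDiffAt_matrix_det fun a b => ?_)
  simp only [Matrix.updateRow_apply]
  split_ifs
  · exact contDiffAt_const
  · exact hM a b

/-- Differentiate `M⁻¹ M = 1`, which holds on a neighbourhood of `z` because nonvanishing of the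
determinant is an open condition. -/
theorem fderiv_matrix_inv_apply {M : E → Matrix ι ι ℝ} {z : E}
    (hM : ∀ i j, ContDiffAt ℝ 1 (fun y => M y i j) z) (hdet : (M z).det ≠ 0) (i j : ι) (v : E) :
    fderiv ℝ (fun y => (M y)⁻¹ i j) z v
      = -∑ a, ∑ b, (M z)⁻¹ i a * fderiv ℝ (fun y => M y a b) z v * (M z)⁻¹ b j := by
  have dM : ∀ i j, DifferentiableAt ℝ (fun y => M y i j) z := fun i j =>
    (hM i j).differentiableAt (by norm_num)
  have dI : ∀ i j, DifferentiableAt ℝ (fun y => (M y)⁻¹ i j) z := fun i j =>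
    (contDiffAt_matrix_inv_apply hM hdet i j).differentiableAt (by norm_num)
  let D1 : Matrix ι ι ℝ := Matrix.of fun i j => fderiv ℝ (fun y => (M y)⁻¹ i j) z v
  let D2 : Matrix ι ι ℝ := Matrix.of fun i j => fderiv ℝ (fun y => M y i j) z v
  have hunit : IsUnit (M z).det := isUnit_iff_ne_zero.2 hdet
  have hev : ∀ᶠ y in 𝓝 z, (M y).det ≠ 0 :=
    (contDiffAt_matrix_det hM).continuousAt.eventually_ne hdet
  have key : D1 * M z + (M z)⁻¹ * D2 = 0 := by
    ext i j
    have h1 : (fun y => ∑ a, (M y)⁻¹ i a * M y a j) =ᶠ[𝓝 z] fun _ => (1 : Matrix ι ι ℝ) i j := by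
      filter_upwards [hev] with y hy
      rw [← Matrix.mul_apply, Matrix.nonsing_inv_mul _ (isUnit_iff_ne_zero.2 hy)]
    have h2 := h1.fderiv_eq (𝕜 := ℝ)
    have h3 : HasFDerivAt (fun y => ∑ a, (M y)⁻¹ i a * M y a j) (∑ a, ((M z)⁻¹ i a •
        fderiv ℝ (fun y => M y a j) z + M z a j • fderiv ℝ (fun y => (M y)⁻¹ i a) z)) z :=
      HasFDerivAt.fun_sum fun a _ => (dI i a).hasFDerivAt.mul (dM a j).hasFDerivAt
    rw [h3.fderiv, fderiv_const_apply] at h2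
    have h4 := congrArg (fun L => L v) h2
    simp only [sum_apply, add_apply,
      smul_apply, smul_eq_mul, zero_apply] at h4
    simp only [Matrix.add_apply, Matrix.mul_apply, D1, D2, Matrix.of_apply, Matrix.zero_apply]
    rw [← h4, ← Finset.sum_add_distrib]
    exact Finset.sum_congr rfl fun a _ => by ring
  have h5 : D1 = -((M z)⁻¹ * D2 * (M z)⁻¹) := by
    have : D1 * M z * (M z)⁻¹ = -((M z)⁻¹ * D2) * (M z)⁻¹ := by
      rw [eq_neg_of_add_eq_zero_left key]
    rwa [Matrix.mul_assoc, Matrix.mul_nonsing_inv _ hunit, Matrix.mul_one, neg_mul] at this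
  have h6 := congrFun (congrFun h5 i) j
  simp only [D1, Matrix.of_apply, Matrix.neg_apply, Matrix.mul_apply, D2] at h6
  rw [h6, Finset.sum_comm]
  simp only [Finset.sum_mul]

end MatrixInverse

/-! ### The Ricci tensor in terms of Christoffel symbols of the first kind. -/

namespace HypersurfaceGeometry

/-- The algebraic identity behind the covariant form of the Ricci tensor: `g` plays the role of
the inverse metric, `C` of the Christoffel symbols of the first kind. -/
theorem sum_christoffel_quadratic {ι : Type*} [Fintype ι] (g : ι → ι → ℝ) (C : ι → ι → ι → ℝ)
    (hg : ∀ i j, g i j = g j i) (dg : ι → ι → ι → ℝ)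
    (hdg : ∀ i j l, dg i j l = -∑ a, ∑ b, g j a * (C i a b + C i b a) * g b l)
    (Γ : ι → ι → ι → ℝ) (hΓ : ∀ k i j, Γ k i j = ∑ l, g k l * C i j l) (j k : ι) :
    ∑ i, ∑ l, (dg i i l * C j k l - dg j i l * C i k l)
      + ∑ i, ∑ l, (Γ i i l * Γ l j k - Γ i j l * Γ l i k)
      = ∑ i, ∑ l, g i l * ∑ m, ∑ r, g m r * (-C j k m * C i l r + C i k m * C j l r) := by
  -- One of the two terms of `dg` assembles into `Γ`. When `Y` is itself a Christoffel symbol, this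
  -- part is minus a product `Γ Γ` and cancels the quadratic part of the Ricci tensor.
  have h1 : ∀ d i (Y : ι → ℝ), ∑ l, dg d i l * Y l
      = -(∑ a, g i a * ∑ b, C d a b * ∑ l, g b l * Y l)
        - ∑ b, Γ i d b * ∑ l, g b l * Y l := by
    intro d i Y
    simp only [hdg, hΓ, neg_mul, Finset.sum_mul, Finset.mul_sum, Finset.sum_neg_distrib]
    rw [Finset.sum_comm]
    have e : ∑ b, ∑ l, ∑ a, g i a * C d b a * (g b l * Y l)
        = ∑ a, ∑ b, ∑ l, g i a * C d b a * (g b l * Y l) := Finset.sum_comm_cycle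
    rw [e, ← neg_add', ← Finset.sum_add_distrib]
    congr 1
    refine Finset.sum_congr rfl fun a _ => ?_
    rw [Finset.sum_comm, ← Finset.sum_add_distrib]
    refine Finset.sum_congr rfl fun b _ => ?_
    rw [← Finset.sum_add_distrib]
    refine Finset.sum_congr rfl fun l _ => by ring
  have h2 : ∀ i l, ∑ m, ∑ r, g m r * (-C j k m * C i l r + C i k m * C j l r)
      = -(∑ b, C i l b * Γ b j k) + ∑ b, C j l b * Γ b i k := by
    intro i l
    rw [Finset.sum_comm]
    simp only [hΓ, Finset.mul_sum]
    rw [← Finset.sum_neg_distrib, ← Finset.sum_add_distrib]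
    refine Finset.sum_congr rfl fun b _ => ?_
    rw [← Finset.sum_neg_distrib, ← Finset.sum_add_distrib]
    refine Finset.sum_congr rfl fun m _ => ?_
    rw [hg m b]
    ring
  rw [← Finset.sum_add_distrib]
  simp only [Finset.sum_sub_distrib, h1, ← hΓ, h2]
  refine Finset.sum_congr rfl fun i _ => ?_
  simp only [mul_add, mul_neg, Finset.sum_add_distrib, Finset.sum_neg_distrib]
  ring

section Coordinates

variable {n : ℕ}
  {G : EuclideanSpace ℝ (Fin n) → EuclideanSpace ℝ (Fin n) → EuclideanSpace ℝ (Fin n) → ℝ}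
  {z : EuclideanSpace ℝ (Fin n)}

/-- `G` is near `z` a symmetric and at `z` a nondegenerate metric tensor, of class `C^1` at `z`. -/
structure IsC1MetricAt
    (G : EuclideanSpace ℝ (Fin n) → EuclideanSpace ℝ (Fin n) → EuclideanSpace ℝ (Fin n) → ℝ)
    (z : EuclideanSpace ℝ (Fin n)) : Prop where
  contDiffAt : ∀ a b : Fin n, ContDiffAt ℝ 1
    (fun y => G y (EuclideanSpace.single a 1) (EuclideanSpace.single b 1)) z
  symm : ∀ᶠ y in 𝓝 z, ∀ a b, G y a b = G y b a
  det_ne_zero : (Matrix.of fun a b : Fin n =>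
    G z (EuclideanSpace.single a 1) (EuclideanSpace.single b 1)).det ≠ 0

/-- The Christoffel symbols of the first kind in the coordinate frame. -/
noncomputable def christoffelFirstCoord
    (G : EuclideanSpace ℝ (Fin n) → EuclideanSpace ℝ (Fin n) → EuclideanSpace ℝ (Fin n) → ℝ)
    (i j l : Fin n) (z : EuclideanSpace ℝ (Fin n)) : ℝ :=
  christoffelFirst G z (EuclideanSpace.single i 1) (EuclideanSpace.single j 1)
    (EuclideanSpace.single l 1)

theorem christoffel_eq_sum (k i j : Fin n) (z : EuclideanSpace ℝ (Fin n)) :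
    christoffel G k i j z = ∑ l, inverseMetric G k l z * christoffelFirstCoord G i j l z := rfl

theorem IsC1MetricAt.fderiv_symm (h : IsC1MetricAt G z) (a b v : EuclideanSpace ℝ (Fin n)) :
    fderiv ℝ (fun y => G y a b) z v = fderiv ℝ (fun y => G y b a) z v := by
  have : (fun y => G y a b) =ᶠ[𝓝 z] fun y => G y b a := by
    filter_upwards [h.symm] with y hy using hy a b
  rw [this.fderiv_eq]

/-- Metric compatibility of the Levi-Civita connection, in coordinates. -/
theorem IsC1MetricAt.partialDeriv_eq (h : IsC1MetricAt G z) (i a b : Fin n) :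
    fderiv ℝ (fun y => G y (EuclideanSpace.single a 1) (EuclideanSpace.single b 1)) z
      (EuclideanSpace.single i 1) = christoffelFirstCoord G i a b z
        + christoffelFirstCoord G i b a z := by
  simp only [christoffelFirstCoord, christoffelFirst]
  rw [h.fderiv_symm (EuclideanSpace.single b 1) (EuclideanSpace.single a 1),
    h.fderiv_symm (EuclideanSpace.single i 1) (EuclideanSpace.single a 1),
    h.fderiv_symm (EuclideanSpace.single i 1) (EuclideanSpace.single b 1)]
  ring

theorem IsC1MetricAt.contDiffAt_inverseMetric (h : IsC1MetricAt G z) (j k : Fin n) :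
    ContDiffAt ℝ 1 (inverseMetric G j k) z :=
  contDiffAt_matrix_inv_apply (M := fun y => Matrix.of fun a b : Fin n =>
    G y (EuclideanSpace.single a 1) (EuclideanSpace.single b 1)) h.contDiffAt h.det_ne_zero j k

theorem IsC1MetricAt.differentiableAt_inverseMetric (h : IsC1MetricAt G z) (j k : Fin n) :
    DifferentiableAt ℝ (inverseMetric G j k) z :=
  (h.contDiffAt_inverseMetric j k).differentiableAt (by norm_num)

theorem IsC1MetricAt.inverseMetric_symm (h : IsC1MetricAt G z) (j k : Fin n) :
    inverseMetric G j k z = inverseMetric G k j z := by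
  have hs : (Matrix.of fun a b : Fin n =>
      G z (EuclideanSpace.single a 1) (EuclideanSpace.single b 1)).transpose
      = Matrix.of fun a b : Fin n =>
        G z (EuclideanSpace.single a 1) (EuclideanSpace.single b 1) := by
    ext a b
    simp only [Matrix.transpose_apply, Matrix.of_apply]
    exact h.symm.self_of_nhds _ _
  have := Matrix.transpose_nonsing_inv (Matrix.of fun a b : Fin n =>
      G z (EuclideanSpace.single a 1) (EuclideanSpace.single b 1))
  rw [hs] at this
  exact (congrFun (congrFun this k) j)

theorem IsC1MetricAt.partialDeriv_inverseMetric (h : IsC1MetricAt G z) (i j l : Fin n) :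
    partialDeriv i (inverseMetric G j l) z = -∑ a, ∑ b, inverseMetric G j a z *
      (christoffelFirstCoord G i a b z + christoffelFirstCoord G i b a z)
        * inverseMetric G b l z := by
  have := fderiv_matrix_inv_apply (M := fun y => Matrix.of fun a b : Fin n =>
    G y (EuclideanSpace.single a 1) (EuclideanSpace.single b 1)) h.contDiffAt h.det_ne_zero j l
    (EuclideanSpace.single i 1)
  simp only [Matrix.of_apply, h.partialDeriv_eq] at this
  exact this

/-- The quadratic terms of `R^m_{ijk} g_{ml}` in terms of the Christoffel symbols of the
first kind. -/
noncomputable def riemannQuadratic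
    (G : EuclideanSpace ℝ (Fin n) → EuclideanSpace ℝ (Fin n) → EuclideanSpace ℝ (Fin n) → ℝ)
    (i j k l : Fin n) (z : EuclideanSpace ℝ (Fin n)) : ℝ :=
  ∑ m, ∑ r, inverseMetric G m r z *
    (-christoffelFirstCoord G j k m z * christoffelFirstCoord G i l r z
      + christoffelFirstCoord G i k m z * christoffelFirstCoord G j l r z)

/-- Lowering the index of a Christoffel symbol under a derivative leaves derivatives of the inverse
metric, which are absorbed here into the quadratic part. No second derivative of `G` occurs, so the
identity serves the classical Ricci tensor and the distributional formula alike. -/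
theorem IsC1MetricAt.sum_add_ricciQuadratic (h : IsC1MetricAt G z) (j k : Fin n) :
    ∑ i, ∑ l, (partialDeriv i (inverseMetric G i l) z * christoffelFirstCoord G j k l z
      - partialDeriv j (inverseMetric G i l) z * christoffelFirstCoord G i k l z)
      + ricciQuadratic G j k z
      = ∑ i, ∑ l, inverseMetric G i l z * riemannQuadratic G i j k l z :=
  sum_christoffel_quadratic (fun i j => inverseMetric G i j z)
    (fun i j l => christoffelFirstCoord G i j l z) (h.inverseMetric_symm)
    (fun i j l => partialDeriv i (inverseMetric G j l) z) (h.partialDeriv_inverseMetric)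
    (fun k i j => christoffel G k i j z) (fun _ _ _ => rfl) j k

theorem IsC1MetricAt.ricciCoord_eq (h : IsC1MetricAt G z)
    (hC : ∀ i j l, DifferentiableAt ℝ (christoffelFirstCoord G i j l) z) (j k : Fin n) :
    ricciCoord G j k z = ∑ i, ∑ l, inverseMetric G i l z *
      (partialDeriv i (christoffelFirstCoord G j k l) z
        - partialDeriv j (christoffelFirstCoord G i k l) z + riemannQuadratic G i j k l z) := by
  have hd : ∀ d k i j, partialDeriv d (christoffel G k i j) z
      = ∑ l, (inverseMetric G k l z * partialDeriv d (christoffelFirstCoord G i j l) z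
        + partialDeriv d (inverseMetric G k l) z * christoffelFirstCoord G i j l z) := by
    intro d k i j
    have : HasFDerivAt (christoffel G k i j) (∑ l, (inverseMetric G k l z •
        fderiv ℝ (christoffelFirstCoord G i j l) z + christoffelFirstCoord G i j l z •
        fderiv ℝ (inverseMetric G k l) z)) z :=
      HasFDerivAt.fun_sum fun l _ =>
        (h.differentiableAt_inverseMetric k l).hasFDerivAt.mul (hC i j l).hasFDerivAt
    simp only [partialDeriv, this.fderiv, sum_apply,
      add_apply, smul_apply, smul_eq_mul]
    exact Finset.sum_congr rfl fun l _ => by ring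
  simp only [mul_add, Finset.sum_add_distrib, ← h.sum_add_ricciQuadratic, ricciCoord, hd]
  rw [← add_assoc]
  congr 1
  simp only [← Finset.sum_add_distrib, ← Finset.sum_sub_distrib]
  exact Finset.sum_congr rfl fun i _ => Finset.sum_congr rfl fun l _ => by ring

/-- The second inverse metric is moved onto the test function too, so that derivatives are tested
against lowered symbols. For an induced metric these have an explicit expression in the derivatives
of the map. -/
theorem IsC1MetricAt.distributional_integrand_eq (h : IsC1MetricAt G z)
    {φ : EuclideanSpace ℝ (Fin n) → ℝ} (hφ : DifferentiableAt ℝ φ z) :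
    ∑ j, ∑ k, (∑ i, (partialDeriv j (fun y => φ y * inverseMetric G j k y) z * christoffel G i i k z
        - partialDeriv i (fun y => φ y * inverseMetric G j k y) z * christoffel G i j k z)
      + φ z * inverseMetric G j k z * ricciQuadratic G j k z)
    = ∑ j, ∑ k, ∑ i, ∑ l,
      (partialDeriv j (fun y => φ y * (inverseMetric G j k y * inverseMetric G i l y)) z
          * christoffelFirstCoord G i k l z
        - partialDeriv i (fun y => φ y * (inverseMetric G j k y * inverseMetric G i l y)) z
          * christoffelFirstCoord G j k l z
        + φ z * (inverseMetric G j k z * inverseMetric G i l z) * riemannQuadratic G i j k l z) := by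
  refine Finset.sum_congr rfl fun j _ => Finset.sum_congr rfl fun k _ => ?_
  have h1 : ∀ d i l, partialDeriv d (fun y => φ y * (inverseMetric G j k y * inverseMetric G i l y)) z
      = partialDeriv d (fun y => φ y * inverseMetric G j k y) z * inverseMetric G i l z
        + φ z * inverseMetric G j k z * partialDeriv d (inverseMetric G i l) z := by
    intro d i l
    have e : (fun y => φ y * (inverseMetric G j k y * inverseMetric G i l y))
        = fun y => (φ y * inverseMetric G j k y) * inverseMetric G i l y := by
      ext y; ring
    have hd : DifferentiableAt ℝ (fun y => φ y * inverseMetric G j k y) z :=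
      hφ.mul (h.differentiableAt_inverseMetric j k)
    rw [e]
    simp only [partialDeriv]
    rw [fderiv_fun_mul hd (h.differentiableAt_inverseMetric i l)]
    simp only [add_apply, smul_apply, smul_eq_mul]
    ring
  have h2 := h.sum_add_ricciQuadratic j k
  rw [← eq_sub_iff_add_eq'] at h2
  rw [h2]
  simp only [h1, christoffel_eq_sum, mul_sub, Finset.mul_sum]
  simp only [← Finset.sum_add_distrib, ← Finset.sum_sub_distrib]
  exact Finset.sum_congr rfl fun i _ => Finset.sum_congr rfl fun l _ => by ring

end Coordinates

end HypersurfaceGeometry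

/-! ### Distributional curvature of the metric induced by a `C^2` map. -/

theorem contDiff_smul_of_tsupport_subset {E F : Type*} [NormedAddCommGroup E] [NormedSpace ℝ E]
    [NormedAddCommGroup F] [NormedSpace ℝ F] {k : ℕ∞} {φ : E → ℝ} {f : E → F} {U : Set E}
    (hU : IsOpen U) (hφ : ContDiff ℝ k φ) (hs : tsupport φ ⊆ U) (hf : ContDiffOn ℝ k f U) :
    ContDiff ℝ k (fun z => φ z • f z) := by
  rw [contDiff_iff_contDiffAt]
  intro z
  by_cases hz : z ∈ tsupport φ
  · exact hφ.contDiffAt.smul (hf.contDiffAt (hU.mem_nhds (hs hz)))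
  · have h0 : φ =ᶠ[𝓝 z] 0 := notMem_tsupport_iff_eventuallyEq.1 hz
    have h1 : (fun z => φ z • f z) =ᶠ[𝓝 z] fun _ => 0 := by
      filter_upwards [h0] with y hy
      simp [hy]
    exact contDiffAt_const.congr_of_eventuallyEq h1

theorem integrable_mul_of_tsupport_subset {E : Type*} [NormedAddCommGroup E] [NormedSpace ℝ E]
    [MeasurableSpace E] [BorelSpace E] {μ : Measure E} [IsFiniteMeasureOnCompacts μ]
    {φ f : E → ℝ} {U : Set E} (hU : IsOpen U)
    (hφ : Continuous φ) (hc : HasCompactSupport φ) (hs : tsupport φ ⊆ U) (hf : ContinuousOn f U) :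
    Integrable (fun z => φ z * f z) μ :=
  (continuous_mul_of_tsupport_subset hU hφ hs hf).integrable_of_hasCompactSupport hc.mul_right

theorem integrable_fun_sub {E : Type*} [MeasurableSpace E] {μ : Measure E} {f g : E → ℝ}
    (hf : Integrable f μ) (hg : Integrable g μ) : Integrable (fun z => f z - g z) μ :=
  hf.sub hg

namespace HypersurfaceGeometry

set_option maxSynthPendingDepth 3

section Pullback

variable {E E' : Type*} [NormedAddCommGroup E] [NormedSpace ℝ E]
  [NormedAddCommGroup E'] [NormedSpace ℝ E']

/-- Christoffel symbols of the first kind of a metric `B`, given as a field of continuous bilinear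
forms. -/
noncomputable def lowerChristoffel (B : E' → E' →L[ℝ] E' →L[ℝ] ℝ) (w a b c : E') : ℝ :=
  (fderiv ℝ B w a b c + fderiv ℝ B w b a c - fderiv ℝ B w c a b) / 2

/-- The linear form `⟨·, ∂_c x⟩` along a map `x`. -/
noncomputable def tangentForm (B : E' → E' →L[ℝ] E' →L[ℝ] ℝ) (x : E → E') (c y : E) :
    E' →L[ℝ] ℝ :=
  B (x y) (fderiv ℝ x y c)

/-- The Christoffel symbols of the first kind of the ambient metric along a map `x`. -/
noncomputable def pullbackChristoffel (B : E' → E' →L[ℝ] E' →L[ℝ] ℝ) (x : E → E') (a b c y : E) :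
    ℝ :=
  lowerChristoffel B (x y) (fderiv ℝ x y a) (fderiv ℝ x y b) (fderiv ℝ x y c)

/-- The part of `∂_a ⟨∇_b x_c, x_d⟩ - ∂_b ⟨∇_a x_c, x_d⟩` which remains when the third derivatives
of `x` are cancelled. -/
noncomputable def weakCurvature (B : E' → E' →L[ℝ] E' →L[ℝ] ℝ) (x : E → E') (z a b c d : E) : ℝ :=
  fderiv ℝ (tangentForm B x d) z a (fderiv ℝ (fderiv ℝ x) z b c)
    - fderiv ℝ (tangentForm B x d) z b (fderiv ℝ (fderiv ℝ x) z a c)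
    + fderiv ℝ (pullbackChristoffel B x b c d) z a
    - fderiv ℝ (pullbackChristoffel B x a c d) z b

/-- On the open set `U`, `x` is a `C^2` map into the open set `V`, on which there is a symmetric
form field `B` of class `C^2`, and `G` is the pull-back of `B` under `x`. -/
structure IsPullbackOn (B : E' → E' →L[ℝ] E' →L[ℝ] ℝ) (V : Set E') (x : E → E') (U : Set E)
    (G : E → E → E → ℝ) : Prop where
  isOpen_source : IsOpen U
  isOpen_target : IsOpen V
  contDiffOn_map : ContDiffOn ℝ 2 x U
  mapsTo : Set.MapsTo x U V
  contDiffOn_form : ContDiffOn ℝ 2 B V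
  symm : ∀ w ∈ V, ∀ a b, B w a b = B w b a
  eq_pullback : ∀ z ∈ U, ∀ a b, G z a b = B (x z) (fderiv ℝ x z a) (fderiv ℝ x z b)

namespace IsPullbackOn

variable {B : E' → E' →L[ℝ] E' →L[ℝ] ℝ} {V : Set E'} {x : E → E'} {U : Set E} {G : E → E → E → ℝ}
  (H : IsPullbackOn B V x U G)
include H

theorem contDiffOn_fderiv : ContDiffOn ℝ 1 (fderiv ℝ x) U :=
  H.contDiffOn_map.fderiv_of_isOpen H.isOpen_source (by norm_num)

theorem contDiffOn_fderiv_apply (c : E) : ContDiffOn ℝ 1 (fun y => fderiv ℝ x y c) U :=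
  H.contDiffOn_fderiv.clm_apply contDiffOn_const

theorem contDiffOn_comp : ContDiffOn ℝ 1 (fun y => B (x y)) U :=
  (H.contDiffOn_form.comp H.contDiffOn_map H.mapsTo).of_le (by norm_num)

theorem contDiffOn_fderiv_comp : ContDiffOn ℝ 1 (fun y => fderiv ℝ B (x y)) U :=
  (H.contDiffOn_form.fderiv_of_isOpen (m := 1) H.isOpen_target (by norm_num)).comp
    (H.contDiffOn_map.of_le (by norm_num)) H.mapsTo

theorem contDiffOn_tangentForm (c : E) : ContDiffOn ℝ 1 (tangentForm B x c) U :=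
  H.contDiffOn_comp.clm_apply (H.contDiffOn_fderiv_apply c)

theorem contDiffOn_pullbackChristoffel (a b c : E) :
    ContDiffOn ℝ 1 (pullbackChristoffel B x a b c) U := by
  have h : ∀ a b c, ContDiffOn ℝ 1
      (fun y => fderiv ℝ B (x y) (fderiv ℝ x y a) (fderiv ℝ x y b) (fderiv ℝ x y c)) U :=
    fun a b c => ((H.contDiffOn_fderiv_comp.clm_apply (H.contDiffOn_fderiv_apply a)).clm_apply
      (H.contDiffOn_fderiv_apply b)).clm_apply (H.contDiffOn_fderiv_apply c)
  exact (((h a b c).add (h b a c)).sub (h c a b)).div_const 2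

variable {z : E} (hz : z ∈ U)
include hz

theorem contDiffAt_of_contDiffOn {F : Type*} [NormedAddCommGroup F] [NormedSpace ℝ F] {k : ℕ∞ω}
    {f : E → F} (hf : ContDiffOn ℝ k f U) : ContDiffAt ℝ k f z :=
  hf.contDiffAt (H.isOpen_source.mem_nhds hz)

theorem hasFDerivAt_fderiv_apply (c : E) :
    HasFDerivAt (fun y => fderiv ℝ x y c) ((fderiv ℝ (fderiv ℝ x) z).flip c) z := by
  have h := ((H.contDiffAt_of_contDiffOn hz H.contDiffOn_fderiv).differentiableAt
    (by norm_num)).hasFDerivAt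
  have h1 := h.clm_apply (hasFDerivAt_const c z)
  refine h1.congr_fderiv ?_
  ext v
  simp

theorem fderiv_fderiv_symm (a b : E) :
    fderiv ℝ (fderiv ℝ x) z a b = fderiv ℝ (fderiv ℝ x) z b a :=
  (H.contDiffAt_of_contDiffOn hz H.contDiffOn_map).isSymmSndFDerivAt (by simp) a b

theorem fderiv_pullback (a b c : E) : fderiv ℝ (fun y => G y b c) z a
    = fderiv ℝ B (x z) (fderiv ℝ x z a) (fderiv ℝ x z b) (fderiv ℝ x z c)
      + B (x z) (fderiv ℝ (fderiv ℝ x) z a b) (fderiv ℝ x z c)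
      + B (x z) (fderiv ℝ x z b) (fderiv ℝ (fderiv ℝ x) z a c) := by
  have he : (fun y => G y b c) =ᶠ[𝓝 z] fun y => B (x y) (fderiv ℝ x y b) (fderiv ℝ x y c) := by
    filter_upwards [H.isOpen_source.mem_nhds hz] with y hy using H.eq_pullback y hy b c
  have hx : HasFDerivAt x (fderiv ℝ x z) z :=
    ((H.contDiffAt_of_contDiffOn hz H.contDiffOn_map).differentiableAt (by norm_num)).hasFDerivAt
  have hB : HasFDerivAt B (fderiv ℝ B (x z)) (x z) :=
    ((H.contDiffOn_form.contDiffAt (H.isOpen_target.mem_nhds (H.mapsTo hz))).differentiableAt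
      (by norm_num)).hasFDerivAt
  have h := ((hB.comp z hx).clm_apply (H.hasFDerivAt_fderiv_apply hz b)).clm_apply
    (H.hasFDerivAt_fderiv_apply hz c)
  rw [he.fderiv_eq]
  have h2 := congrArg (fun L => L a) h.fderiv
  refine h2.trans ?_
  simp
  ring

/-- This is `⟨∇_a x_b, x_c⟩`. Of the six terms with second derivatives of `x`, symmetry of `D²x` and
of `B` cancels four, and the other two coincide. -/
theorem christoffelFirst_eq (a b c : E) : christoffelFirst G z a b c
    = tangentForm B x c z (fderiv ℝ (fderiv ℝ x) z a b) + pullbackChristoffel B x a b c z := by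
  have hs := H.symm _ (H.mapsTo hz)
  simp only [christoffelFirst, H.fderiv_pullback hz, pullbackChristoffel, lowerChristoffel,
    tangentForm]
  rw [H.fderiv_fderiv_symm hz b a, H.fderiv_fderiv_symm hz c a, H.fderiv_fderiv_symm hz c b,
    hs (fderiv ℝ x z b), hs (fderiv ℝ x z a), hs (fderiv ℝ x z c)]
  ring

omit hz

theorem continuousOn_weakCurvature (a b c d : E) :
    ContinuousOn (fun z => weakCurvature B x z a b c d) U := by
  have h1 : ∀ a c, ContinuousOn (fun z => fderiv ℝ (fderiv ℝ x) z a c) U := fun a c =>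
    ((H.contDiffOn_fderiv.continuousOn_fderiv_of_isOpen H.isOpen_source (by norm_num)).clm_apply
      continuousOn_const).clm_apply continuousOn_const
  have h2 : ∀ d a, ContinuousOn (fun z => fderiv ℝ (tangentForm B x d) z a) U := fun d a =>
    ((H.contDiffOn_tangentForm d).continuousOn_fderiv_of_isOpen H.isOpen_source
      (by norm_num)).clm_apply continuousOn_const
  have h3 : ∀ b c d a, ContinuousOn (fun z => fderiv ℝ (pullbackChristoffel B x b c d) z a) U :=
    fun b c d a => ((H.contDiffOn_pullbackChristoffel b c d).continuousOn_fderiv_of_isOpen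
      H.isOpen_source (by norm_num)).clm_apply continuousOn_const
  exact ((((h2 d a).clm_apply (h1 b c)).sub ((h2 d b).clm_apply (h1 a c))).add (h3 b c d a)).sub
    (h3 a c d b)

theorem continuousOn_christoffelFirst (a b c : E) :
    ContinuousOn (fun z => christoffelFirst G z a b c) U := by
  have h1 : ContinuousOn (fun z => fderiv ℝ (fderiv ℝ x) z a b) U :=
    ((H.contDiffOn_fderiv.continuousOn_fderiv_of_isOpen H.isOpen_source (by norm_num)).clm_apply
      continuousOn_const).clm_apply continuousOn_const
  refine (((H.contDiffOn_tangentForm c).continuousOn.clm_apply h1).add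
    (H.contDiffOn_pullbackChristoffel a b c).continuousOn).congr fun z hz => ?_
  exact H.christoffelFirst_eq hz a b c

/-- The weak form of the relation between the first derivatives of the Christoffel symbols and the
curvature, for the metric induced by a `C^2` map. -/
theorem integral_fderiv_mul_christoffelFirst [FiniteDimensional ℝ E] [FiniteDimensional ℝ E']
    [MeasurableSpace E] [BorelSpace E] (μ : Measure E) [μ.IsAddHaarMeasure]
    {ψ : E → ℝ} (hψ : ContDiff ℝ 1 ψ) (hc : HasCompactSupport ψ) (hψU : tsupport ψ ⊆ U)
    (a b c d : E) :
    ∫ z, (fderiv ℝ ψ z b * christoffelFirst G z a c d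
        - fderiv ℝ ψ z a * christoffelFirst G z b c d) ∂μ
      = ∫ z, ψ z * weakCurvature B x z a b c d ∂μ := by
  have hU := H.isOpen_source
  have hΨ : ContDiff ℝ 1 (fun z => ψ z • tangentForm B x d z) :=
    contDiff_smul_of_tsupport_subset (k := 1) hU hψ hψU (H.contDiffOn_tangentForm d)
  have hΨs : tsupport (fun z => ψ z • tangentForm B x d z) ⊆ tsupport ψ :=
    closure_mono (Function.support_smul_subset_left ψ _)
  have hΨc : HasCompactSupport (fun z => ψ z • tangentForm B x d z) :=
    hc.mono (Function.support_smul_subset_left ψ _)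
  have hT : ∀ a c, ContDiff ℝ 1 (fun z => ψ z * pullbackChristoffel B x a c d z) := fun a c =>
    contDiff_mul_of_tsupport_subset (k := 1) hU hψ hψU (H.contDiffOn_pullbackChristoffel a c d)
  have hTc : ∀ a c, HasCompactSupport (fun z => ψ z * pullbackChristoffel B x a c d z) :=
    fun a c => hc.mul_right
  -- The weak counterpart of the cancellation of third derivatives of `x`, for the form `ψ ⟨·, x_d⟩`
  -- paired with the vector function `x_c`.
  have e1 := integral_fderiv_apply_fderiv_comm μ hU hΨ hΨc (hΨs.trans hψU)
    (H.contDiffOn_fderiv_apply c) b a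
  have e2 := integral_fderiv_eq_zero μ (hT a c) (hTc a c) b
  have e3 := integral_fderiv_eq_zero μ (hT b c) (hTc b c) a
  have cT : ∀ a c v, Continuous
      (fun z => fderiv ℝ (fun z => ψ z * pullbackChristoffel B x a c d z) z v) := fun a c v =>
    ((hT a c).continuous_fderiv (by norm_num)).clm_apply continuous_const
  have iT : ∀ a c v, Integrable
      (fun z => fderiv ℝ (fun z => ψ z * pullbackChristoffel B x a c d z) z v) μ := fun a c v =>
    (cT a c v).integrable_of_hasCompactSupport ((hTc a c).fderiv_apply_const v)
  have iΓ : ∀ a c v, Integrable (fun z => fderiv ℝ ψ z v * christoffelFirst G z a c d) μ :=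
    fun a c v => integrable_mul_of_tsupport_subset hU
      ((hψ.continuous_fderiv (by norm_num)).clm_apply continuous_const) (hc.fderiv_apply_const v)
      ((tsupport_fderiv_apply_subset_tsupport ψ v).trans hψU)
      (H.continuousOn_christoffelFirst a c d)
  have iK : Integrable (fun z => ψ z * weakCurvature B x z a b c d) μ :=
    integrable_mul_of_tsupport_subset hU hψ.continuous hc hψU
      (H.continuousOn_weakCurvature a b c d)
  -- The product rule, pointwise. Terms with a derivative of `ψ` collect into the lowered
  -- Christoffel symbols of `G`, and the two total derivatives split off at the end integrate to
  -- zero by `e2` and `e3`.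
  have key : ∀ z, fderiv ℝ (fun z => ψ z • tangentForm B x d z) z b
        (fderiv ℝ (fun y => fderiv ℝ x y c) z a)
      - fderiv ℝ (fun z => ψ z • tangentForm B x d z) z a
        (fderiv ℝ (fun y => fderiv ℝ x y c) z b)
      = ((fderiv ℝ ψ z b * christoffelFirst G z a c d
        - fderiv ℝ ψ z a * christoffelFirst G z b c d) - ψ z * weakCurvature B x z a b c d)
        - (fderiv ℝ (fun z => ψ z * pullbackChristoffel B x a c d z) z b
          - fderiv ℝ (fun z => ψ z * pullbackChristoffel B x b c d z) z a) := by
    intro z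
    by_cases hz : z ∈ tsupport ψ
    · have hzU := hψU hz
      have dψ : DifferentiableAt ℝ ψ z := hψ.differentiable (by norm_num) z
      have dω : DifferentiableAt ℝ (tangentForm B x d) z :=
        (H.contDiffAt_of_contDiffOn hzU (H.contDiffOn_tangentForm d)).differentiableAt
          (by norm_num)
      have dτ : ∀ a, DifferentiableAt ℝ (pullbackChristoffel B x a c d) z := fun a =>
        (H.contDiffAt_of_contDiffOn hzU (H.contDiffOn_pullbackChristoffel a c d)).differentiableAt
          (by norm_num)
      rw [(H.hasFDerivAt_fderiv_apply hzU c).fderiv, fderiv_fun_smul dψ dω,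
        fderiv_fun_mul dψ (dτ a), fderiv_fun_mul dψ (dτ b), H.christoffelFirst_eq hzU,
        H.christoffelFirst_eq hzU]
      simp only [weakCurvature, add_apply, smul_apply, smul_eq_mul,
        ContinuousLinearMap.smulRight_apply, ContinuousLinearMap.flip_apply]
      ring
    · have h0 : ψ z = 0 := image_eq_zero_of_notMem_tsupport hz
      have h1 : fderiv ℝ ψ z = 0 := fderiv_eq_zero_of_notMem_tsupport hz
      have h2 : fderiv ℝ (fun z => ψ z • tangentForm B x d z) z = 0 :=
        fderiv_eq_zero_of_notMem_tsupport fun h => hz (hΨs h)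
      have h3 : ∀ a, fderiv ℝ (fun z => ψ z * pullbackChristoffel B x a c d z) z = 0 := fun a =>
        fderiv_eq_zero_of_notMem_tsupport fun h =>
          hz (closure_mono (Function.support_mul_subset_left ψ _) h)
      simp [h0, h1, h2, h3]
  have iΨ : ∀ v w, Integrable (fun z => fderiv ℝ (fun z => ψ z • tangentForm B x d z) z v
      (fderiv ℝ (fun y => fderiv ℝ x y c) z w)) μ := by
    intro v w
    have hcont : Continuous (fun z => fderiv ℝ (fun z => ψ z • tangentForm B x d z) z v
        (fderiv ℝ (fun y => fderiv ℝ x y c) z w)) := by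
      rw [continuous_iff_continuousAt]
      intro z
      by_cases hz : z ∈ tsupport (fun z => ψ z • tangentForm B x d z)
      · have h1 : ContinuousAt (fun z => fderiv ℝ (fun z => ψ z • tangentForm B x d z) z v) z :=
          ((hΨ.continuous_fderiv (by norm_num)).clm_apply continuous_const).continuousAt
        have h2 : ContinuousAt (fun z => fderiv ℝ (fun y => fderiv ℝ x y c) z w) z :=
          (((H.contDiffOn_fderiv_apply c).continuousOn_fderiv_of_isOpen hU
            (by norm_num)).clm_apply continuousOn_const).continuousAt
            (hU.mem_nhds (hψU (hΨs hz)))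
        exact h1.clm_apply h2
      · have h0 := notMem_tsupport_iff_eventuallyEq.1
          (fun h => hz (tsupport_fderiv_subset ℝ h))
        have : (fun z => fderiv ℝ (fun z => ψ z • tangentForm B x d z) z v
            (fderiv ℝ (fun y => fderiv ℝ x y c) z w)) =ᶠ[𝓝 z] fun _ => 0 := by
          filter_upwards [h0] with y hy
          simp [hy]
        exact continuousAt_const.congr this.symm
    refine hcont.integrable_of_hasCompactSupport (hΨc.mono' ?_)
    intro z hz
    by_contra h
    exact hz (by simp [fderiv_eq_zero_of_notMem_tsupport h])
  have e4 := integral_sub (iΨ b a) (iΨ a b)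
  rw [e1, sub_self] at e4
  simp only [key] at e4
  rw [integral_sub (integrable_fun_sub (integrable_fun_sub (iΓ a c b) (iΓ b c a)) iK)
      (integrable_fun_sub (iT a c b) (iT b c a)),
    integral_sub (integrable_fun_sub (iΓ a c b) (iΓ b c a)) iK, integral_sub (iT a c b) (iT b c a), e2, e3] at e4
  linarith

end IsPullbackOn

end Pullback

section ScalarCurvature

variable {n : ℕ} {E' : Type*} [NormedAddCommGroup E'] [NormedSpace ℝ E']
  {B : E' → E' →L[ℝ] E' →L[ℝ] ℝ} {V : Set E'}
  {x : EuclideanSpace ℝ (Fin n) → E'} {U : Set (EuclideanSpace ℝ (Fin n))}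
  {G : EuclideanSpace ℝ (Fin n) → EuclideanSpace ℝ (Fin n) → EuclideanSpace ℝ (Fin n) → ℝ}

/-- The contraction `G^{jk} G^{il} R_{ijkl}` for the metric `G` induced by a `C^2` map `x`, which
involves only derivatives of `x` up to the second order. -/
noncomputable def weakScalarCurvature (B : E' → E' →L[ℝ] E' →L[ℝ] ℝ)
    (x : EuclideanSpace ℝ (Fin n) → E')
    (G : EuclideanSpace ℝ (Fin n) → EuclideanSpace ℝ (Fin n) → EuclideanSpace ℝ (Fin n) → ℝ)
    (z : EuclideanSpace ℝ (Fin n)) : ℝ :=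
  ∑ j, ∑ k, ∑ i, ∑ l, inverseMetric G j k z * inverseMetric G i l z *
    (weakCurvature B x z (EuclideanSpace.single i 1) (EuclideanSpace.single j 1)
      (EuclideanSpace.single k 1) (EuclideanSpace.single l 1) + riemannQuadratic G i j k l z)

theorem IsPullbackOn.isC1MetricAt (H : IsPullbackOn B V x U G) {z : EuclideanSpace ℝ (Fin n)}
    (hz : z ∈ U) (hdet : (Matrix.of fun a b : Fin n =>
      G z (EuclideanSpace.single a 1) (EuclideanSpace.single b 1)).det ≠ 0) :
    IsC1MetricAt G z where
  contDiffAt a b := by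
    have h : ContDiffOn ℝ 1 (fun y => tangentForm B x (EuclideanSpace.single a 1) y
        (fderiv ℝ x y (EuclideanSpace.single b 1))) U :=
      (H.contDiffOn_tangentForm _).clm_apply (H.contDiffOn_fderiv_apply _)
    exact H.contDiffAt_of_contDiffOn hz (h.congr fun y hy => H.eq_pullback y hy _ _)
  symm := by
    filter_upwards [H.isOpen_source.mem_nhds hz] with y hy a b
    rw [H.eq_pullback y hy, H.eq_pullback y hy, H.symm _ (H.mapsTo hy)]
  det_ne_zero := hdet

variable (H : IsPullbackOn B V x U G) (hdet : ∀ z ∈ U, (Matrix.of fun a b : Fin n =>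
      G z (EuclideanSpace.single a 1) (EuclideanSpace.single b 1)).det ≠ 0)
include H hdet

theorem IsPullbackOn.contDiffOn_inverseMetric (j k : Fin n) :
    ContDiffOn ℝ 1 (inverseMetric G j k) U := fun z hz =>
  ((H.isC1MetricAt hz (hdet z hz)).contDiffAt_inverseMetric j k).contDiffWithinAt

theorem IsPullbackOn.continuousOn_riemannQuadratic (i j k l : Fin n) :
    ContinuousOn (riemannQuadratic G i j k l) U := by
  have h1 := fun j k => (H.contDiffOn_inverseMetric hdet j k).continuousOn
  have h2 : ∀ i j k, ContinuousOn (christoffelFirstCoord G i j k) U := fun i j k =>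
    H.continuousOn_christoffelFirst _ _ _
  exact continuousOn_finsetSum _ fun m _ => continuousOn_finsetSum _ fun r _ =>
    (h1 m r).mul (((h2 j k m).neg.mul (h2 i l r)).add ((h2 i k m).mul (h2 j l r)))

theorem IsPullbackOn.continuousOn_weakScalarCurvature :
    ContinuousOn (weakScalarCurvature B x G) U := by
  have h1 := fun j k => (H.contDiffOn_inverseMetric hdet j k).continuousOn
  exact continuousOn_finsetSum _ fun j _ => continuousOn_finsetSum _ fun k _ =>
    continuousOn_finsetSum _ fun i _ => continuousOn_finsetSum _ fun l _ =>
    ((h1 j k).mul (h1 i l)).mul ((H.continuousOn_weakCurvature _ _ _ _).add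
      (H.continuousOn_riemannQuadratic hdet i j k l))

/-- The metric induced by a `C^2` map has a continuous distributional scalar curvature. -/
theorem IsPullbackOn.isDistributionalScalarCurvatureOn [FiniteDimensional ℝ E'] :
    IsDistributionalScalarCurvatureOn G U (weakScalarCurvature B x G) := by
  intro φ hφ hc hφU
  have hU := H.isOpen_source
  have h1 := fun j k => H.contDiffOn_inverseMetric hdet j k
  have hφ1 : ContDiff ℝ 1 φ := hφ.of_le (by norm_cast)
  have hψ : ∀ j k i l, ContDiff ℝ 1
      (fun y => φ y * (inverseMetric G j k y * inverseMetric G i l y)) := fun j k i l =>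
    contDiff_mul_of_tsupport_subset (k := 1) hU hφ1 hφU ((h1 j k).mul (h1 i l))
  have hψc : ∀ j k i l, HasCompactSupport
      (fun y => φ y * (inverseMetric G j k y * inverseMetric G i l y)) := fun j k i l =>
    hc.mul_right
  have hψU : ∀ j k i l, tsupport
      (fun y => φ y * (inverseMetric G j k y * inverseMetric G i l y)) ⊆ U := fun j k i l =>
    (closure_mono (Function.support_mul_subset_left φ _)).trans hφU
  -- The rewriting needs a nondegenerate `C^1` metric, which is available only on `U`; off the
  -- support of `φ` both sides are zero.
  have hint : ∀ z, ∑ j, ∑ k,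
        (∑ i, (partialDeriv j (fun y => φ y * inverseMetric G j k y) z * christoffel G i i k z
          - partialDeriv i (fun y => φ y * inverseMetric G j k y) z * christoffel G i j k z)
        + φ z * inverseMetric G j k z * ricciQuadratic G j k z)
      = ∑ j, ∑ k, ∑ i, ∑ l,
        ((partialDeriv j (fun y => φ y * (inverseMetric G j k y * inverseMetric G i l y)) z
            * christoffelFirstCoord G i k l z
          - partialDeriv i (fun y => φ y * (inverseMetric G j k y * inverseMetric G i l y)) z
            * christoffelFirstCoord G j k l z)
          + φ z * (inverseMetric G j k z * inverseMetric G i l z)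
            * riemannQuadratic G i j k l z) := by
    intro z
    by_cases hz : z ∈ tsupport φ
    · exact (H.isC1MetricAt (hφU hz) (hdet z (hφU hz))).distributional_integrand_eq
        (hφ1.differentiable (by norm_num) z)
    · have h0 : φ z = 0 := image_eq_zero_of_notMem_tsupport hz
      have h2 : ∀ (f : EuclideanSpace ℝ (Fin n) → ℝ) (i : Fin n),
          partialDeriv i (fun y => φ y * f y) z = 0 := by
        intro f i
        have : fderiv ℝ (fun y => φ y * f y) z = 0 := fderiv_eq_zero_of_notMem_tsupport fun h =>
          hz (closure_mono (Function.support_mul_subset_left φ _) h)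
        simp [partialDeriv, this]
      simp [h0, h2]
  simp only [hint]
  have iΓ : ∀ j k i l d e f g, Integrable (fun z => partialDeriv d
      (fun y => φ y * (inverseMetric G j k y * inverseMetric G i l y)) z
        * christoffelFirstCoord G e f g z) := fun j k i l d e f g =>
    integrable_mul_of_tsupport_subset hU
      (((hψ j k i l).continuous_fderiv (by norm_num)).clm_apply continuous_const)
      ((hψc j k i l).fderiv_apply_const _)
      ((tsupport_fderiv_apply_subset_tsupport _ _).trans (hψU j k i l))
      (H.continuousOn_christoffelFirst _ _ _)
  have iΓ2 := fun j k i l => integrable_fun_sub (iΓ j k i l j i k l) (iΓ j k i l i j k l)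
  have iQ : ∀ j k i l, Integrable (fun z => φ z * (inverseMetric G j k z * inverseMetric G i l z)
      * riemannQuadratic G i j k l z) := fun j k i l =>
    integrable_mul_of_tsupport_subset hU (hψ j k i l).continuous (hψc j k i l) (hψU j k i l)
      (H.continuousOn_riemannQuadratic hdet i j k l)
  have iK : ∀ j k i l, Integrable (fun z => φ z * (inverseMetric G j k z * inverseMetric G i l z)
      * weakCurvature B x z (EuclideanSpace.single i 1) (EuclideanSpace.single j 1)
      (EuclideanSpace.single k 1) (EuclideanSpace.single l 1)) := fun j k i l =>
    integrable_mul_of_tsupport_subset hU (hψ j k i l).continuous (hψc j k i l) (hψU j k i l)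
      (H.continuousOn_weakCurvature _ _ _ _)
  have hρ : ∀ z, weakScalarCurvature B x G z * φ z = ∑ j, ∑ k, ∑ i, ∑ l,
      (φ z * (inverseMetric G j k z * inverseMetric G i l z)
        * weakCurvature B x z (EuclideanSpace.single i 1) (EuclideanSpace.single j 1)
        (EuclideanSpace.single k 1) (EuclideanSpace.single l 1)
      + φ z * (inverseMetric G j k z * inverseMetric G i l z) * riemannQuadratic G i j k l z) := by
    intro z
    simp only [weakScalarCurvature, Finset.sum_mul]
    refine Finset.sum_congr rfl fun j _ => Finset.sum_congr rfl fun k _ =>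
      Finset.sum_congr rfl fun i _ => Finset.sum_congr rfl fun l _ => by ring
  simp only [hρ]
  have hsum : ∀ f : Fin n → Fin n → Fin n → Fin n → EuclideanSpace ℝ (Fin n) → ℝ,
      (∀ j k i l, Integrable (f j k i l)) →
      ∫ z, ∑ j, ∑ k, ∑ i, ∑ l, f j k i l z = ∑ j, ∑ k, ∑ i, ∑ l, ∫ z, f j k i l z := by
    intro f hf
    rw [integral_finsetSum _ fun j _ => integrable_finsetSum _ fun k _ =>
      integrable_finsetSum _ fun i _ => integrable_finsetSum _ fun l _ => hf j k i l]
    refine Finset.sum_congr rfl fun j _ => ?_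
    rw [integral_finsetSum _ fun k _ =>
      integrable_finsetSum _ fun i _ => integrable_finsetSum _ fun l _ => hf j k i l]
    refine Finset.sum_congr rfl fun k _ => ?_
    rw [integral_finsetSum _ fun i _ => integrable_finsetSum _ fun l _ => hf j k i l]
    refine Finset.sum_congr rfl fun i _ => ?_
    rw [integral_finsetSum _ fun l _ => hf j k i l]
  rw [hsum _ fun j k i l => (iK j k i l).fun_add (iQ j k i l),
    hsum _ fun j k i l => (iΓ2 j k i l).fun_add (iQ j k i l)]
  refine Finset.sum_congr rfl fun j _ => Finset.sum_congr rfl fun k _ =>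
    Finset.sum_congr rfl fun i _ => Finset.sum_congr rfl fun l _ => ?_
  have e1 := integral_add (iK j k i l) (iQ j k i l)
  have e2 := integral_add (iΓ2 j k i l) (iQ j k i l)
  -- The function tested is `φ G^{jk} G^{il}`, which is only `C^1` because the metric is; hence that
  -- lemma asks no more of `ψ`.
  have e3 := H.integral_fderiv_mul_christoffelFirst volume (hψ j k i l) (hψc j k i l) (hψU j k i l)
    (EuclideanSpace.single i 1) (EuclideanSpace.single j 1)
      (EuclideanSpace.single k 1) (EuclideanSpace.single l 1)
  refine e1.trans (Eq.trans ?_ e2.symm)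
  congr 1
  exact e3.symm

end ScalarCurvature

end HypersurfaceGeometry

/-! ### Orthonormal frames, Gram matrices, and traces. -/

section OrthonormalFrames

variable {V : Type*} [AddCommGroup V] [Module ℝ V] {ι : Type*} [Fintype ι] [DecidableEq ι]

/-- The family `f` is orthonormal with respect to the form `b`. -/
def IsOrthonormalFrame (b : V → V → ℝ) (f : ι → V) : Prop :=
  ∀ i j, b (f i) (f j) = if i = j then 1 else 0

theorem IsOrthonormalFrame.linearIndependent {b : LinearMap.BilinForm ℝ V} {f : ι → V}
    (hf : IsOrthonormalFrame (fun v w => b v w) f) : LinearIndependent ℝ f := by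
  rw [Fintype.linearIndependent_iff]
  intro g hg i
  have h := congrArg (fun v => b v (f i)) hg
  simpa [hf _ i] using h

theorem IsOrthonormalFrame.sum_smul_eq [FiniteDimensional ℝ V] {b : LinearMap.BilinForm ℝ V}
    {f : ι → V} (hf : IsOrthonormalFrame (fun v w => b v w) f)
    (hcard : Fintype.card ι = Module.finrank ℝ V) (v : V) : ∑ i, b v (f i) • f i = v := by
  by_cases hι : Nonempty ι
  · have hli := hf.linearIndependent
    let B := basisOfLinearIndependentOfCardEqFinrank hli hcard
    have hB : ∀ i, B i = f i := fun i => by simp [B]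
    have h : ∀ i, b v (f i) = B.repr v i := by
      intro i
      conv_lhs => rw [← B.sum_repr v]
      simp [hB, hf _ i]
    conv_rhs => rw [← B.sum_repr v]
    simp only [h, hB]
  · rw [not_nonempty_iff] at hι
    have : Subsingleton V := Module.finrank_zero_iff.1 (by rw [← hcard, Fintype.card_eq_zero])
    exact Subsingleton.elim _ _

theorem exists_isOrthonormalFrame [FiniteDimensional ℝ V] {m : ℕ} (hm : Module.finrank ℝ V = m)
    (b : LinearMap.BilinForm ℝ V) (hsymm : ∀ v w, b v w = b w v) (hpos : ∀ v, v ≠ 0 → 0 < b v v) :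
    ∃ f : Fin m → V, IsOrthonormalFrame (fun v w => b v w) f := by
  subst hm
  obtain ⟨v, hv⟩ := LinearMap.BilinForm.exists_orthogonal_basis (B := b) ⟨fun x y => hsymm x y⟩
  have hp : ∀ i, 0 < b (v i) (v i) := fun i => hpos _ (v.ne_zero i)
  refine ⟨fun i => (Real.sqrt (b (v i) (v i)))⁻¹ • v i, fun i j => ?_⟩
  simp only [map_smul, LinearMap.smul_apply, smul_eq_mul]
  by_cases hij : i = j
  · subst hij
    rw [if_pos rfl]
    have h1 := Real.mul_self_sqrt (hp i).le
    have h2 : Real.sqrt (b (v i) (v i)) ≠ 0 := (Real.sqrt_pos.2 (hp i)).ne'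
    field_simp
    rw [pow_two, h1]
  · rw [if_neg hij]
    have : b (v i) (v j) = 0 := hv hij
    simp [this]

end OrthonormalFrames

section Gram

variable {n : ℕ} {b : EuclideanSpace ℝ (Fin n) → EuclideanSpace ℝ (Fin n) → ℝ}
  {f : Fin n → EuclideanSpace ℝ (Fin n)}

theorem sum_apply_smul_single (v : EuclideanSpace ℝ (Fin n)) :
    ∑ j, v j • EuclideanSpace.single j (1 : ℝ) = v := by
  ext i
  simp [Finset.sum_apply, Pi.single_apply]

theorem apply_eq_sum_mul (hl : ∀ w, IsLinearMap ℝ fun v => b v w) (hr : ∀ v, IsLinearMap ℝ (b v))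
    (v w : EuclideanSpace ℝ (Fin n)) :
    b v w = ∑ j, ∑ k, v j * w k * b (EuclideanSpace.single j 1) (EuclideanSpace.single k 1) := by
  have h1 : ∀ w, b v w = ∑ j, v j * b (EuclideanSpace.single j 1) w := by
    intro w
    conv_lhs => rw [← sum_apply_smul_single v]
    change (hl w).mk' _ (∑ j, v j • EuclideanSpace.single j (1 : ℝ)) = _
    simp
  have h2 : ∀ u, b u w = ∑ k, w k * b u (EuclideanSpace.single k 1) := by
    intro u
    conv_lhs => rw [← sum_apply_smul_single w]
    change (hr u).mk' _ (∑ j, w j • EuclideanSpace.single j (1 : ℝ)) = _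
    simp
  rw [h1]
  refine Finset.sum_congr rfl fun j _ => ?_
  rw [h2, Finset.mul_sum]
  exact Finset.sum_congr rfl fun k _ => by ring

/-- The Gram matrix of a form in the standard frame. -/
noncomputable def gramMatrix (b : EuclideanSpace ℝ (Fin n) → EuclideanSpace ℝ (Fin n) → ℝ) :
    Matrix (Fin n) (Fin n) ℝ :=
  Matrix.of fun j k => b (EuclideanSpace.single j 1) (EuclideanSpace.single k 1)

/-- The matrix whose columns are the vectors of the frame `f`. -/
noncomputable def frameMatrix (f : Fin n → EuclideanSpace ℝ (Fin n)) : Matrix (Fin n) (Fin n) ℝ :=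
  Matrix.of fun j a => f a j

theorem transpose_frameMatrix_mul_gramMatrix_mul (hl : ∀ w, IsLinearMap ℝ fun v => b v w)
    (hr : ∀ v, IsLinearMap ℝ (b v)) :
    (frameMatrix f).transpose * gramMatrix b * frameMatrix f
      = Matrix.of fun a c => b (f a) (f c) := by
  ext a c
  rw [Matrix.of_apply, apply_eq_sum_mul hl hr, Finset.sum_comm]
  simp only [Matrix.mul_apply, frameMatrix, gramMatrix, Matrix.transpose_apply, Matrix.of_apply,
    Finset.sum_mul]
  exact Finset.sum_congr rfl fun k _ => Finset.sum_congr rfl fun j _ => by ring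

theorem IsOrthonormalFrame.transpose_mul_gramMatrix_mul (hl : ∀ w, IsLinearMap ℝ fun v => b v w)
    (hr : ∀ v, IsLinearMap ℝ (b v)) (hf : IsOrthonormalFrame b f) :
    (frameMatrix f).transpose * gramMatrix b * frameMatrix f = 1 := by
  rw [transpose_frameMatrix_mul_gramMatrix_mul hl hr]
  ext a c
  rw [Matrix.of_apply, hf, Matrix.one_apply]

/-- With `P` the frame matrix, `Pᵀ b P = 1` inverts to `b⁻¹ = P Pᵀ`. The existence of the frame is
all that is used. -/
theorem IsOrthonormalFrame.inv_gramMatrix (hl : ∀ w, IsLinearMap ℝ fun v => b v w)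
    (hr : ∀ v, IsLinearMap ℝ (b v)) (hf : IsOrthonormalFrame b f) :
    (gramMatrix b)⁻¹ = frameMatrix f * (frameMatrix f).transpose := by
  have h := hf.transpose_mul_gramMatrix_mul hl hr
  refine Matrix.inv_eq_left_inv ?_
  rw [Matrix.mul_assoc, mul_eq_one_comm]
  exact h

theorem IsOrthonormalFrame.det_gramMatrix_ne_zero (hl : ∀ w, IsLinearMap ℝ fun v => b v w)
    (hr : ∀ v, IsLinearMap ℝ (b v)) (hf : IsOrthonormalFrame b f) : (gramMatrix b).det ≠ 0 := by
  intro h0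
  have h := congrArg Matrix.det (hf.transpose_mul_gramMatrix_mul hl hr)
  simp [h0] at h

/-- Contraction with the inverse of the Gram matrix is a trace over an orthonormal frame. -/
theorem IsOrthonormalFrame.sum_inv_gramMatrix_mul (hl : ∀ w, IsLinearMap ℝ fun v => b v w)
    (hr : ∀ v, IsLinearMap ℝ (b v)) (hf : IsOrthonormalFrame b f)
    {T : EuclideanSpace ℝ (Fin n) → EuclideanSpace ℝ (Fin n) → ℝ}
    (hTl : ∀ w, IsLinearMap ℝ fun v => T v w) (hTr : ∀ v, IsLinearMap ℝ (T v)) :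
    ∑ j, ∑ k, (gramMatrix b)⁻¹ j k * T (EuclideanSpace.single j 1) (EuclideanSpace.single k 1)
      = ∑ a, T (f a) (f a) := by
  have h : ∀ a, T (f a) (f a) = _ := fun a => apply_eq_sum_mul hTl hTr (f a) (f a)
  simp only [h, hf.inv_gramMatrix hl hr, Matrix.mul_apply, Matrix.transpose_apply, frameMatrix,
    Matrix.of_apply, Finset.sum_mul]
  exact Finset.sum_comm_cycle

end Gram

/-! ### The Riemann tensor in a frame and the Gauss equation. -/

namespace HypersurfaceGeometry

set_option maxSynthPendingDepth 3

section FrameCurvature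

variable {F : Type*} [NormedAddCommGroup F] [NormedSpace ℝ F] {ι : Type*} [Fintype ι]
  {B : F → F →L[ℝ] F →L[ℝ] ℝ} {y : F} {w : ι → F}

/-- The derivative in direction `a` of the Christoffel symbol `C b c d` of the first kind. -/
noncomputable def lowerChristoffelDeriv (B : F → F →L[ℝ] F →L[ℝ] ℝ) (y a b c d : F) : ℝ :=
  (fderiv ℝ (fderiv ℝ B) y a b c d + fderiv ℝ (fderiv ℝ B) y a c b d
    - fderiv ℝ (fderiv ℝ B) y a d b c) / 2

/-- The Riemann tensor of the metric `B` at `y`, computed with a `B y`-orthonormal frame `w`. -/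
noncomputable def frameCurvature (B : F → F →L[ℝ] F →L[ℝ] ℝ) (y : F) (w : ι → F) (a b c d : F) : ℝ :=
  lowerChristoffelDeriv B y a b c d - lowerChristoffelDeriv B y b a c d
    - ∑ A, lowerChristoffel B y b c (w A) * lowerChristoffel B y a d (w A)
    + ∑ A, lowerChristoffel B y a c (w A) * lowerChristoffel B y b d (w A)

theorem isLinearMap_lowerChristoffel_left (b c : F) :
    IsLinearMap ℝ fun a => lowerChristoffel B y a b c :=
  ⟨fun v w => by simp [lowerChristoffel]; ring, fun r v => by simp [lowerChristoffel]; ring⟩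

theorem isLinearMap_lowerChristoffel_middle (a c : F) :
    IsLinearMap ℝ fun b => lowerChristoffel B y a b c :=
  ⟨fun v w => by simp [lowerChristoffel]; ring, fun r v => by simp [lowerChristoffel]; ring⟩

theorem isLinearMap_lowerChristoffel_right (a b : F) :
    IsLinearMap ℝ fun c => lowerChristoffel B y a b c :=
  ⟨fun v w => by simp [lowerChristoffel]; ring, fun r v => by simp [lowerChristoffel]; ring⟩

theorem isLinearMap_lowerChristoffelDeriv₁ (b c d : F) :
    IsLinearMap ℝ fun a => lowerChristoffelDeriv B y a b c d :=
  ⟨fun v w => by simp [lowerChristoffelDeriv]; ring,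
    fun r v => by simp [lowerChristoffelDeriv]; ring⟩

theorem isLinearMap_lowerChristoffelDeriv₂ (a c d : F) :
    IsLinearMap ℝ fun b => lowerChristoffelDeriv B y a b c d :=
  ⟨fun v w => by simp [lowerChristoffelDeriv]; ring,
    fun r v => by simp [lowerChristoffelDeriv]; ring⟩

theorem isLinearMap_lowerChristoffelDeriv₃ (a b d : F) :
    IsLinearMap ℝ fun c => lowerChristoffelDeriv B y a b c d :=
  ⟨fun v w => by simp [lowerChristoffelDeriv]; ring,
    fun r v => by simp [lowerChristoffelDeriv]; ring⟩

theorem isLinearMap_lowerChristoffelDeriv₄ (a b c : F) :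
    IsLinearMap ℝ fun d => lowerChristoffelDeriv B y a b c d :=
  ⟨fun v w => by simp [lowerChristoffelDeriv]; ring,
    fun r v => by simp [lowerChristoffelDeriv]; ring⟩

theorem isLinearMap_mul_const {f : F → ℝ} (hf : IsLinearMap ℝ f) (r : ℝ) :
    IsLinearMap ℝ fun v => f v * r :=
  ⟨fun v w => by rw [hf.map_add]; ring, fun s v => by rw [hf.map_smul]; simp only [smul_eq_mul]; ring⟩

theorem isLinearMap_const_mul {f : F → ℝ} (hf : IsLinearMap ℝ f) (r : ℝ) :
    IsLinearMap ℝ fun v => r * f v :=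
  ⟨fun v w => by rw [hf.map_add]; ring, fun s v => by rw [hf.map_smul]; simp only [smul_eq_mul]; ring⟩

theorem isLinearMap_add {f g : F → ℝ} (hf : IsLinearMap ℝ f) (hg : IsLinearMap ℝ g) :
    IsLinearMap ℝ fun v => f v + g v :=
  (hf.mk' f + hg.mk' g).isLinear

theorem isLinearMap_sub {f g : F → ℝ} (hf : IsLinearMap ℝ f) (hg : IsLinearMap ℝ g) :
    IsLinearMap ℝ fun v => f v - g v :=
  (hf.mk' f - hg.mk' g).isLinear

theorem isLinearMap_sum {κ : Type*} (s : Finset κ) {f : κ → F → ℝ} (hf : ∀ k, IsLinearMap ℝ (f k)) :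
    IsLinearMap ℝ fun v => ∑ k ∈ s, f k v := by
  refine ⟨fun v w => ?_, fun r v => ?_⟩
  · simp only [(hf _).map_add, Finset.sum_add_distrib]
  · simp only [(hf _).map_smul, Finset.smul_sum]

theorem isLinearMap_frameCurvature₁ (b c d : F) :
    IsLinearMap ℝ fun a => frameCurvature B y w a b c d :=
  isLinearMap_add (isLinearMap_sub (isLinearMap_sub (isLinearMap_lowerChristoffelDeriv₁ b c d)
    (isLinearMap_lowerChristoffelDeriv₂ b c d))
    (isLinearMap_sum _ fun A => isLinearMap_const_mul (isLinearMap_lowerChristoffel_left d (w A)) _))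
    (isLinearMap_sum _ fun A => isLinearMap_mul_const (isLinearMap_lowerChristoffel_left c (w A)) _)

theorem isLinearMap_frameCurvature₂ (a c d : F) :
    IsLinearMap ℝ fun b => frameCurvature B y w a b c d :=
  isLinearMap_add (isLinearMap_sub (isLinearMap_sub (isLinearMap_lowerChristoffelDeriv₂ a c d)
    (isLinearMap_lowerChristoffelDeriv₁ a c d))
    (isLinearMap_sum _ fun A => isLinearMap_mul_const (isLinearMap_lowerChristoffel_left c (w A)) _))
    (isLinearMap_sum _ fun A => isLinearMap_const_mul (isLinearMap_lowerChristoffel_left d (w A)) _)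

theorem isLinearMap_frameCurvature₃ (a b d : F) :
    IsLinearMap ℝ fun c => frameCurvature B y w a b c d :=
  isLinearMap_add (isLinearMap_sub (isLinearMap_sub (isLinearMap_lowerChristoffelDeriv₃ a b d)
    (isLinearMap_lowerChristoffelDeriv₃ b a d))
    (isLinearMap_sum _ fun A => isLinearMap_mul_const (isLinearMap_lowerChristoffel_middle b (w A)) _))
    (isLinearMap_sum _ fun A => isLinearMap_mul_const (isLinearMap_lowerChristoffel_middle a (w A)) _)

theorem isLinearMap_frameCurvature₄ (a b c : F) :
    IsLinearMap ℝ fun d => frameCurvature B y w a b c d :=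
  isLinearMap_add (isLinearMap_sub (isLinearMap_sub (isLinearMap_lowerChristoffelDeriv₄ a b c)
    (isLinearMap_lowerChristoffelDeriv₄ b a c))
    (isLinearMap_sum _ fun A => isLinearMap_const_mul (isLinearMap_lowerChristoffel_middle a (w A)) _))
    (isLinearMap_sum _ fun A => isLinearMap_const_mul (isLinearMap_lowerChristoffel_middle b (w A)) _)

theorem frameCurvature_swap_left (a b c d : F) :
    frameCurvature B y w a b c d = -frameCurvature B y w b a c d := by
  simp only [frameCurvature]
  ring

/-- In the sum of `R_{abcd}` and `R_{abdc}` the quadratic terms cancel in pairs, and the derivative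
terms reduce to `∂_a ∂_b B - ∂_b ∂_a B`. Neither symmetry of `B` nor orthonormality of `w` plays a
role. -/
theorem frameCurvature_swap_right (hB : ContDiffAt ℝ 2 B y) (a b c d : F) :
    frameCurvature B y w a b c d = -frameCurvature B y w a b d c := by
  have h : fderiv ℝ (fderiv ℝ B) y a b = fderiv ℝ (fderiv ℝ B) y b a :=
    hB.isSymmSndFDerivAt (by simp) a b
  have h1 : ∑ A, lowerChristoffel B y b d (w A) * lowerChristoffel B y a c (w A)
      = ∑ A, lowerChristoffel B y a c (w A) * lowerChristoffel B y b d (w A) :=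
    Finset.sum_congr rfl fun A _ => mul_comm _ _
  have h2 : ∑ A, lowerChristoffel B y a d (w A) * lowerChristoffel B y b c (w A)
      = ∑ A, lowerChristoffel B y b c (w A) * lowerChristoffel B y a d (w A) :=
    Finset.sum_congr rfl fun A _ => mul_comm _ _
  simp only [frameCurvature, lowerChristoffelDeriv, h, h1, h2]
  ring

theorem fderiv_fderiv_apply (hB : ContDiffAt ℝ 2 B y) (a b c d : F) :
    fderiv ℝ (fun y => fderiv ℝ B y b c d) y a = fderiv ℝ (fderiv ℝ B) y a b c d := by
  have hd : HasFDerivAt (fderiv ℝ B) (fderiv ℝ (fderiv ℝ B) y) y :=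
    ((hB.fderiv_right (m := 1) (by norm_num)).differentiableAt (by norm_num)).hasFDerivAt
  have h := ((hd.clm_apply (hasFDerivAt_const b y)).clm_apply (hasFDerivAt_const c y)).clm_apply
    (hasFDerivAt_const d y)
  rw [h.fderiv]
  simp

theorem differentiableAt_fderiv_apply (hB : ContDiffAt ℝ 2 B y) (b c d : F) :
    DifferentiableAt ℝ (fun y => fderiv ℝ B y b c d) y :=
  ((((hB.fderiv_right (m := 1) (by norm_num)).differentiableAt (by norm_num)).clm_apply
    (differentiableAt_const b)).clm_apply (differentiableAt_const c)).clm_apply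
    (differentiableAt_const d)

theorem differentiableAt_lowerChristoffel (hB : ContDiffAt ℝ 2 B y) (b c d : F) :
    DifferentiableAt ℝ (fun y => lowerChristoffel B y b c d) y := by
  simp only [lowerChristoffel, div_eq_mul_inv]
  exact (((differentiableAt_fderiv_apply hB b c d).add (differentiableAt_fderiv_apply hB c b d)).sub
    (differentiableAt_fderiv_apply hB d b c)).mul_const (2⁻¹ : ℝ)

theorem fderiv_lowerChristoffel (hB : ContDiffAt ℝ 2 B y) (a b c d : F) :
    fderiv ℝ (fun y => lowerChristoffel B y b c d) y a = lowerChristoffelDeriv B y a b c d := by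
  have h1 := (differentiableAt_fderiv_apply hB b c d)
  have h2 := (differentiableAt_fderiv_apply hB c b d)
  have h3 := (differentiableAt_fderiv_apply hB d b c)
  have h := ((h1.hasFDerivAt.add h2.hasFDerivAt).sub h3.hasFDerivAt).mul_const (2⁻¹ : ℝ)
  have e : (fun y => lowerChristoffel B y b c d)
      = fun y => (fderiv ℝ B y b c d + fderiv ℝ B y c b d - fderiv ℝ B y d b c) * 2⁻¹ := by
    ext y
    rw [lowerChristoffel, div_eq_mul_inv]
  rw [e]
  have h' := congrArg (fun L => L a) h.fderiv
  refine h'.trans ?_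
  simp only [smul_apply, sub_apply, add_apply, fderiv_fderiv_apply hB, smul_eq_mul,
    lowerChristoffelDeriv]
  ring

end FrameCurvature

section Gauss

variable {E E' : Type*} [NormedAddCommGroup E] [NormedSpace ℝ E]
  [NormedAddCommGroup E'] [NormedSpace ℝ E'] {ι : Type*} [Fintype ι]
  {B : E' → E' →L[ℝ] E' →L[ℝ] ℝ} {V : Set E'} {x : E → E'} {U : Set E} {G : E → E → E → ℝ}

/-- The pairing `⟨∇_a ∂_b x, ξ⟩` of the second covariant derivative of a map with a vector. -/
noncomputable def hessianForm (B : E' → E' →L[ℝ] E' →L[ℝ] ℝ) (x : E → E') (z a b : E) (ξ : E') : ℝ :=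
  B (x z) (fderiv ℝ (fderiv ℝ x) z a b) ξ
    + lowerChristoffel B (x z) (fderiv ℝ x z a) (fderiv ℝ x z b) ξ

/-- Parseval: summation over the frame is contraction with the inverse of `b`, so the mixed terms
become evaluations of `L` and `M`. -/
theorem sum_add_mul_add_of_frame {b : E' →L[ℝ] E' →L[ℝ] ℝ} {w : ι → E'}
    (hw : ∀ v, ∑ A, b v (w A) • w A = v) {L M : E' → ℝ} (hL : IsLinearMap ℝ L)
    (hM : IsLinearMap ℝ M) (p q : E') :
    ∑ A, (b p (w A) + L (w A)) * (b q (w A) + M (w A))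
      = b q p + L q + M p + ∑ A, L (w A) * M (w A) := by
  have h : ∀ (K : E' → ℝ), IsLinearMap ℝ K → ∀ v, ∑ A, b v (w A) * K (w A) = K v := by
    intro K hK v
    conv_rhs => rw [← hw v]
    change _ = hK.mk' K (∑ A, b v (w A) • w A)
    simp
  have hb : ∑ A, b p (w A) * b q (w A) = b q p :=
    h (fun v => b q v) (b q).toLinearMap.isLinear p
  rw [← h L hL q, ← h M hM p, ← hb]
  simp only [← Finset.sum_add_distrib]
  exact Finset.sum_congr rfl fun A _ => by ring

namespace IsPullbackOn

variable (H : IsPullbackOn B V x U G) {z : E} (hz : z ∈ U)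
include H hz

theorem contDiffAt_form : ContDiffAt ℝ 2 B (x z) :=
  H.contDiffOn_form.contDiffAt (H.isOpen_target.mem_nhds (H.mapsTo hz))

theorem fderiv_form_symm (a b c : E') : fderiv ℝ B (x z) a b c = fderiv ℝ B (x z) a c b := by
  have hd : HasFDerivAt B (fderiv ℝ B (x z)) (x z) :=
    ((H.contDiffAt_form hz).differentiableAt (by norm_num)).hasFDerivAt
  have h : ∀ b c, fderiv ℝ (fun y => B y b c) (x z) a = fderiv ℝ B (x z) a b c := by
    intro b c
    rw [((hd.clm_apply (hasFDerivAt_const b _)).clm_apply (hasFDerivAt_const c _)).fderiv]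
    simp
  have he : (fun y => B y b c) =ᶠ[𝓝 (x z)] fun y => B y c b := by
    filter_upwards [H.isOpen_target.mem_nhds (H.mapsTo hz)] with y hy using H.symm y hy b c
  rw [← h, ← h, he.fderiv_eq]

theorem lowerChristoffel_symm (a b c : E') :
    lowerChristoffel B (x z) a b c = lowerChristoffel B (x z) b a c := by
  simp only [lowerChristoffel]
  rw [H.fderiv_form_symm hz c a b]
  ring

theorem hessianForm_symm (a b : E) (ξ : E') :
    hessianForm B x z a b ξ = hessianForm B x z b a ξ := by
  simp only [hessianForm]
  rw [H.fderiv_fderiv_symm hz, H.lowerChristoffel_symm hz]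

theorem hasFDerivAt_map : HasFDerivAt x (fderiv ℝ x z) z :=
  ((H.contDiffAt_of_contDiffOn hz H.contDiffOn_map).differentiableAt (by norm_num)).hasFDerivAt

theorem fderiv_tangentForm (d a : E) (ξ : E') : fderiv ℝ (tangentForm B x d) z a ξ
    = fderiv ℝ B (x z) (fderiv ℝ x z a) (fderiv ℝ x z d) ξ
      + B (x z) (fderiv ℝ (fderiv ℝ x) z a d) ξ := by
  have hB : HasFDerivAt B (fderiv ℝ B (x z)) (x z) :=
    ((H.contDiffAt_form hz).differentiableAt (by norm_num)).hasFDerivAt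
  have h := (hB.comp z (H.hasFDerivAt_map hz)).clm_apply (H.hasFDerivAt_fderiv_apply hz d)
  have h' := congrArg (fun L => L a ξ) h.fderiv
  refine h'.trans ?_
  simp
  ring

theorem fderiv_fderiv_form_comp (a b c d : E) :
    fderiv ℝ (fun y => fderiv ℝ B (x y) (fderiv ℝ x y b) (fderiv ℝ x y c) (fderiv ℝ x y d)) z a
      = fderiv ℝ (fderiv ℝ B) (x z) (fderiv ℝ x z a) (fderiv ℝ x z b) (fderiv ℝ x z c)
          (fderiv ℝ x z d)
        + fderiv ℝ B (x z) (fderiv ℝ (fderiv ℝ x) z a b) (fderiv ℝ x z c) (fderiv ℝ x z d)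
        + fderiv ℝ B (x z) (fderiv ℝ x z b) (fderiv ℝ (fderiv ℝ x) z a c) (fderiv ℝ x z d)
        + fderiv ℝ B (x z) (fderiv ℝ x z b) (fderiv ℝ x z c) (fderiv ℝ (fderiv ℝ x) z a d) := by
  have hB : HasFDerivAt (fderiv ℝ B) (fderiv ℝ (fderiv ℝ B) (x z)) (x z) :=
    (((H.contDiffAt_form hz).fderiv_right (m := 1) (by norm_num)).differentiableAt
      (by norm_num)).hasFDerivAt
  have h := (((hB.comp z (H.hasFDerivAt_map hz)).clm_apply
    (H.hasFDerivAt_fderiv_apply hz b)).clm_apply (H.hasFDerivAt_fderiv_apply hz c)).clm_apply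
    (H.hasFDerivAt_fderiv_apply hz d)
  have h' := congrArg (fun L => L a) h.fderiv
  refine h'.trans ?_
  simp
  ring

theorem fderiv_pullbackChristoffel (a b c d : E) :
    fderiv ℝ (pullbackChristoffel B x b c d) z a
      = lowerChristoffelDeriv B (x z) (fderiv ℝ x z a) (fderiv ℝ x z b) (fderiv ℝ x z c)
          (fderiv ℝ x z d)
        + lowerChristoffel B (x z) (fderiv ℝ (fderiv ℝ x) z a b) (fderiv ℝ x z c) (fderiv ℝ x z d)
        + lowerChristoffel B (x z) (fderiv ℝ x z b) (fderiv ℝ (fderiv ℝ x) z a c) (fderiv ℝ x z d)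
        + lowerChristoffel B (x z) (fderiv ℝ x z b) (fderiv ℝ x z c)
          (fderiv ℝ (fderiv ℝ x) z a d) := by
  have hd : ∀ b c d, DifferentiableAt ℝ
      (fun y => fderiv ℝ B (x y) (fderiv ℝ x y b) (fderiv ℝ x y c) (fderiv ℝ x y d)) z :=
    fun b c d => (H.contDiffAt_of_contDiffOn hz
      (((H.contDiffOn_fderiv_comp.clm_apply (H.contDiffOn_fderiv_apply b)).clm_apply
      (H.contDiffOn_fderiv_apply c)).clm_apply (H.contDiffOn_fderiv_apply d))).differentiableAt
      (by norm_num)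
  have h := (((hd b c d).hasFDerivAt.add (hd c b d).hasFDerivAt).sub
    (hd d b c).hasFDerivAt).mul_const (2⁻¹ : ℝ)
  have e : pullbackChristoffel B x b c d = fun y =>
      (fderiv ℝ B (x y) (fderiv ℝ x y b) (fderiv ℝ x y c) (fderiv ℝ x y d)
        + fderiv ℝ B (x y) (fderiv ℝ x y c) (fderiv ℝ x y b) (fderiv ℝ x y d)
        - fderiv ℝ B (x y) (fderiv ℝ x y d) (fderiv ℝ x y b) (fderiv ℝ x y c)) * 2⁻¹ := by
    ext y
    rw [pullbackChristoffel, lowerChristoffel, div_eq_mul_inv]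
  rw [e]
  have h' := congrArg (fun L => L a) h.fderiv
  refine h'.trans ?_
  simp only [smul_apply, sub_apply, add_apply, H.fderiv_fderiv_form_comp hz, smul_eq_mul,
    lowerChristoffelDeriv, lowerChristoffel]
  ring

/-- The Gauss equation before anything intrinsic is subtracted, with the full second covariant
derivatives of `x` in place of their normal parts. Expanding the products by Parseval yields
Christoffel symbols evaluated at second derivatives of `x`; the chain rule produces the same terms
on the left, up to metric compatibility. -/
theorem weakCurvature_eq {w : ι → E'} (hw : ∀ v, ∑ A, B (x z) v (w A) • w A = v) (a b c d : E) :
    weakCurvature B x z a b c d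
      = frameCurvature B (x z) w (fderiv ℝ x z a) (fderiv ℝ x z b) (fderiv ℝ x z c) (fderiv ℝ x z d)
        + ∑ A, hessianForm B x z b c (w A) * hessianForm B x z a d (w A)
        - ∑ A, hessianForm B x z a c (w A) * hessianForm B x z b d (w A) := by
  have hcompat : ∀ a b c, fderiv ℝ B (x z) a b c
      = lowerChristoffel B (x z) a b c + lowerChristoffel B (x z) a c b := by
    intro a b c
    simp only [lowerChristoffel]
    rw [H.fderiv_form_symm hz a c b]
    ring
  simp only [hessianForm]
  rw [sum_add_mul_add_of_frame hw (isLinearMap_lowerChristoffel_right _ _)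
      (isLinearMap_lowerChristoffel_right _ _),
    sum_add_mul_add_of_frame hw (isLinearMap_lowerChristoffel_right _ _)
      (isLinearMap_lowerChristoffel_right _ _)]
  simp only [weakCurvature, H.fderiv_tangentForm hz, H.fderiv_pullbackChristoffel hz,
    frameCurvature, hcompat]
  rw [H.fderiv_fderiv_symm hz b a]
  ring

end IsPullbackOn

end Gauss

section ScalarCurvature

variable {n : ℕ} {E' : Type*} [NormedAddCommGroup E'] [NormedSpace ℝ E']
  {B : E' → E' →L[ℝ] E' →L[ℝ] ℝ} {V : Set E'}
  {x : EuclideanSpace ℝ (Fin n) → E'} {U : Set (EuclideanSpace ℝ (Fin n))}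
  {G : EuclideanSpace ℝ (Fin n) → EuclideanSpace ℝ (Fin n) → EuclideanSpace ℝ (Fin n) → ℝ}

/-- The contracted Gauss equation for a `C^2` hypersurface. -/
theorem IsPullbackOn.weakScalarCurvature_eq (H : IsPullbackOn B V x U G)
    {z : EuclideanSpace ℝ (Fin n)} (hz : z ∈ U) {f : Fin n → EuclideanSpace ℝ (Fin n)}
    (hf : IsOrthonormalFrame (G z) f) {ν : E'}
    (hw : ∀ v, B (x z) v ν • ν + ∑ A, B (x z) v (fderiv ℝ x z (f A)) • fderiv ℝ x z (f A) = v) :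
    weakScalarCurvature B x G z = ∑ b, ∑ a,
      (frameCurvature B (x z) (Fin.cons ν fun A => fderiv ℝ x z (f A) : Fin (n + 1) → E')
          (fderiv ℝ x z (f a)) (fderiv ℝ x z (f b)) (fderiv ℝ x z (f b)) (fderiv ℝ x z (f a))
        + hessianForm B x z (f b) (f b) ν * hessianForm B x z (f a) (f a) ν
        - hessianForm B x z (f a) (f b) ν * hessianForm B x z (f a) (f b) ν) := by
  set w : Fin (n + 1) → E' := Fin.cons ν fun A => fderiv ℝ x z (f A) with hwdef
  have hw' : ∀ v, ∑ A, B (x z) v (w A) • w A = v := by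
    intro v
    rw [Fin.sum_univ_succ]
    exact hw v
  have hGl : ∀ v, IsLinearMap ℝ fun u => G z u v := fun v =>
    ⟨fun a b => by simp [H.eq_pullback z hz], fun r a => by simp [H.eq_pullback z hz]⟩
  have hGr : ∀ v, IsLinearMap ℝ (G z v) := fun v =>
    ⟨fun a b => by simp [H.eq_pullback z hz], fun r a => by simp [H.eq_pullback z hz]⟩
  have hβl : ∀ b ξ, IsLinearMap ℝ fun a => hessianForm B x z a b ξ := fun b ξ =>
    ⟨fun v w => by simp [hessianForm, lowerChristoffel]; ring,
      fun r v => by simp [hessianForm, lowerChristoffel]; ring⟩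
  have hβr : ∀ a ξ, IsLinearMap ℝ fun b => hessianForm B x z a b ξ := fun b ξ =>
    ⟨fun v w => by simp [hessianForm, lowerChristoffel]; ring,
      fun r v => by simp [hessianForm, lowerChristoffel]; ring⟩
  have hβx : ∀ a b, IsLinearMap ℝ fun c => hessianForm B x z a b (fderiv ℝ x z c) := fun a b =>
    ⟨fun v w => by simp [hessianForm, lowerChristoffel]; ring,
      fun r v => by simp [hessianForm, lowerChristoffel]; ring⟩
  have hx : ∀ {g : E' → ℝ}, IsLinearMap ℝ g → IsLinearMap ℝ fun v => g (fderiv ℝ x z v) :=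
    fun hg => (hg.mk' _ ∘ₗ (fderiv ℝ x z).toLinearMap).isLinear
  -- The intrinsic symbols are the tangential components of the second covariant derivative. The
  -- intrinsic quadratic part therefore cancels the tangential terms of `weakCurvature_eq`, and only
  -- products of `ν`-components survive.
  have hΓ : ∀ i j l, christoffelFirstCoord G i j l z = hessianForm B x z
      (EuclideanSpace.single i 1) (EuclideanSpace.single j 1)
        (fderiv ℝ x z (EuclideanSpace.single l 1)) := by
    intro i j l
    rw [christoffelFirstCoord, H.christoffelFirst_eq hz, tangentForm, H.symm _ (H.mapsTo hz)]
    rfl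
  let T : EuclideanSpace ℝ (Fin n) → EuclideanSpace ℝ (Fin n) → EuclideanSpace ℝ (Fin n) →
      EuclideanSpace ℝ (Fin n) → ℝ := fun a b c d =>
    frameCurvature B (x z) w (fderiv ℝ x z a) (fderiv ℝ x z b) (fderiv ℝ x z c) (fderiv ℝ x z d)
      + hessianForm B x z b c ν * hessianForm B x z a d ν
      - hessianForm B x z a c ν * hessianForm B x z b d ν
  have hT : ∀ i j k l, weakCurvature B x z (EuclideanSpace.single i 1) (EuclideanSpace.single j 1)
      (EuclideanSpace.single k 1) (EuclideanSpace.single l 1) + riemannQuadratic G i j k l z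
      = T (EuclideanSpace.single i 1) (EuclideanSpace.single j 1)
        (EuclideanSpace.single k 1) (EuclideanSpace.single l 1) := by
    intro i j k l
    have hq : riemannQuadratic G i j k l z = ∑ A, (-hessianForm B x z (EuclideanSpace.single j 1)
          (EuclideanSpace.single k 1) (fderiv ℝ x z (f A))
          * hessianForm B x z (EuclideanSpace.single i 1) (EuclideanSpace.single l 1)
            (fderiv ℝ x z (f A))
        + hessianForm B x z (EuclideanSpace.single i 1)
          (EuclideanSpace.single k 1) (fderiv ℝ x z (f A))
          * hessianForm B x z (EuclideanSpace.single j 1) (EuclideanSpace.single l 1)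
            (fderiv ℝ x z (f A))) := by
      simp only [riemannQuadratic, hΓ]
      exact hf.sum_inv_gramMatrix_mul hGl hGr
        (T := fun u v => -hessianForm B x z (EuclideanSpace.single j 1)
          (EuclideanSpace.single k 1) (fderiv ℝ x z u)
          * hessianForm B x z (EuclideanSpace.single i 1) (EuclideanSpace.single l 1)
            (fderiv ℝ x z v)
        + hessianForm B x z (EuclideanSpace.single i 1)
          (EuclideanSpace.single k 1) (fderiv ℝ x z u)
          * hessianForm B x z (EuclideanSpace.single j 1) (EuclideanSpace.single l 1)
            (fderiv ℝ x z v))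
        (fun v => by
          simp only [neg_mul, ← mul_neg]
          exact isLinearMap_add (isLinearMap_mul_const (hβx _ _) _)
            (isLinearMap_mul_const (hβx _ _) _))
        (fun v => isLinearMap_add (isLinearMap_const_mul (hβx _ _) _)
            (isLinearMap_const_mul (hβx _ _) _))
    rw [hq, H.weakCurvature_eq hz hw', Fin.sum_univ_succ, Fin.sum_univ_succ]
    simp only [hwdef, Fin.cons_zero, Fin.cons_succ, T, neg_mul, Finset.sum_add_distrib,
      Finset.sum_neg_distrib]
    ring
  have hinner : ∀ u v, ∑ i, ∑ l, inverseMetric G i l z *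
      T (EuclideanSpace.single i 1) u v (EuclideanSpace.single l 1)
      = ∑ a, T (f a) u v (f a) := by
    intro u v
    exact hf.sum_inv_gramMatrix_mul hGl hGr (T := fun p q => T p u v q)
      (fun q => isLinearMap_sub (isLinearMap_add (hx (isLinearMap_frameCurvature₁ _ _ _))
        (isLinearMap_const_mul (hβl _ _) _)) (isLinearMap_mul_const (hβl _ _) _))
      (fun p => isLinearMap_sub (isLinearMap_add (hx (isLinearMap_frameCurvature₄ _ _ _))
        (isLinearMap_const_mul (hβr _ _) _)) (isLinearMap_const_mul (hβr _ _) _))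
  have houter := hf.sum_inv_gramMatrix_mul hGl hGr (T := fun u v => ∑ a, T (f a) u v (f a))
    (fun v => isLinearMap_sum _ fun a => isLinearMap_sub (isLinearMap_add
      (hx (isLinearMap_frameCurvature₂ _ _ _))
        (isLinearMap_mul_const (hβl _ _) _)) (isLinearMap_const_mul (hβl _ _) _))
    (fun u => isLinearMap_sum _ fun a => isLinearMap_sub (isLinearMap_add
      (hx (isLinearMap_frameCurvature₃ _ _ _))
        (isLinearMap_mul_const (hβr _ _) _)) (isLinearMap_mul_const (hβr _ _) _))
  simp only [weakScalarCurvature, hT, mul_assoc, ← Finset.mul_sum, hinner]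
  refine houter.trans (Finset.sum_congr rfl fun b _ => Finset.sum_congr rfl fun a _ => ?_)
  simp only [T]
  rw [H.hessianForm_symm hz (f b) (f a)]

end ScalarCurvature

/-! ### Ricci and scalar curvature of a `C^2` metric as traces over a frame. -/

section Ricci

variable {n : ℕ}
  {B : EuclideanSpace ℝ (Fin n) → EuclideanSpace ℝ (Fin n) →L[ℝ] EuclideanSpace ℝ (Fin n) →L[ℝ] ℝ}
  {V : Set (EuclideanSpace ℝ (Fin n))}
  {G : EuclideanSpace ℝ (Fin n) → EuclideanSpace ℝ (Fin n) → EuclideanSpace ℝ (Fin n) → ℝ}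
  {z : EuclideanSpace ℝ (Fin n)} {w : Fin n → EuclideanSpace ℝ (Fin n)}

/-- The bridge between metrics given as plain functions `G z a b`, as in the definitions of
curvature, and fields of continuous bilinear forms, on which the calculus is done. -/
theorem christoffelFirst_eq_lowerChristoffel {F : Type*} [NormedAddCommGroup F] [NormedSpace ℝ F]
    {B : F → F →L[ℝ] F →L[ℝ] ℝ} {G : F → F → F → ℝ} {z : F} (hG : ∀ᶠ y in 𝓝 z, ∀ a b, G y a b = B y a b)
    (hB : DifferentiableAt ℝ B z) (a b c : F) :
    christoffelFirst G z a b c = lowerChristoffel B z a b c := by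
  have h : ∀ a b c, fderiv ℝ (fun y => G y b c) z a = fderiv ℝ B z a b c := by
    intro a b c
    have he : (fun y => G y b c) =ᶠ[𝓝 z] fun y => B y b c := by
      filter_upwards [hG] with y hy using hy b c
    rw [he.fderiv_eq, ((hB.hasFDerivAt.clm_apply (hasFDerivAt_const b _)).clm_apply
      (hasFDerivAt_const c _)).fderiv]
    simp
  simp only [christoffelFirst, lowerChristoffel, h]

variable (hV : IsOpen V) (hB : ContDiffOn ℝ 2 B V) (hsymm : ∀ y ∈ V, ∀ a b, B y a b = B y b a)
  (hG : ∀ y ∈ V, ∀ a b, G y a b = B y a b) (hz : z ∈ V)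
  (hw : IsOrthonormalFrame (G z) w)
include hV hB hsymm hG hz hw

/-- The lowered form of the Ricci tensor contains two contractions with the inverse metric, one
inside the quadratic terms and one outside. Both become sums over `w`. -/
theorem ricciCoord_eq_sum_frameCurvature (j k : Fin n) : ricciCoord G j k z = ∑ A,
    frameCurvature B z w (w A) (EuclideanSpace.single j 1) (EuclideanSpace.single k 1) (w A) := by
  have hBz : ContDiffAt ℝ 2 B z := hB.contDiffAt (hV.mem_nhds hz)
  have hGl : ∀ v, IsLinearMap ℝ fun u => G z u v := fun v =>
    ⟨fun a b => by simp [hG z hz], fun r a => by simp [hG z hz]⟩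
  have hGr : ∀ v, IsLinearMap ℝ (G z v) := fun v =>
    ⟨fun a b => by simp [hG z hz], fun r a => by simp [hG z hz]⟩
  have hC : ∀ y ∈ V, ∀ a b c, christoffelFirst G y a b c = lowerChristoffel B y a b c := by
    intro y hy
    refine christoffelFirst_eq_lowerChristoffel ?_
      ((hB.contDiffAt (hV.mem_nhds hy)).differentiableAt (by norm_num))
    filter_upwards [hV.mem_nhds hy] with y hy using hG y hy
  have hCe : ∀ i j l, christoffelFirstCoord G i j l =ᶠ[𝓝 z] fun y => lowerChristoffel B y
      (EuclideanSpace.single i 1) (EuclideanSpace.single j 1) (EuclideanSpace.single l 1) := by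
    intro i j l
    filter_upwards [hV.mem_nhds hz] with y hy using hC y hy _ _ _
  have hM : IsC1MetricAt G z := by
    refine ⟨fun a b => ?_, ?_, hw.det_gramMatrix_ne_zero hGl hGr⟩
    · have h : ContDiffAt ℝ 1 (fun y => B y (EuclideanSpace.single a 1)
          (EuclideanSpace.single b 1)) z :=
        ((hBz.of_le (by norm_num)).clm_apply contDiffAt_const).clm_apply contDiffAt_const
      refine h.congr_of_eventuallyEq ?_
      filter_upwards [hV.mem_nhds hz] with y hy using hG y hy _ _
    · filter_upwards [hV.mem_nhds hz] with y hy a b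
      rw [hG y hy, hG y hy, hsymm y hy]
  rw [hM.ricciCoord_eq fun i j l => (differentiableAt_lowerChristoffel hBz _ _ _).congr_of_eventuallyEq
    (hCe i j l)]
  have hR : ∀ i l, partialDeriv i (christoffelFirstCoord G j k l) z
        - partialDeriv j (christoffelFirstCoord G i k l) z + riemannQuadratic G i j k l z
      = frameCurvature B z w (EuclideanSpace.single i 1) (EuclideanSpace.single j 1)
        (EuclideanSpace.single k 1) (EuclideanSpace.single l 1) := by
    intro i l
    have hq : riemannQuadratic G i j k l z = ∑ A, (-lowerChristoffel B z (EuclideanSpace.single j 1)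
          (EuclideanSpace.single k 1) (w A)
          * lowerChristoffel B z (EuclideanSpace.single i 1) (EuclideanSpace.single l 1) (w A)
        + lowerChristoffel B z (EuclideanSpace.single i 1) (EuclideanSpace.single k 1) (w A)
          * lowerChristoffel B z (EuclideanSpace.single j 1) (EuclideanSpace.single l 1) (w A)) := by
      simp only [riemannQuadratic, christoffelFirstCoord, hC z hz]
      exact hw.sum_inv_gramMatrix_mul hGl hGr
        (T := fun u v => -lowerChristoffel B z (EuclideanSpace.single j 1)
          (EuclideanSpace.single k 1) u
          * lowerChristoffel B z (EuclideanSpace.single i 1) (EuclideanSpace.single l 1) v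
        + lowerChristoffel B z (EuclideanSpace.single i 1) (EuclideanSpace.single k 1) u
          * lowerChristoffel B z (EuclideanSpace.single j 1) (EuclideanSpace.single l 1) v)
        (fun v => by
          simp only [neg_mul, ← mul_neg]
          exact isLinearMap_add (isLinearMap_mul_const (isLinearMap_lowerChristoffel_right _ _) _)
            (isLinearMap_mul_const (isLinearMap_lowerChristoffel_right _ _) _))
        (fun v => isLinearMap_add
            (isLinearMap_const_mul (isLinearMap_lowerChristoffel_right _ _) _)
            (isLinearMap_const_mul (isLinearMap_lowerChristoffel_right _ _) _))
    rw [hq]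
    simp only [partialDeriv, (hCe _ _ _).fderiv_eq, fderiv_lowerChristoffel hBz, frameCurvature,
      neg_mul, Finset.sum_add_distrib, Finset.sum_neg_distrib]
    ring
  simp only [hR]
  exact hw.sum_inv_gramMatrix_mul hGl hGr
    (T := fun u v => frameCurvature B z w u (EuclideanSpace.single j 1)
      (EuclideanSpace.single k 1) v) (fun v => isLinearMap_frameCurvature₁ _ _ _)
      (fun v => isLinearMap_frameCurvature₄ _ _ _)

theorem sum_ricciCoord_mul (a b : EuclideanSpace ℝ (Fin n)) :
    ∑ j, ∑ k, ricciCoord G j k z * a j * b k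
      = ∑ A, frameCurvature B z w (w A) a b (w A) := by
  simp only [ricciCoord_eq_sum_frameCurvature hV hB hsymm hG hz hw]
  rw [apply_eq_sum_mul (b := fun u v => ∑ A, frameCurvature B z w (w A) u v (w A))
    (fun v => isLinearMap_sum _ fun A => isLinearMap_frameCurvature₂ _ _ _)
    (fun v => isLinearMap_sum _ fun A => isLinearMap_frameCurvature₃ _ _ _)]
  exact Finset.sum_congr rfl fun j _ => Finset.sum_congr rfl fun k _ => by ring

theorem sum_inverseMetric_mul_ricciCoord :
    ∑ j, ∑ k, inverseMetric G j k z * ricciCoord G j k z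
      = ∑ C, ∑ A, frameCurvature B z w (w A) (w C) (w C) (w A) := by
  have hGl : ∀ v, IsLinearMap ℝ fun u => G z u v := fun v =>
    ⟨fun a b => by simp [hG z hz], fun r a => by simp [hG z hz]⟩
  have hGr : ∀ v, IsLinearMap ℝ (G z v) := fun v =>
    ⟨fun a b => by simp [hG z hz], fun r a => by simp [hG z hz]⟩
  simp only [ricciCoord_eq_sum_frameCurvature hV hB hsymm hG hz hw]
  exact hw.sum_inv_gramMatrix_mul hGl hGr
    (T := fun u v => ∑ A, frameCurvature B z w (w A) u v (w A))
    (fun v => isLinearMap_sum _ fun A => isLinearMap_frameCurvature₂ _ _ _)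
    (fun v => isLinearMap_sum _ fun A => isLinearMap_frameCurvature₃ _ _ _)

end Ricci

end HypersurfaceGeometry

/-! ### Linear algebra of the bordered matrix. -/

section BorderedMatrix

open Matrix

/-- The symmetric matrix with first row `(d, b)` and with lower right block `c S`. -/
def borderedMatrix {m : ℕ} (d : ℝ) (b : Fin m → ℝ) (c : ℝ) (S : Matrix (Fin m) (Fin m) ℝ) :
    Matrix (Fin (m + 1)) (Fin (m + 1)) ℝ :=
  Matrix.of (Fin.cons (Fin.cons d b) fun i => Fin.cons (b i) fun j => c * S i j)

variable {m : ℕ} (d : ℝ) (b : Fin m → ℝ) (c : ℝ) (S : Matrix (Fin m) (Fin m) ℝ)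

@[simp] theorem borderedMatrix_zero_zero : borderedMatrix d b c S 0 0 = d := rfl

@[simp] theorem borderedMatrix_zero_succ (i : Fin m) : borderedMatrix d b c S 0 i.succ = b i := rfl

@[simp] theorem borderedMatrix_succ_zero (i : Fin m) : borderedMatrix d b c S i.succ 0 = b i := rfl

@[simp] theorem borderedMatrix_succ_succ (i j : Fin m) :
    borderedMatrix d b c S i.succ j.succ = c * S i j := rfl

theorem trace_borderedMatrix : (borderedMatrix d b c S).trace = d + c * S.trace := by
  simp [Matrix.trace, Fin.sum_univ_succ, Finset.mul_sum]

theorem sum_sub_trace_sq (hm : m ≠ 0) :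
    ∑ i, ∑ j, (S i j - if i = j then S.trace / m else 0) ^ 2
      = ∑ i, ∑ j, S i j * S i j - S.trace ^ 2 / m := by
  have h : ∀ i j, (S i j - if i = j then S.trace / m else 0) ^ 2
      = S i j * S i j + (if i = j then (S.trace / m) ^ 2 - 2 * (S.trace / m) * S i j else 0) := by
    intro i j
    split_ifs <;> ring
  have hm' : (m : ℝ) ≠ 0 := Nat.cast_ne_zero.2 hm
  simp only [h, Finset.sum_add_distrib, Finset.sum_ite_eq, Finset.mem_univ, if_true,
    Finset.sum_sub_distrib, ← Finset.mul_sum, Finset.sum_const, Finset.card_univ, Fintype.card_fin,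
    nsmul_eq_mul]
  have : ∑ i, S i i = S.trace := rfl
  rw [this]
  field_simp
  ring

/-- The algebraic core, with `m = n - 1`. The square of the corner `d` cancels in `H² - |A|²`, and
its mixed term with `c tr S` cancels against the one in `c H tr S`. Since `(m + 1) / (2m) = 1/2 +
1/(2m)`, exactly `-c² (tr S)² / (2m)` is left over, which completes `½ c² |S|²` to the trace-free
part. -/
theorem trace_mul_trace_sub_eq (hm : m ≠ 0) :
    c * (borderedMatrix d b c S).trace * S.trace
      - (1 / 2 * ∑ j, ∑ i, (borderedMatrix d b c S j j * borderedMatrix d b c S i i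
          - borderedMatrix d b c S i j * borderedMatrix d b c S i j)
        + ((m : ℝ) + 1) / (2 * m) * c ^ 2 * S.trace ^ 2)
      = 1 / 2 * c ^ 2 * ∑ i, ∑ j, (S i j - if i = j then S.trace / m else 0) ^ 2
        + ∑ i, b i ^ 2 := by
  have hm' : (m : ℝ) ≠ 0 := Nat.cast_ne_zero.2 hm
  have h1 : ∑ j, ∑ i, borderedMatrix d b c S j j * borderedMatrix d b c S i i
      = (d + c * S.trace) ^ 2 := by
    rw [← trace_borderedMatrix d b, pow_two]
    simp only [Matrix.trace, Matrix.diag_apply, Finset.sum_mul, Finset.mul_sum]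
    exact Finset.sum_comm
  have h2 : ∑ j, ∑ i, borderedMatrix d b c S i j * borderedMatrix d b c S i j
      = d ^ 2 + 2 * ∑ i, b i ^ 2 + c ^ 2 * ∑ i, ∑ j, S i j * S i j := by
    simp only [Fin.sum_univ_succ, borderedMatrix_zero_zero, borderedMatrix_zero_succ,
      borderedMatrix_succ_zero, borderedMatrix_succ_succ, Finset.sum_add_distrib]
    have e1 : ∑ j, ∑ i, c * S i j * (c * S i j) = c ^ 2 * ∑ i, ∑ j, S i j * S i j := by
      rw [Finset.sum_comm]
      simp only [Finset.mul_sum]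
      exact Finset.sum_congr rfl fun i _ => Finset.sum_congr rfl fun j _ => by ring
    rw [e1]
    simp only [pow_two]
    ring
  simp only [Finset.sum_sub_distrib]
  rw [h1, h2, trace_borderedMatrix, sum_sub_trace_sq S hm]
  field_simp
  ring

theorem trace_mul_trace_sub_nonneg (hm : m ≠ 0) :
    0 ≤ c * (borderedMatrix d b c S).trace * S.trace
      - (1 / 2 * ∑ j, ∑ i, (borderedMatrix d b c S j j * borderedMatrix d b c S i i
          - borderedMatrix d b c S i j * borderedMatrix d b c S i j)
        + ((m : ℝ) + 1) / (2 * m) * c ^ 2 * S.trace ^ 2) := by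
  rw [trace_mul_trace_sub_eq d b c S hm]
  have h1 : 0 ≤ ∑ i, ∑ j, (S i j - if i = j then S.trace / m else 0) ^ 2 :=
    Finset.sum_nonneg fun i _ => Finset.sum_nonneg fun j _ => sq_nonneg _
  have h2 : 0 ≤ ∑ i, b i ^ 2 := Finset.sum_nonneg fun i _ => sq_nonneg _
  positivity

/-- The trace-free part is weighted by `c²`, so its vanishing can be read off only for `c ≠ 0`. -/
theorem trace_mul_trace_sub_eq_zero_iff (hm : m ≠ 0) (hc : c ≠ 0) :
    c * (borderedMatrix d b c S).trace * S.trace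
      - (1 / 2 * ∑ j, ∑ i, (borderedMatrix d b c S j j * borderedMatrix d b c S i i
          - borderedMatrix d b c S i j * borderedMatrix d b c S i j)
        + ((m : ℝ) + 1) / (2 * m) * c ^ 2 * S.trace ^ 2) = 0
      ↔ ∃ κ : ℝ, S = κ • (1 : Matrix (Fin m) (Fin m) ℝ) ∧ b = 0 := by
  rw [trace_mul_trace_sub_eq d b c S hm]
  have h1 : 0 ≤ ∑ i, ∑ j, (S i j - if i = j then S.trace / m else 0) ^ 2 :=
    Finset.sum_nonneg fun i _ => Finset.sum_nonneg fun j _ => sq_nonneg _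
  have h2 : 0 ≤ ∑ i, b i ^ 2 := Finset.sum_nonneg fun i _ => sq_nonneg _
  have hc2 : 0 < 1 / 2 * c ^ 2 := by positivity
  rw [add_eq_zero_iff_of_nonneg (by positivity) h2, mul_eq_zero, or_iff_right hc2.ne']
  constructor
  · rintro ⟨h3, h4⟩
    refine ⟨S.trace / m, ?_, ?_⟩
    · ext i j
      rw [Finset.sum_eq_zero_iff_of_nonneg
        fun i _ => Finset.sum_nonneg fun j _ => sq_nonneg _] at h3
      have h5 := h3 i (Finset.mem_univ i)
      rw [Finset.sum_eq_zero_iff_of_nonneg fun j _ => sq_nonneg _] at h5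
      have h6 := pow_eq_zero_iff (two_ne_zero) |>.1 (h5 j (Finset.mem_univ j))
      rw [Matrix.smul_apply, Matrix.one_apply, sub_eq_zero.1 h6]
      simp
    · ext i
      rw [Finset.sum_eq_zero_iff_of_nonneg fun i _ => sq_nonneg _] at h4
      exact pow_eq_zero_iff (two_ne_zero) |>.1 (h4 i (Finset.mem_univ i))
  · rintro ⟨κ, rfl, rfl⟩
    have hm' : (m : ℝ) ≠ 0 := Nat.cast_ne_zero.2 hm
    have ht : (κ • (1 : Matrix (Fin m) (Fin m) ℝ)).trace / m = κ := by
      simp [Matrix.trace_smul, hm']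
    rw [ht]
    refine ⟨?_, by simp⟩
    refine Finset.sum_eq_zero fun i _ => Finset.sum_eq_zero fun j _ => ?_
    rw [Matrix.smul_apply, Matrix.one_apply]
    split_ifs <;> simp

/-- Subtracting `c κ` leaves a matrix supported in its first row and column. Its kernel has
dimension at least `m` exactly when its rank is at most 1, and a nonzero `b i` would make two
columns independent. The corner is irrelevant, so the multiplicity may also be `m + 1`. -/
theorem le_finrank_eigenspace_borderedMatrix_iff (κ : ℝ)
    (hS : S = κ • (1 : Matrix (Fin m) (Fin m) ℝ)) :
    m ≤ Module.finrank ℝ (Module.End.eigenspace (Matrix.toLin' (borderedMatrix d b c S)) (c * κ))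
      ↔ b = 0 := by
  set L : (Fin (m + 1) → ℝ) →ₗ[ℝ] (Fin (m + 1) → ℝ) :=
    Matrix.toLin' (borderedMatrix d b c S) - (c * κ) • 1 with hL
  have hker : Module.End.eigenspace (Matrix.toLin' (borderedMatrix d b c S)) (c * κ)
      = LinearMap.ker L := by
    rw [Module.End.eigenspace_def, hL]
  have hrn := LinearMap.finrank_range_add_finrank_ker L
  rw [Module.finrank_fin_fun] at hrn
  have h0 : ∀ v, L v 0 = (d - c * κ) * v 0 + ∑ i, b i * v i.succ := by
    intro v
    simp [hL, Matrix.toLin'_apply, Matrix.mulVec, dotProduct, Fin.sum_univ_succ]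
    ring
  have hs : ∀ v i, L v (Fin.succ i) = b i * v 0 := by
    intro v i
    simp [hL, Matrix.toLin'_apply, Matrix.mulVec, dotProduct, Fin.sum_univ_succ, hS,
      Matrix.one_apply]
  rw [hker]
  constructor
  · intro h
    have h1 : Module.finrank ℝ (LinearMap.range L) ≤ 1 := by omega
    obtain ⟨v, hv⟩ := finrank_le_one_iff.1 h1
    by_contra hb
    obtain ⟨i, hi⟩ := Function.ne_iff.1 hb
    rw [Pi.zero_apply] at hi
    -- Columns `0` and `i + 1` are multiples of one vector `v`. The second has entry `b i ≠ 0` at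
    -- `0` and entry `0` at `i + 1`, so `v` vanishes at `i + 1`; but the first has entry `b i`
    -- there.
    obtain ⟨r, hr⟩ := hv ⟨L (Pi.single 0 1), LinearMap.mem_range_self _ _⟩
    obtain ⟨t, ht⟩ := hv ⟨L (Pi.single i.succ 1), LinearMap.mem_range_self _ _⟩
    have hr' : r • (v : Fin (m + 1) → ℝ) = L (Pi.single 0 1) := congrArg Subtype.val hr
    have ht' : t • (v : Fin (m + 1) → ℝ) = L (Pi.single i.succ 1) := congrArg Subtype.val ht
    have e1 := congrFun hr' i.succ
    have e2 := congrFun ht' 0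
    have e3 := congrFun ht' i.succ
    rw [hs] at e1 e3
    rw [h0] at e2
    have e4 : ∑ j, b j * (Pi.single i.succ 1 : Fin (m + 1) → ℝ) j.succ = b i := by
      simp [Pi.single_apply]
    rw [e4] at e2
    simp only [Pi.smul_apply, smul_eq_mul, Pi.single_eq_same, mul_one] at e1 e2 e3
    have e5 : (Pi.single i.succ 1 : Fin (m + 1) → ℝ) 0 = 0 := by
      simp [(Fin.succ_ne_zero i).symm]
    rw [e5, mul_zero] at e3
    rw [e5, mul_zero, zero_add] at e2
    have ht0 : t ≠ 0 := fun h => hi (by rw [← e2, h, zero_mul])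
    have hv0 := (mul_eq_zero.1 e3).resolve_left ht0
    exact hi (by rw [← e1, hv0, mul_zero])
  · intro hb
    have hle : LinearMap.range L ≤ Submodule.span ℝ {Pi.single 0 1} := by
      rintro _ ⟨v, rfl⟩
      refine Submodule.mem_span_singleton.2 ⟨L v 0, ?_⟩
      ext j
      refine Fin.cases ?_ (fun i => ?_) j
      · simp
      · rw [hs, hb]
        simp [Fin.succ_ne_zero]
    have h1 := (Submodule.finrank_mono hle).trans
      (finrank_span_le_card ({Pi.single 0 1} : Set (Fin (m + 1) → ℝ)))
    simp only [Set.toFinset_singleton, Finset.card_singleton] at h1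
    omega

/-- The map given by `P` carries the eigenspace of `D` onto that of `A`. -/
theorem finrank_eigenspace_toLin'_eq_of_conj {ι : Type*} [Fintype ι] [DecidableEq ι]
    {A D P Q : Matrix ι ι ℝ} (hPQ : P * Q = 1) (hQP : Q * P = 1) (h : A * P = P * D) (μ : ℝ) :
    Module.finrank ℝ (Module.End.eigenspace (Matrix.toLin' A) μ)
      = Module.finrank ℝ (Module.End.eigenspace (Matrix.toLin' D) μ) := by
  let e : (ι → ℝ) ≃ₗ[ℝ] (ι → ℝ) := Matrix.toLin'OfInv hQP hPQ
  have hmap : Module.End.eigenspace (Matrix.toLin' A) μ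
      = (Module.End.eigenspace (Matrix.toLin' D) μ).map e.toLinearMap := by
    ext v
    rw [Submodule.mem_map_equiv, Module.End.mem_eigenspace_iff, Module.End.mem_eigenspace_iff]
    have he : e.symm v = Q *ᵥ v := by
      rw [LinearEquiv.symm_apply_eq]
      change v = Matrix.toLin' P (Q *ᵥ v)
      rw [Matrix.toLin'_apply, Matrix.mulVec_mulVec, hPQ, Matrix.one_mulVec]
    rw [he, Matrix.toLin'_apply, Matrix.toLin'_apply]
    have hv : P *ᵥ (Q *ᵥ v) = v := by rw [Matrix.mulVec_mulVec, hPQ, Matrix.one_mulVec]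
    have h2 : Q * A = D * Q := by
      calc Q * A = Q * (A * (P * Q)) := by rw [hPQ, Matrix.mul_one]
        _ = Q * (A * P) * Q := by simp only [Matrix.mul_assoc]
        _ = D * Q := by rw [h, ← Matrix.mul_assoc, hQP, Matrix.one_mul]
    constructor
    · intro hA
      rw [Matrix.mulVec_mulVec, ← h2, ← Matrix.mulVec_mulVec, hA, Matrix.mulVec_smul]
    · intro hD
      rw [← hv, Matrix.mulVec_mulVec, h, ← Matrix.mulVec_mulVec, hD, Matrix.mulVec_smul]
  rw [hmap, LinearEquiv.finrank_map_eq]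

end BorderedMatrix

/-! ### The product metric, adapted frames, and curvature of the product. -/

namespace HypersurfaceGeometry

set_option maxSynthPendingDepth 3

section ProductMetric

variable {F : Type*} [NormedAddCommGroup F] [NormedSpace ℝ F]

/-- The product metric `B + dt²`. -/
noncomputable def productBilin (B : F → F →L[ℝ] F →L[ℝ] ℝ) (p : F × ℝ) :
    F × ℝ →L[ℝ] F × ℝ →L[ℝ] ℝ :=
  (B p.1).bilinearComp (ContinuousLinearMap.fst ℝ F ℝ) (ContinuousLinearMap.fst ℝ F ℝ)
    + (ContinuousLinearMap.mul ℝ ℝ).bilinearComp (ContinuousLinearMap.snd ℝ F ℝ)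
      (ContinuousLinearMap.snd ℝ F ℝ)

variable {B : F → F →L[ℝ] F →L[ℝ] ℝ}

@[simp] theorem productBilin_apply (p a b : F × ℝ) :
    productBilin B p a b = B p.1 a.1 b.1 + a.2 * b.2 := by
  simp [productBilin]

theorem contDiffOn_productBilin [FiniteDimensional ℝ F] {k : ℕ∞ω} {V : Set F}
    (hB : ContDiffOn ℝ k B V) : ContDiffOn ℝ k (productBilin B) (V ×ˢ Set.univ) := by
  rw [contDiffOn_clm_apply]
  intro a
  rw [contDiffOn_clm_apply]
  intro b
  simp only [productBilin_apply]
  have h : ContDiffOn ℝ k (fun p : F × ℝ => B p.1) (V ×ˢ Set.univ) :=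
    hB.comp contDiff_fst.contDiffOn fun p hp => hp.1
  exact ((h.clm_apply contDiffOn_const).clm_apply contDiffOn_const).add contDiffOn_const

variable [FiniteDimensional ℝ F] {V : Set F} (hV : IsOpen V) (hB : ContDiffOn ℝ 2 B V) {p : F × ℝ}
  (hp : p.1 ∈ V)
include hV hB hp

/-- The summand `dt²` is constant and `B` does not depend on `t`, so only `F`-components enter.
Christoffel symbols and curvature of the product inherit this. -/
theorem fderiv_productBilin (a b c : F × ℝ) :
    fderiv ℝ (productBilin B) p a b c = fderiv ℝ B p.1 a.1 b.1 c.1 := by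
  have hd : HasFDerivAt (productBilin B) (fderiv ℝ (productBilin B) p) p :=
    (((contDiffOn_productBilin hB).contDiffAt ((hV.prod isOpen_univ).mem_nhds
      ⟨hp, Set.mem_univ _⟩)).differentiableAt (by norm_num)).hasFDerivAt
  have h := (hd.clm_apply (hasFDerivAt_const b p)).clm_apply (hasFDerivAt_const c p)
  have hdB : HasFDerivAt B (fderiv ℝ B p.1) p.1 :=
    ((hB.contDiffAt (hV.mem_nhds hp)).differentiableAt (by norm_num)).hasFDerivAt
  have h2 := ((((hdB.comp p hasFDerivAt_fst).clm_apply
    (hasFDerivAt_const b.1 p)).clm_apply (hasFDerivAt_const c.1 p))).add_const (b.2 * c.2)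
  have h3 := congrArg (fun L => L a) (h.unique (h2.congr_of_eventuallyEq
    (Filter.Eventually.of_forall fun y => by simp)))
  simpa using h3

theorem lowerChristoffel_productBilin (a b c : F × ℝ) :
    lowerChristoffel (productBilin B) p a b c = lowerChristoffel B p.1 a.1 b.1 c.1 := by
  simp only [lowerChristoffel, fderiv_productBilin hV hB hp]

theorem lowerChristoffelDeriv_productBilin (a b c d : F × ℝ) :
    lowerChristoffelDeriv (productBilin B) p a b c d
      = lowerChristoffelDeriv B p.1 a.1 b.1 c.1 d.1 := by
  have hBp : ContDiffAt ℝ 2 B p.1 := hB.contDiffAt (hV.mem_nhds hp)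
  have hPp : ContDiffAt ℝ 2 (productBilin B) p :=
    (contDiffOn_productBilin hB).contDiffAt ((hV.prod isOpen_univ).mem_nhds ⟨hp, Set.mem_univ _⟩)
  rw [← fderiv_lowerChristoffel hPp, ← fderiv_lowerChristoffel hBp]
  have he : (fun y => lowerChristoffel (productBilin B) y b c d) =ᶠ[𝓝 p]
      fun y => lowerChristoffel B y.1 b.1 c.1 d.1 := by
    filter_upwards [(hV.prod isOpen_univ).mem_nhds (⟨hp, Set.mem_univ _⟩ : p ∈ V ×ˢ Set.univ)]
      with y hy using lowerChristoffel_productBilin hV hB hy.1 b c d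
  rw [he.fderiv_eq]
  have h := (differentiableAt_lowerChristoffel hBp b.1 c.1 d.1).hasFDerivAt.comp p
    (hasFDerivAt_fst (𝕜 := ℝ) (p := p))
  exact congrArg (fun L => L a) h.fderiv

end ProductMetric

section AdaptedFrames

variable {F : Type*} [AddCommGroup F] [Module ℝ F] [FiniteDimensional ℝ F]

/-- Frames adapted to a level set `J` of the height function on a hypersurface `X` in `F × ℝ`,
where `ν` is the normal of the hypersurface, and `η` the normal of the level set in `F`. -/
theorem exists_adapted_frame {m : ℕ} (hF : Module.finrank ℝ F = m + 1)
    (g : LinearMap.BilinForm ℝ F) (hsymm : ∀ v w, g v w = g w v) (hpos : ∀ v, v ≠ 0 → 0 < g v v)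
    {X : EuclideanSpace ℝ (Fin (m + 1)) →ₗ[ℝ] F × ℝ} (hX : Function.Injective X)
    {J : EuclideanSpace ℝ (Fin m) →ₗ[ℝ] EuclideanSpace ℝ (Fin (m + 1))}
    (hJ : Function.Injective J) (hXJ : ∀ v, (X (J v)).2 = 0) (hX2 : ∃ v, (X v).2 ≠ 0)
    {ν : F × ℝ} (hν : g ν.1 ν.1 + ν.2 * ν.2 = 1) (hνX : ∀ v, g ν.1 (X v).1 + ν.2 * (X v).2 = 0)
    {η : F} (hη : g η η = 1) (hηX : ∀ v, g η (X (J v)).1 = 0) :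
    ν.1 = g ν.1 η • η ∧ g ν.1 η * g ν.1 η + ν.2 * ν.2 = 1 ∧ g ν.1 η ≠ 0 ∧
    ∃ (f : Fin m → EuclideanSpace ℝ (Fin m)) (e : EuclideanSpace ℝ (Fin (m + 1))),
      IsOrthonormalFrame (fun v w => g (X (J v)).1 (X (J w)).1) f ∧
      IsOrthonormalFrame (fun v w => g v w) (Fin.cons η fun i => (X (J (f i))).1 : Fin (m + 1) → F) ∧
      X e = (-ν.2 • η, g ν.1 η) ∧
      IsOrthonormalFrame (fun v w => g (X v).1 (X w).1 + (X v).2 * (X w).2)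
        (Fin.cons e fun i => J (f i) : Fin (m + 1) → EuclideanSpace ℝ (Fin (m + 1))) ∧
      ∀ v : F × ℝ, (g v.1 ν.1 + v.2 * ν.2) • ν
        + ∑ A, (g v.1 (X ((Fin.cons e fun i => J (f i) :
            Fin (m + 1) → EuclideanSpace ℝ (Fin (m + 1))) A)).1
          + v.2 * (X ((Fin.cons e fun i => J (f i) :
            Fin (m + 1) → EuclideanSpace ℝ (Fin (m + 1))) A)).2) •
          X ((Fin.cons e fun i => J (f i) : Fin (m + 1) → EuclideanSpace ℝ (Fin (m + 1))) A) = v := by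
  let Y : EuclideanSpace ℝ (Fin m) →ₗ[ℝ] F := LinearMap.fst ℝ F ℝ ∘ₗ X ∘ₗ J
  have hY : ∀ v, X (J v) = (Y v, 0) := fun v => Prod.ext rfl (hXJ v)
  have hYinj : Function.Injective Y := by
    intro v w h
    apply hJ
    apply hX
    rw [hY, hY, h]
  obtain ⟨f, hf⟩ := exists_isOrthonormalFrame (V := EuclideanSpace ℝ (Fin m)) (m := m) (by simp)
    (g.compl₁₂ Y Y) (fun v w => hsymm _ _)
    (fun v hv => hpos _ fun h => hv (hYinj (by rw [h, map_zero])))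
  have hf' : ∀ i j, g (Y (f i)) (Y (f j)) = if i = j then 1 else 0 := hf
  have hηY : ∀ v, g η (Y v) = 0 := hηX
  have hYη : ∀ v, g (Y v) η = 0 := fun v => by rw [hsymm, hηY]
  have hw : IsOrthonormalFrame (fun v w => g v w)
      (Fin.cons η fun i => Y (f i) : Fin (m + 1) → F) := by
    intro i j
    refine Fin.cases ?_ (fun i => ?_) i <;> refine Fin.cases ?_ (fun j => ?_) j
    · simpa using hη
    · simpa [(Fin.succ_ne_zero j).symm] using hηY _
    · simpa [Fin.succ_ne_zero] using hYη _
    · simpa using hf' i j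
  have hexp : ∀ v, g v η • η + ∑ i, g v (Y (f i)) • Y (f i) = v := by
    intro v
    have := hw.sum_smul_eq (by simp [hF]) v
    rw [Fin.sum_univ_succ] at this
    simpa using this
  have hνY : ∀ v, g ν.1 (Y v) = 0 := by
    intro v
    have := hνX (J v)
    rw [hY] at this
    simpa using this
  -- `ν.1` is orthogonal to the tangent space of the level set, whose orthogonal complement in `F`
  -- is spanned by `η`.
  have hν1 : ν.1 = g ν.1 η • η := by
    have := hexp ν.1
    simp only [hνY, zero_smul, Finset.sum_const_zero, add_zero] at this
    exact this.symm
  set c := g ν.1 η with hcdef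
  have hν1ν : g ν.1 ν.1 = c * c := by
    conv_lhs => rw [hν1]
    simp [hη]
  have hc1 : c * c + ν.2 * ν.2 = 1 := by rw [← hν1ν, hν]
  -- If `c = 0` then `ν = (0, ±1)`, and orthogonality to the image of `X` makes `dt` vanish on it,
  -- contrary to `hX2`.
  have hc0 : c ≠ 0 := by
    intro h
    obtain ⟨v, hv⟩ := hX2
    rw [h] at hc1 hν1
    have h1 := hνX v
    rw [hν1] at h1
    simp at h1
    rcases h1 with h1 | h1
    · simp [h1] at hc1
    · exact hv h1
  -- the image of `X` is the orthogonal complement of `ν`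
  let N : F × ℝ →ₗ[ℝ] ℝ := (g ν.1).coprod (ν.2 • LinearMap.id)
  have hN : ∀ v, N v = g ν.1 v.1 + ν.2 * v.2 := fun v => by simp [N]
  have hrange : LinearMap.range X = LinearMap.ker N := by
    refine Submodule.eq_of_le_of_finrank_eq ?_ ?_
    · rintro _ ⟨v, rfl⟩
      rw [LinearMap.mem_ker, hN, hνX]
    · have h1 := LinearMap.finrank_range_of_inj hX
      have h2 := LinearMap.finrank_range_add_finrank_ker N
      have h3 : LinearMap.range N = ⊤ := by
        rw [LinearMap.range_eq_top]
        refine LinearMap.surjective fun h => ?_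
        have := congrArg (fun L => L ν) h
        simp [hN, hν] at this
      rw [h3, finrank_top, Module.finrank_prod, hF, Module.finrank_self] at h2
      rw [h1]
      simp
      omega
  -- This vector is `ν = (c η, ν.2)` turned by a right angle in the plane of `η` and `∂_t`. By
  -- dimension the image of `X` is the whole orthogonal complement of `ν`.
  have hmem : ((-ν.2 • η, c) : F × ℝ) ∈ LinearMap.range X := by
    rw [hrange, LinearMap.mem_ker, hN]
    simp only [map_smul, smul_eq_mul]
    rw [← hcdef]
    ring
  obtain ⟨e, he⟩ := hmem
  refine ⟨hν1, hc1, hc0, f, e, hf, hw, he, ?_, ?_⟩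
  · intro i j
    refine Fin.cases ?_ (fun i => ?_) i <;> refine Fin.cases ?_ (fun j => ?_) j
    · simp only [Fin.cons_zero, he, map_smul, LinearMap.smul_apply, smul_eq_mul, hη, if_true]
      linarith
    · simp [he, hY, hηY, (Fin.succ_ne_zero j).symm]
    · simp [he, hY, hYη, Fin.succ_ne_zero]
    · simp [hY, hf']
  · intro v
    rw [Fin.sum_univ_succ]
    simp only [Fin.cons_zero, Fin.cons_succ, he, hY]
    have h1 : g v.1 ν.1 = c * g v.1 η := by
      conv_lhs => rw [hν1]
      simp
    have hv := hexp v.1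
    refine Prod.ext ?_ ?_
    · simp only [Prod.fst_add, Prod.smul_fst, Prod.fst_sum, map_smul, smul_eq_mul, h1, mul_zero,
        add_zero]
      conv_rhs => rw [← hv]
      rw [← add_assoc]
      congr 1
      conv_lhs => rw [hν1]
      simp only [smul_smul, ← add_smul]
      congr 1
      linear_combination (g v.1 η) * hc1
    · simp only [Prod.snd_add, Prod.smul_snd, Prod.snd_sum, map_smul, smul_eq_mul, h1, mul_zero,
        add_zero, Finset.sum_const_zero]
      linear_combination v.2 * hc1

end AdaptedFrames

section ProductCurvature

variable {F : Type*} [NormedAddCommGroup F] [NormedSpace ℝ F]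
  {B : F → F →L[ℝ] F →L[ℝ] ℝ} {V : Set F} {m : ℕ}

/-- The frame of the product has one vector more than the frame of the factor. Its first two vectors
project to `c η` and `-τ η`; each quadratic term is quadratic in the frame vector, so together they
contribute `c² + τ² = 1` times the term of `η`. -/
theorem frameCurvature_productBilin [FiniteDimensional ℝ F] (hV : IsOpen V) (hB : ContDiffOn ℝ 2 B V) {p : F × ℝ}
    (hp : p.1 ∈ V) {η : F} {u : Fin m → F} {c τ : ℝ} (hc : c * c + τ * τ = 1) {ν : F × ℝ}
    (hν : ν.1 = c • η) {w : Fin (m + 1) → F × ℝ} (hw0 : (w 0).1 = -τ • η)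
    (hws : ∀ i : Fin m, (w i.succ).1 = u i) (a₁ a₂ a₃ a₄ : F × ℝ) :
    frameCurvature (productBilin B) p (Fin.cons ν w : Fin (m + 2) → F × ℝ) a₁ a₂ a₃ a₄
      = frameCurvature B p.1 (Fin.cons η u : Fin (m + 1) → F) a₁.1 a₂.1 a₃.1 a₄.1 := by
  have hsmul : ∀ (r : ℝ) (a b v : F),
      lowerChristoffel B p.1 a b (r • v) = r * lowerChristoffel B p.1 a b v :=
    fun r a b v => (isLinearMap_lowerChristoffel_right a b).map_smul r v
  simp only [frameCurvature, lowerChristoffel_productBilin hV hB hp,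
    lowerChristoffelDeriv_productBilin hV hB hp, Fin.sum_univ_succ, Fin.cons_zero, Fin.cons_succ,
    hν, hw0, hws, hsmul]
  linear_combination (lowerChristoffel B p.1 a₁.1 a₃.1 η * lowerChristoffel B p.1 a₂.1 a₄.1 η
    - lowerChristoffel B p.1 a₂.1 a₃.1 η * lowerChristoffel B p.1 a₁.1 a₄.1 η) * hc

/-- The trace of the curvature tensor over the tangent space of a hypersurface in a product. -/
theorem sum_frameCurvature_eq {y : F} (hBy : ContDiffAt ℝ 2 B y) {ι : Type*} [Fintype ι]
    {w : ι → F} {η : F} {u : Fin m → F} {c τ : ℝ} (hc : c * c + τ * τ = 1)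
    {v : Fin (m + 1) → F} (hv0 : v 0 = -τ • η) (hvs : ∀ i : Fin m, v i.succ = u i) :
    ∑ b, ∑ a, frameCurvature B y w (v a) (v b) (v b) (v a)
      = ∑ C, ∑ A, frameCurvature B y w ((Fin.cons η u : Fin (m + 1) → F) A)
          ((Fin.cons η u : Fin (m + 1) → F) C) ((Fin.cons η u : Fin (m + 1) → F) C)
          ((Fin.cons η u : Fin (m + 1) → F) A)
        - 2 * c ^ 2 * ∑ A, frameCurvature B y w ((Fin.cons η u : Fin (m + 1) → F) A) η η
          ((Fin.cons η u : Fin (m + 1) → F) A) := by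
  have h0 : ∀ a b, frameCurvature B y w a a b b = 0 := fun a b => by
    have := frameCurvature_swap_left (B := B) (y := y) (w := w) a a b b
    linarith
  have hsw : ∀ i, frameCurvature B y w η (u i) (u i) η = frameCurvature B y w (u i) η η (u i) := by
    intro i
    rw [frameCurvature_swap_left, frameCurvature_swap_right hBy, neg_neg]
  have hs : ∀ i, frameCurvature B y w (-τ • η) (u i) (u i) (-τ • η)
      = τ * τ * frameCurvature B y w η (u i) (u i) η := by
    intro i
    have e1 := (isLinearMap_frameCurvature₁ (B := B) (y := y) (w := w) (u i) (u i) (-τ • η)).map_smul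
      (-τ) η
    have e2 := (isLinearMap_frameCurvature₄ (B := B) (y := y) (w := w) η (u i) (u i)).map_smul (-τ) η
    simp only [smul_eq_mul] at e1 e2
    rw [e1, e2]
    ring
  have hs' : ∀ i, frameCurvature B y w (u i) (-τ • η) (-τ • η) (u i)
      = τ * τ * frameCurvature B y w (u i) η η (u i) := by
    intro i
    have e1 := (isLinearMap_frameCurvature₂ (B := B) (y := y) (w := w) (u i) (-τ • η) (u i)).map_smul
      (-τ) η
    have e2 := (isLinearMap_frameCurvature₃ (B := B) (y := y) (w := w) (u i) η (u i)).map_smul (-τ) η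
    simp only [smul_eq_mul] at e1 e2
    rw [e1, e2]
    ring
  simp only [Fin.sum_univ_succ, hv0, hvs, Fin.cons_zero, Fin.cons_succ, h0, hs, hs', hsw, zero_add,
    Finset.sum_add_distrib, ← Finset.mul_sum]
  -- Replacing `η` by `-τ η` scales the terms with `η` by `τ² = 1 - c²`. They occur as the pairs
  -- `(η, u i)` and `(u i, η)`, whence the factor 2.
  linear_combination (2 * ∑ i, frameCurvature B y w (u i) η η (u i)) * hc

end ProductCurvature

end HypersurfaceGeometry

/-! ### Maps and pull-back metrics in preferred charts. -/

namespace HypersurfaceGeometry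

set_option maxSynthPendingDepth 3

section Pullback

variable {E : Type*} [NormedAddCommGroup E] [NormedSpace ℝ E]
  {H : Type*} [TopologicalSpace H] {I : ModelWithCorners ℝ E H}
  {S : Type*} [TopologicalSpace S] [ChartedSpace H S]
  {E' : Type*} [NormedAddCommGroup E'] [NormedSpace ℝ E']
  {H' : Type*} [TopologicalSpace H'] {I' : ModelWithCorners ℝ E' H'}
  {Q : Type*} [TopologicalSpace Q] [ChartedSpace H' Q]
  {E'' : Type*} [NormedAddCommGroup E''] [NormedSpace ℝ E'']
  {H'' : Type*} [TopologicalSpace H''] {I'' : ModelWithCorners ℝ E'' H''}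
  {R : Type*} [TopologicalSpace R] [ChartedSpace H'' R]

/-- The tangent spaces at `q` and `q'` are distinct as types but both unfold to `E'`; taking vectors
in `E'` lets the base point be replaced. -/
theorem formField_congr (g : FormField I' Q) {q q' : Q} (h : q = q') (a b : E') :
    g q a b = g q' a b := by
  subst h
  rfl

theorem pullbackForm_congr (g : FormField I' Q) {f k : S → Q} {p : S} (h : f =ᶠ[𝓝 p] k)
    (a b : TangentSpace I p) : pullbackForm I I' g f p a b = pullbackForm I I' g k p a b := by
  have h1 : (mfderiv I I' f p : E →L[ℝ] E') = mfderiv I I' k p := h.mfderiv_eq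
  have h2 := formField_congr g h.eq_of_nhds (mfderiv I I' k p a) (mfderiv I I' k p b)
  refine Eq.trans ?_ h2
  change g (f p) ((mfderiv I I' f p : E →L[ℝ] E') a) ((mfderiv I I' f p : E →L[ℝ] E') b) = _
  rw [h1]
  rfl

theorem pullbackForm_pullbackForm (g : FormField I'' R) {f : Q → R} {k : S → Q} {p : S}
    (hf : MDifferentiableAt I' I'' f (k p)) (hk : MDifferentiableAt I I' k p)
    (a b : TangentSpace I p) :
    pullbackForm I I' (pullbackForm I' I'' g f) k p a b = pullbackForm I I'' g (f ∘ k) p a b := by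
  have h := mfderiv_comp p hf hk
  simp only [pullbackForm, h]
  rfl

theorem mdifferentiableAt_extChartAt_symm [I'.Boundaryless] [IsManifold I' 1 Q] (q : Q) {z : E'}
    (hz : z ∈ (extChartAt I' q).target) :
    MDifferentiableAt 𝓘(ℝ, E') I' (extChartAt I' q).symm z := by
  have h := mdifferentiableWithinAt_extChartAt_symm (I := I') hz
  rwa [I'.range_eq_univ, mdifferentiableWithinAt_univ] at h

theorem injective_mfderiv_extChartAt_symm [I'.Boundaryless] [IsManifold I' 1 Q] (q : Q) {z : E'}
    (hz : z ∈ (extChartAt I' q).target) :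
    Function.Injective (mfderiv 𝓘(ℝ, E') I' (extChartAt I' q).symm z) := by
  have h := isInvertible_mfderivWithin_extChartAt_symm (I := I') hz
  rw [I'.range_eq_univ, mfderivWithin_univ] at h
  exact h.injective

theorem coordForm_self [I'.Boundaryless] [IsManifold I' 1 Q] (g : FormField I' Q) (q : Q)
    (a b : E') : coordForm I' g q (extChartAt I' q q) a b = g q a b := by
  have h := mfderivWithin_range_extChartAt_symm (I := I') (x := q)
  rw [I'.range_eq_univ, mfderivWithin_univ] at h
  simp only [coordForm, h]
  exact formField_congr g (extChartAt_to_inv q) a b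

theorem coordForm_pos [I'.Boundaryless] [IsManifold I' 1 Q] {g : FormField I' Q}
    (hpos : ∀ q (v : TangentSpace I' q), v ≠ 0 → 0 < g q v v) (q : Q) {z : E'}
    (hz : z ∈ (extChartAt I' q).target) {a : E'} (ha : a ≠ 0) : 0 < coordForm I' g q z a a := by
  refine hpos _ _ fun h => ha ?_
  exact injective_mfderiv_extChartAt_symm q hz (h.trans (map_zero _).symm)

theorem pullbackForm_pos {g : FormField I' Q}
    (hpos : ∀ q (v : TangentSpace I' q), v ≠ 0 → 0 < g q v v) {f : S → Q}
    (hf : ∀ p, Function.Injective (mfderiv I I' f p)) (p : S) {v : TangentSpace I p} (hv : v ≠ 0) :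
    0 < pullbackForm I I' g f p v v :=
  hpos _ _ fun h => hv (hf p (h.trans (map_zero _).symm))

theorem fderiv_extChartAt_comp [I.Boundaryless] {f : S → Q} {p : S}
    (hf : MDifferentiableAt I I' f p) :
    fderiv ℝ (fun y => extChartAt I' (f p) (f ((extChartAt I p).symm y))) (extChartAt I p p)
      = mfderiv I I' f p := by
  have h : mfderiv I I' f p = fderivWithin ℝ (writtenInExtChartAt I I' p f) (Set.range I)
      (extChartAt I p p) := if_pos hf
  rw [I.range_eq_univ, fderivWithin_univ] at h
  exact h.symm

/-- The part of the preferred chart domain at `p` which `f` maps into the preferred chart domain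
at `f p`, in coordinates. -/
def chartDomain (I : ModelWithCorners ℝ E H) (I' : ModelWithCorners ℝ E' H')
    (f : S → Q) (p : S) : Set E :=
  (extChartAt I p).target ∩ (extChartAt I p).symm ⁻¹' (f ⁻¹' (extChartAt I' (f p)).source)

/-- The expression of `f` in the preferred charts at `p` and `f p`. -/
noncomputable def chartMap (I : ModelWithCorners ℝ E H) (I' : ModelWithCorners ℝ E' H')
    (f : S → Q) (p : S) (y : E) : E' :=
  extChartAt I' (f p) (f ((extChartAt I p).symm y))

theorem isOpen_chartDomain [I.Boundaryless] {f : S → Q} (hf : Continuous f) (p : S) :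
    IsOpen (chartDomain I I' f p) :=
  (continuousOn_extChartAt_symm p).isOpen_inter_preimage (isOpen_extChartAt_target p)
    ((isOpen_extChartAt_source (f p)).preimage hf)

theorem mem_chartDomain (f : S → Q) (p : S) : extChartAt I p p ∈ chartDomain I I' f p := by
  refine ⟨mem_extChartAt_target p, ?_⟩
  simp only [Set.mem_preimage, extChartAt_to_inv]
  exact mem_extChartAt_source (f p)

theorem chartMap_self (f : S → Q) (p : S) :
    chartMap I I' f p (extChartAt I p p) = extChartAt I' (f p) (f p) := by
  simp [chartMap]

theorem contDiffOn_chartMap [I.Boundaryless] [IsManifold I 2 S] [IsManifold I' 2 Q]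
    {f : S → Q} (hf : ContMDiff I I' 2 f) (p : S) :
    ContDiffOn ℝ 2 (chartMap I I' f p) (chartDomain I I' f p) := by
  rw [← contMDiffOn_iff_contDiffOn]
  refine ContMDiffOn.comp (I' := I') (t := (extChartAt I' (f p)).source) ?_ ?_ ?_
  · simpa using contMDiffOn_extChartAt (I := I') (n := 2) (x := f p)
  · exact hf.comp_contMDiffOn ((contMDiffOn_extChartAt_symm p).mono Set.inter_subset_left)
  · exact fun z hz => hz.2

theorem mapsTo_chartMap (f : S → Q) (p : S) :
    Set.MapsTo (chartMap I I' f p) (chartDomain I I' f p) (extChartAt I' (f p)).target :=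
  fun _ hz => (extChartAt I' (f p)).map_source hz.2

/-- Both sides are pull-backs of `g` under `f` composed with the inverse chart at `p`, once directly
and once through the chart at `f p` and back, which is the identity on `chartDomain`. -/
theorem coordForm_pullbackForm [I.Boundaryless] [I'.Boundaryless] [IsManifold I 2 S]
    [IsManifold I' 2 Q] (g : FormField I' Q) {f : S → Q} (hf : ContMDiff I I' 2 f) (p : S) {z : E}
    (hz : z ∈ chartDomain I I' f p) (a b : E) :
    coordForm I (pullbackForm I I' g f) p z a b
      = coordForm I' g (f p) (chartMap I I' f p z) (fderiv ℝ (chartMap I I' f p) z a)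
          (fderiv ℝ (chartMap I I' f p) z b) := by
  have : IsManifold I 1 S := IsManifold.of_le (n := 2) one_le_two
  have : IsManifold I' 1 Q := IsManifold.of_le (n := 2) one_le_two
  have hU := (isOpen_chartDomain (I := I) (I' := I') hf.continuous p).mem_nhds hz
  have hx : DifferentiableAt ℝ (chartMap I I' f p) z :=
    ((contDiffOn_chartMap hf p).contDiffAt hU).differentiableAt (by norm_num)
  have h1 := pullbackForm_pullbackForm (I := 𝓘(ℝ, E)) g
    (hf.mdifferentiableAt (x := (extChartAt I p).symm z) (by norm_num))
    (mdifferentiableAt_extChartAt_symm p hz.1) a b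
  rw [← mfderiv_eq_fderiv]
  have h := pullbackForm_pullbackForm (I := 𝓘(ℝ, E)) g
    (mdifferentiableAt_extChartAt_symm (f p) (mapsTo_chartMap f p hz)) hx.mdifferentiableAt a b
  refine h1.trans (Eq.trans ?_ h.symm)
  refine pullbackForm_congr g ?_ a b
  filter_upwards [hU] with y hy
  exact ((extChartAt I' (f p)).left_inv hy.2).symm

theorem isPullbackOn_chartMap [I.Boundaryless] [I'.Boundaryless] [IsManifold I 2 S]
    [IsManifold I' 2 Q] {g : FormField I' Q} {f : S → Q} (hf : ContMDiff I I' 2 f) (p : S)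
    {B : E' → E' →L[ℝ] E' →L[ℝ] ℝ} (hB : ContDiffOn ℝ 2 B (extChartAt I' (f p)).target)
    (hBg : ∀ z ∈ (extChartAt I' (f p)).target, ∀ a b, coordForm I' g (f p) z a b = B z a b)
    (hsymm : ∀ q (v w : TangentSpace I' q), g q v w = g q w v) :
    IsPullbackOn B (extChartAt I' (f p)).target (chartMap I I' f p) (chartDomain I I' f p)
      (coordForm I (pullbackForm I I' g f) p) where
  isOpen_source := isOpen_chartDomain hf.continuous p
  isOpen_target := isOpen_extChartAt_target (f p)
  contDiffOn_map := contDiffOn_chartMap hf p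
  mapsTo := mapsTo_chartMap f p
  contDiffOn_form := hB
  symm := fun w hw a b => by rw [← hBg w hw, ← hBg w hw]; exact hsymm _ _ _
  eq_pullback := fun z hz a b => by
    rw [coordForm_pullbackForm g hf p hz, hBg _ (mapsTo_chartMap f p hz)]

/-- The differential of a preferred chart at its base point is the identity, so `ξ` is its own
coordinate vector. -/
theorem secondFundamentalForm_eq_hessianForm [I'.Boundaryless] [IsManifold I' 1 Q]
    {g : FormField I' Q} {f : S → Q} {p : S}
    {B : E' → E' →L[ℝ] E' →L[ℝ] ℝ} (hB : ContDiffOn ℝ 2 B (extChartAt I' (f p)).target)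
    (hBg : ∀ z ∈ (extChartAt I' (f p)).target, ∀ a b, coordForm I' g (f p) z a b = B z a b)
    (ξ : TangentSpace I' (f p)) (u v : E) :
    secondFundamentalForm I I' g f p ξ u v
      = hessianForm B (chartMap I I' f p) (extChartAt I p p) u v ξ := by
  have hz := mem_extChartAt_target (I := I') (f p)
  have hV := (isOpen_extChartAt_target (I := I') (f p)).mem_nhds hz
  have hd := (hB.contDiffAt hV).differentiableAt (by norm_num)
  have hζ : (mfderiv I' 𝓘(ℝ, E') (extChartAt I' (f p)) (f p) ξ : E') = ξ := by
    rw [mfderiv_extChartAt_self]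
    rfl
  have he : ∀ᶠ y in 𝓝 (extChartAt I' (f p) (f p)), ∀ a b, coordForm I' g (f p) y a b = B y a b := by
    filter_upwards [hV] with y hy using hBg y hy
  simp only [secondFundamentalForm, hessianForm, chartMap_self]
  rw [hζ]
  exact congrArg₂ (· + ·) (hBg _ hz _ _) (christoffelFirst_eq_lowerChristoffel he hd _ _ _)

end Pullback

end HypersurfaceGeometry

/-! ### Smooth and product metrics in coordinates. -/

namespace HypersurfaceGeometry

set_option maxSynthPendingDepth 3

section Metric

variable {E : Type*} [NormedAddCommGroup E] [NormedSpace ℝ E]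
  {H : Type*} [TopologicalSpace H] {I : ModelWithCorners ℝ E H}
  {N : Type*} [TopologicalSpace N] [ChartedSpace H N]

section Smooth

variable [IsManifold I ∞ N]
  (g : Bundle.ContMDiffRiemannianMetric I ∞ E (fun x : N => TangentSpace I x))

/-- A Riemannian metric in the coordinates given by the preferred chart at `q`, as a field of
continuous bilinear forms. -/
noncomputable def coordBilin (q : N) (z : E) : E →L[ℝ] E →L[ℝ] ℝ :=
  let B : E →L[ℝ] E →L[ℝ] ℝ := g.inner ((extChartAt I q).symm z)
  let D : E →L[ℝ] E := mfderiv 𝓘(ℝ, E) I (extChartAt I q).symm z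
  B.bilinearComp D D

/-- The coordinate fields are smooth along the inverse chart, being images of constant fields under
its tangent map. The metric, a smooth section of a bundle of bilinear forms, is then evaluated on
them. -/
theorem contDiffOn_coordForm_metricForm [I.Boundaryless] (q : N) (a b : E) :
    ContDiffOn ℝ ∞ (fun z => coordForm I (metricForm I g) q z a b) (extChartAt I q).target := by
  have : IsManifold I 1 N := IsManifold.of_le (n := ∞) (by exact_mod_cast le_top)
  have : IsManifold I (∞ + 1) N := by simpa using ‹IsManifold I ∞ N›
  have hs := contMDiffOn_extChartAt_symm (I := I) (n := ∞) q
  have ho := isOpen_extChartAt_target (I := I) q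
  have hT := hs.contMDiffOn_tangentMapWithin (m := ∞) (by simp) ho.uniqueMDiffOn
  have hv : ∀ a : E, ContMDiffOn 𝓘(ℝ, E) I.tangent ∞
      (fun z => Bundle.TotalSpace.mk' E (E := fun x : N => TangentSpace I x)
        ((extChartAt I q).symm z) (mfderiv 𝓘(ℝ, E) I (extChartAt I q).symm z a))
      (extChartAt I q).target := by
    intro a
    have hc : ContMDiff 𝓘(ℝ, E) 𝓘(ℝ, E).tangent ∞
        (fun z => (⟨z, a⟩ : TangentBundle 𝓘(ℝ, E) E)) := by
      intro z
      rw [Bundle.contMDiffAt_totalSpace]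
      exact ⟨contMDiffAt_id, by simpa using contMDiffAt_const⟩
    refine (hT.comp hc.contMDiffOn fun z hz => hz).congr fun z hz => ?_
    simp only [Function.comp_apply, tangentMapWithin, mfderivWithin_of_isOpen ho hz]
  have h : ContMDiffOn 𝓘(ℝ, E) (I.prod 𝓘(ℝ, ℝ)) ∞
      (fun z => Bundle.TotalSpace.mk' ℝ (E := Bundle.Trivial N ℝ) ((extChartAt I q).symm z)
        (coordForm I (metricForm I g) q z a b)) (extChartAt I q).target :=
    ContMDiffOn.clm_bundle_apply₂ (F₁ := E) (F₂ := E) (g.contMDiff.comp_contMDiffOn hs) (hv a) (hv b)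
  rw [← contMDiffOn_iff_contDiffOn]
  intro z hz
  have h2 := h z hz
  simp only [Bundle.contMDiffWithinAt_totalSpace] at h2
  exact h2.2

theorem contDiffOn_coordBilin [FiniteDimensional ℝ E] [I.Boundaryless] (q : N) :
    ContDiffOn ℝ ∞ (coordBilin g q) (extChartAt I q).target := by
  rw [contDiffOn_clm_apply]
  intro a
  rw [contDiffOn_clm_apply]
  exact contDiffOn_coordForm_metricForm g q a

theorem metricForm_symm (q : N) (v w : TangentSpace I q) :
    metricForm I g q v w = metricForm I g q w v :=
  g.symm q v w

theorem metricForm_pos (q : N) (v : TangentSpace I q) (hv : v ≠ 0) : 0 < metricForm I g q v v :=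
  g.pos q v hv

end Smooth

theorem productForm_symm {g : FormField I N}
    (hg : ∀ q (v w : TangentSpace I q), g q v w = g q w v) (p : N × ℝ)
    (v w : TangentSpace (I.prod 𝓘(ℝ, ℝ)) p) : productForm I g p v w = productForm I g p w v := by
  simp only [productForm]
  rw [hg, mul_comm]

theorem productForm_apply (g : FormField I N) (p : N × ℝ) (v w : E × ℝ) :
    productForm I g p v w = g p.1 v.1 w.1 + v.2 * w.2 := by
  simp only [productForm, heightForm, mfderiv_fst, mfderiv_snd]
  rfl

theorem productForm_pos {g : FormField I N} (hg0 : ∀ q, g q 0 0 = 0)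
    (hg : ∀ q (v : TangentSpace I q), v ≠ 0 → 0 < g q v v) (p : N × ℝ)
    (v : TangentSpace (I.prod 𝓘(ℝ, ℝ)) p) (hv : v ≠ 0) : 0 < productForm I g p v v := by
  obtain ⟨v1, v2⟩ := v
  refine lt_of_lt_of_eq ?_ (productForm_apply g p (v1, v2) (v1, v2)).symm
  by_cases h1 : v1 = 0
  · subst h1
    have h2 : v2 ≠ 0 := fun h2 => hv (by rw [h2]; rfl)
    have := mul_self_pos.2 h2
    have h0 := hg0 p.1
    change 0 < g p.1 0 0 + v2 * v2
    rw [h0, zero_add]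
    exact this
  · exact add_pos_of_pos_of_nonneg (hg p.1 v1 h1) (mul_self_nonneg v2)

theorem sliceVector_eq (p : N × ℝ) (η : TangentSpace I p.1) :
    (sliceVector I p η : E × ℝ) = (η, 0) := by
  have h : mfderiv I (I.prod 𝓘(ℝ, ℝ)) (fun x : N => (x, p.2)) p.1
      = ContinuousLinearMap.inl ℝ (TangentSpace I p.1) (TangentSpace 𝓘(ℝ, ℝ) p.2) :=
    mfderiv_prod_left
  simp only [sliceVector, h]
  rfl

theorem extChartAt_target_prod (p : N × ℝ) :
    (extChartAt (I.prod 𝓘(ℝ, ℝ)) p).target = (extChartAt I p.1).target ×ˢ Set.univ := by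
  rw [extChartAt_prod, PartialEquiv.prod_target, extChartAt_model_space_eq_id]
  rfl

/-- Each summand is the pull-back of a form under a projection, and the projections intertwine the
product chart with the charts of the factors. -/
theorem coordForm_productForm [IsManifold I 1 N] [I.Boundaryless] (g : FormField I N) (p : N × ℝ)
    {z : E × ℝ} (hz : z.1 ∈ (extChartAt I p.1).target) (a b : E × ℝ) :
    coordForm (I.prod 𝓘(ℝ, ℝ)) (productForm I g) p z a b
      = coordForm I g p.1 z.1 a.1 b.1 + a.2 * b.2 := by
  have he : ∀ z : E × ℝ, (extChartAt (I.prod 𝓘(ℝ, ℝ)) p).symm z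
      = ((extChartAt I p.1).symm z.1, z.2) := by
    intro z
    rw [extChartAt_prod]
    rfl
  have hzP : z ∈ (extChartAt (I.prod 𝓘(ℝ, ℝ)) p).target := by
    rw [extChartAt_target_prod]
    exact ⟨hz, Set.mem_univ _⟩
  have hP := mdifferentiableAt_extChartAt_symm p hzP
  have h1 : coordForm I g p.1 z.1 a.1 b.1
      = pullbackForm 𝓘(ℝ, E × ℝ) (I.prod 𝓘(ℝ, ℝ)) (pullbackForm (I.prod 𝓘(ℝ, ℝ)) I g Prod.fst)
        (extChartAt (I.prod 𝓘(ℝ, ℝ)) p).symm z a b := by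
    have hfst : MDifferentiableAt 𝓘(ℝ, E × ℝ) 𝓘(ℝ, E) Prod.fst z :=
      differentiableAt_fst.mdifferentiableAt
    have h := pullbackForm_pullbackForm g (mdifferentiableAt_extChartAt_symm p.1 hz) hfst a b
    have h' : coordForm I g p.1 z.1 a.1 b.1 = pullbackForm 𝓘(ℝ, E × ℝ) 𝓘(ℝ, E)
        (pullbackForm 𝓘(ℝ, E) I g (extChartAt I p.1).symm) Prod.fst z a b := by
      simp only [pullbackForm, mfderiv_eq_fderiv, fderiv_fst]
      rfl
    rw [h']
    refine h.trans (Eq.trans ?_ (pullbackForm_pullbackForm g mdifferentiableAt_fst hP a b).symm)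
    refine pullbackForm_congr g (Filter.Eventually.of_forall fun y => ?_) a b
    simp only [Function.comp_apply, he]
  have h2 : a.2 * b.2
      = pullbackForm 𝓘(ℝ, E × ℝ) (I.prod 𝓘(ℝ, ℝ)) (pullbackForm (I.prod 𝓘(ℝ, ℝ)) 𝓘(ℝ, ℝ)
          (fun (_ : ℝ) (v w : ℝ) => v * w) Prod.snd)
        (extChartAt (I.prod 𝓘(ℝ, ℝ)) p).symm z a b := by
    have h' : a.2 * b.2 = pullbackForm 𝓘(ℝ, E × ℝ) 𝓘(ℝ, ℝ)
        (fun (_ : ℝ) (v w : ℝ) => v * w) Prod.snd z a b := by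
      simp only [pullbackForm, mfderiv_eq_fderiv, fderiv_snd]
      rfl
    rw [h']
    refine Eq.trans ?_ (pullbackForm_pullbackForm _ mdifferentiableAt_snd hP a b).symm
    refine pullbackForm_congr _ (Filter.Eventually.of_forall fun y => ?_) a b
    simp only [Function.comp_apply, he]
  rw [h1, h2]
  rfl

end Metric

end HypersurfaceGeometry

/-! ### Second derivatives along a level set. -/

theorem fderiv_fderiv_comp {E₁ E₂ E₃ : Type*} [NormedAddCommGroup E₁] [NormedSpace ℝ E₁]
    [NormedAddCommGroup E₂] [NormedSpace ℝ E₂] [NormedAddCommGroup E₃] [NormedSpace ℝ E₃]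
    {φ : E₁ → E₂} {x : E₂ → E₃} {s : E₁} (hφ : ContDiffAt ℝ 2 φ s) (hx : ContDiffAt ℝ 2 x (φ s))
    (v w : E₁) :
    fderiv ℝ (fderiv ℝ (x ∘ φ)) s v w
      = fderiv ℝ (fderiv ℝ x) (φ s) (fderiv ℝ φ s v) (fderiv ℝ φ s w)
        + fderiv ℝ x (φ s) (fderiv ℝ (fderiv ℝ φ) s v w) := by
  have hφ1 : ∀ᶠ y in 𝓝 s, DifferentiableAt ℝ φ y :=
    (hφ.eventually (by norm_num)).mono fun y hy => hy.differentiableAt (by norm_num)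
  have hx1 : ∀ᶠ y in 𝓝 s, DifferentiableAt ℝ x (φ y) :=
    hφ.continuousAt.eventually
      ((hx.eventually (by norm_num)).mono fun y hy => hy.differentiableAt (by norm_num))
  have he : fderiv ℝ (x ∘ φ) =ᶠ[𝓝 s] fun y => (fderiv ℝ x (φ y)).comp (fderiv ℝ φ y) := by
    filter_upwards [hφ1, hx1] with y h1 h2 using fderiv_comp y h2 h1
  have hdx : HasFDerivAt (fderiv ℝ x) (fderiv ℝ (fderiv ℝ x) (φ s)) (φ s) :=
    ((hx.fderiv_right (m := 1) (by norm_num)).differentiableAt (by norm_num)).hasFDerivAt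
  have hdφ : HasFDerivAt (fderiv ℝ φ) (fderiv ℝ (fderiv ℝ φ) s) s :=
    ((hφ.fderiv_right (m := 1) (by norm_num)).differentiableAt (by norm_num)).hasFDerivAt
  have h := (hdx.comp s (hφ.differentiableAt (by norm_num)).hasFDerivAt).clm_comp hdφ
  rw [he.fderiv_eq]
  have h' := congrArg (fun L => L v w) h.fderiv
  simp only [Function.comp_apply] at h'
  rw [h']
  simp [add_comm]

namespace HypersurfaceGeometry

set_option maxSynthPendingDepth 3

section Slice

variable {E₁ E₂ F : Type*} [NormedAddCommGroup E₁] [NormedSpace ℝ E₁]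
  [NormedAddCommGroup E₂] [NormedSpace ℝ E₂] [NormedAddCommGroup F] [NormedSpace ℝ F]
  {φ : E₁ → E₂} {x : E₂ → F × ℝ} {y : E₁ → F} {ε : ℝ} {s : E₁}

theorem fderiv_slice (hφ : DifferentiableAt ℝ φ s) (hx : DifferentiableAt ℝ x (φ s))
    (hy : x ∘ φ =ᶠ[𝓝 s] fun s => (y s, ε)) (v : E₁) :
    fderiv ℝ x (φ s) (fderiv ℝ φ s v) = (fderiv ℝ y s v, 0) := by
  have h := (hx.hasFDerivAt.comp s hφ.hasFDerivAt)
  have h1 : HasFDerivAt y _ s :=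
    (hasFDerivAt_fst.comp s h).congr_of_eventuallyEq (hy.mono fun z hz => by
      have := congrArg Prod.fst hz
      exact this.symm)
  have h2 : HasFDerivAt (fun _ : E₁ => ε) _ s :=
    (hasFDerivAt_snd.comp s h).congr_of_eventuallyEq (hy.mono fun z hz => by
      have := congrArg Prod.snd hz
      exact this.symm)
  rw [h1.fderiv]
  have h3 := congrArg (fun L => L v) (h2.unique (hasFDerivAt_const ε s))
  exact Prod.ext rfl h3

/-- The second-order chain rule for `x ∘ φ = (y, ε)`. The term with `D²φ` lies in the image of `dx`,
so it disappears on pairing with a normal of the hypersurface. -/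
theorem fderiv_fderiv_slice (hφ : ContDiffAt ℝ 2 φ s) (hx : ContDiffAt ℝ 2 x (φ s))
    (hy : x ∘ φ =ᶠ[𝓝 s] fun s => (y s, ε)) (v w : E₁) :
    fderiv ℝ (fderiv ℝ x) (φ s) (fderiv ℝ φ s v) (fderiv ℝ φ s w)
        + fderiv ℝ x (φ s) (fderiv ℝ (fderiv ℝ φ) s v w)
      = (fderiv ℝ (fderiv ℝ y) s v w, 0) := by
  rw [← fderiv_fderiv_comp hφ hx]
  have h := hx.comp s hφ
  have h1 : Prod.fst ∘ (x ∘ φ) =ᶠ[𝓝 s] y := hy.mono fun z hz => congrArg Prod.fst hz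
  have h2 : Prod.snd ∘ (x ∘ φ) =ᶠ[𝓝 s] fun _ => ε := hy.mono fun z hz => congrArg Prod.snd hz
  have e1 := fderiv_fderiv_comp h (contDiffAt_fst (n := 2)) v w
  have e2 := fderiv_fderiv_comp h (contDiffAt_snd (n := 2)) v w
  have h1' : fderiv ℝ (Prod.fst ∘ (x ∘ φ)) =ᶠ[𝓝 s] fderiv ℝ y := h1.fderiv
  have h2' : fderiv ℝ (Prod.snd ∘ (x ∘ φ)) =ᶠ[𝓝 s] fderiv ℝ fun _ => ε := h2.fderiv
  have f1 : fderiv ℝ (Prod.fst : F × ℝ → F) = fun _ => ContinuousLinearMap.fst ℝ F ℝ :=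
    funext fun _ => fderiv_fst
  have f2 : fderiv ℝ (Prod.snd : F × ℝ → ℝ) = fun _ => ContinuousLinearMap.snd ℝ F ℝ :=
    funext fun _ => fderiv_snd
  rw [h1'.fderiv_eq] at e1
  rw [h2'.fderiv_eq] at e2
  rw [f1] at e1
  rw [f2] at e2
  refine Prod.ext ?_ ?_
  · simpa using e1.symm
  · simpa using e2.symm

/-- Slices are totally geodesic: along the level set the second covariant derivative is horizontal
up to vectors tangent to the hypersurface, so it sees only the component `c η` of `ν`. This is the
block `c A_Σ` of the bordered matrix. -/
theorem hessianForm_productBilin [FiniteDimensional ℝ F] {V : Set F} (hV : IsOpen V)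
    {B : F → F →L[ℝ] F →L[ℝ] ℝ} (hB : ContDiffOn ℝ 2 B V)
    (hφ : ContDiffAt ℝ 2 φ s) (hx : ContDiffAt ℝ 2 x (φ s))
    (hy : x ∘ φ =ᶠ[𝓝 s] fun s => (y s, ε)) (hxV : (x (φ s)).1 ∈ V) {ν : F × ℝ} {η : F} {c : ℝ}
    (hν : ν.1 = c • η) (hνx : ∀ v, productBilin B (x (φ s)) (fderiv ℝ x (φ s) v) ν = 0) (v w : E₁) :
    hessianForm (productBilin B) x (φ s) (fderiv ℝ φ s v) (fderiv ℝ φ s w) ν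
      = c * hessianForm B y s v w η := by
  have h := fderiv_fderiv_slice hφ hx hy v w
  have hys : (x (φ s)).1 = y s := congrArg Prod.fst hy.eq_of_nhds
  have h1 := congrArg (fun u => productBilin B (x (φ s)) u ν) h
  simp only [map_add, add_apply, hνx, add_zero] at h1
  rw [hessianForm, hessianForm, h1, lowerChristoffel_productBilin hV hB hxV,
    fderiv_slice (hφ.differentiableAt (by norm_num)) (hx.differentiableAt (by norm_num)) hy,
    fderiv_slice (hφ.differentiableAt (by norm_num)) (hx.differentiableAt (by norm_num)) hy]
  simp only [productBilin_apply, hν, hys, map_smul, smul_eq_mul,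
    (isLinearMap_lowerChristoffel_right (B := B) (y := y s) _ _).map_smul]
  ring

end Slice

/-! ### Uniqueness of the distributional scalar curvature. -/

section ScalarCurvature

variable {n : ℕ} {M : Type*} [TopologicalSpace M] [ChartedSpace (EuclideanSpace ℝ (Fin n)) M]

/-- The fundamental lemma of the calculus of variations gives equality almost everywhere on the
common neighbourhood, and continuity gives it at the point. Both functions live in the same chart,
so no coordinate invariance is needed. -/
theorem HasScalarCurvatureAt.unique {g : FormField (𝓡 n) M} {p : M} {r₁ r₂ : ℝ}
    (h₁ : HasScalarCurvatureAt g p r₁) (h₂ : HasScalarCurvatureAt g p r₂) : r₁ = r₂ := by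
  obtain ⟨U₁, hU₁, hp₁, -, ρ₁, hc₁, rfl, hd₁⟩ := h₁
  obtain ⟨U₂, hU₂, hp₂, -, ρ₂, hc₂, rfl, hd₂⟩ := h₂
  have hU := hU₁.inter hU₂
  have hc₁' := hc₁.mono (Set.inter_subset_left (t := U₂))
  have hc₂' := hc₂.mono (Set.inter_subset_right (s := U₁))
  have hae := hU.ae_eq_zero_of_integral_contDiff_smul_eq_zero (μ := volume)
    ((hc₁'.sub hc₂').locallyIntegrableOn hU.measurableSet) (fun φ hφ hφc hφs => by
      have e₁ := hd₁ φ hφ hφc (hφs.trans Set.inter_subset_left)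
      have e₂ := hd₂ φ hφ hφc (hφs.trans Set.inter_subset_right)
      have i₁ := integrable_mul_of_tsupport_subset (μ := volume) hU hφ.continuous hφc hφs hc₁'
      have i₂ := integrable_mul_of_tsupport_subset (μ := volume) hU hφ.continuous hφc hφs hc₂'
      simp only [smul_eq_mul, Pi.sub_apply, mul_sub]
      rw [integral_sub i₁ i₂, sub_eq_zero]
      simp only [mul_comm (φ _)]
      rw [e₁, e₂])
  have heq : ρ₁ =ᵐ[volume.restrict (U₁ ∩ U₂)] ρ₂ := by
    refine (ae_restrict_iff' hU.measurableSet).2 (hae.mono fun z hz hzU => ?_)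
    exact sub_eq_zero.1 (hz hzU)
  exact Measure.eqOn_open_of_ae_eq heq hU hc₁' hc₂' ⟨hp₁, hp₂⟩

theorem det_ne_zero_of_pos {b : EuclideanSpace ℝ (Fin n) →L[ℝ] EuclideanSpace ℝ (Fin n) →L[ℝ] ℝ}
    (hsymm : ∀ v w, b v w = b w v) (hpos : ∀ v, v ≠ 0 → 0 < b v v) :
    (Matrix.of fun i j : Fin n => b (EuclideanSpace.single i 1) (EuclideanSpace.single j 1)).det
      ≠ 0 := by
  obtain ⟨f, hf⟩ := exists_isOrthonormalFrame (m := n) (by simp) (LinearMap.mk₂ ℝ (fun v w => b v w)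
    (by simp) (by simp) (by simp) (by simp)) hsymm hpos
  exact hf.det_gramMatrix_ne_zero (fun w => ⟨by simp, by simp⟩) (fun w => ⟨by simp, by simp⟩)

end ScalarCurvature

end HypersurfaceGeometry

/-! ### The shape operator in an orthonormal frame. -/

section ShapeMatrix

variable {n : ℕ} {b : EuclideanSpace ℝ (Fin n) → EuclideanSpace ℝ (Fin n) → ℝ}
  {f : Fin n → EuclideanSpace ℝ (Fin n)}

/-- The matrix of the shape operator in an orthonormal frame is the matrix of the second
fundamental form. -/
theorem IsOrthonormalFrame.exists_conj (hl : ∀ w, IsLinearMap ℝ fun v => b v w)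
    (hr : ∀ v, IsLinearMap ℝ (b v)) (hf : IsOrthonormalFrame b f)
    {h : EuclideanSpace ℝ (Fin n) → EuclideanSpace ℝ (Fin n) → ℝ}
    (hhl : ∀ w, IsLinearMap ℝ fun v => h v w) (hhr : ∀ v, IsLinearMap ℝ (h v)) :
    ∃ P Q : Matrix (Fin n) (Fin n) ℝ, P * Q = 1 ∧ Q * P = 1 ∧
      (gramMatrix b)⁻¹ * gramMatrix h * P = P * Matrix.of fun a c => h (f a) (f c) := by
  have h1 := hf.transpose_mul_gramMatrix_mul hl hr
  refine ⟨frameMatrix f, (frameMatrix f).transpose * gramMatrix b, mul_eq_one_comm.1 h1, h1, ?_⟩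
  rw [hf.inv_gramMatrix hl hr, ← transpose_frameMatrix_mul_gramMatrix_mul hhl hhr]
  simp only [Matrix.mul_assoc]

end ShapeMatrix

theorem trace_eq_of_conj {n : ℕ} {A D P Q : Matrix (Fin n) (Fin n) ℝ} (hPQ : P * Q = 1)
    (hQP : Q * P = 1) (h : A * P = P * D) : A.trace = D.trace := by
  rw [← mul_one A, ← hPQ, ← Matrix.mul_assoc, h, Matrix.mul_assoc, Matrix.trace_mul_comm,
    Matrix.mul_assoc, hQP, mul_one]

theorem eq_smul_one_iff_of_conj {n : ℕ} {A D P Q : Matrix (Fin n) (Fin n) ℝ} (hPQ : P * Q = 1)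
    (hQP : Q * P = 1) (h : A * P = P * D) (κ : ℝ) :
    A = κ • (1 : Matrix (Fin n) (Fin n) ℝ) ↔ D = κ • (1 : Matrix (Fin n) (Fin n) ℝ) := by
  constructor
  · rintro rfl
    have h1 := congrArg (Q * ·) h
    simp only [← Matrix.mul_assoc, hQP, one_mul] at h1
    rw [← h1]
    simp [hQP]
  · rintro rfl
    have h1 := congrArg (· * Q) h
    simp only [Matrix.mul_assoc, hPQ, mul_one] at h1
    rw [h1]
    simp [hPQ]

/-! ### The inequality at a point, in coordinates. -/

namespace HypersurfaceGeometry

set_option maxSynthPendingDepth 3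

section Hessian

variable {E E' : Type*} [NormedAddCommGroup E] [NormedSpace ℝ E] [NormedAddCommGroup E']
  [NormedSpace ℝ E'] {B : E' → E' →L[ℝ] E' →L[ℝ] ℝ} {x : E → E'} {z : E} {ξ : E'}

theorem isLinearMap_hessianForm_left (b : E) :
    IsLinearMap ℝ fun a => hessianForm B x z a b ξ := by
  constructor <;> intros <;> simp [hessianForm, lowerChristoffel] <;> ring

theorem isLinearMap_hessianForm_right (a : E) :
    IsLinearMap ℝ fun b => hessianForm B x z a b ξ := by
  constructor <;> intros <;> simp [hessianForm, lowerChristoffel] <;> ring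

end Hessian

/-- Here `x` parametrises the hypersurface, `y` its level set inside the factor, and `φ` the
inclusion of the level set. Adapted frame and Gauss equation reduce the claim to the algebra of
bordered matrices. -/
theorem gauss_inequality_in_coordinates {m : ℕ} (hm : m ≠ 0)
    {B : EuclideanSpace ℝ (Fin (m + 1)) → EuclideanSpace ℝ (Fin (m + 1)) →L[ℝ]
      EuclideanSpace ℝ (Fin (m + 1)) →L[ℝ] ℝ} {V : Set (EuclideanSpace ℝ (Fin (m + 1)))}
    {GN : EuclideanSpace ℝ (Fin (m + 1)) → EuclideanSpace ℝ (Fin (m + 1)) →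
      EuclideanSpace ℝ (Fin (m + 1)) → ℝ} (hGN : ∀ z ∈ V, ∀ a b, GN z a b = B z a b)
    {x : EuclideanSpace ℝ (Fin (m + 1)) → EuclideanSpace ℝ (Fin (m + 1)) × ℝ}
    {U : Set (EuclideanSpace ℝ (Fin (m + 1)))}
    {G : EuclideanSpace ℝ (Fin (m + 1)) → EuclideanSpace ℝ (Fin (m + 1)) →
      EuclideanSpace ℝ (Fin (m + 1)) → ℝ}
    (hx : IsPullbackOn (productBilin B) (V ×ˢ Set.univ) x U G)
    {y : EuclideanSpace ℝ (Fin m) → EuclideanSpace ℝ (Fin (m + 1))}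
    {W : Set (EuclideanSpace ℝ (Fin m))}
    {GS : EuclideanSpace ℝ (Fin m) → EuclideanSpace ℝ (Fin m) → EuclideanSpace ℝ (Fin m) → ℝ}
    (hy : IsPullbackOn B V y W GS)
    {φ : EuclideanSpace ℝ (Fin m) → EuclideanSpace ℝ (Fin (m + 1))} {s : EuclideanSpace ℝ (Fin m)}
    (hs : s ∈ W) (hφs : φ s ∈ U) (hφ : ContDiffAt ℝ 2 φ s) {ε : ℝ}
    (hxy : x ∘ φ =ᶠ[𝓝 s] fun s => (y s, ε)) (hpos : ∀ v, v ≠ 0 → 0 < B (y s) v v)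
    (hX : Function.Injective (fderiv ℝ x (φ s))) (hJ : Function.Injective (fderiv ℝ φ s))
    (hX2 : ∃ v, (fderiv ℝ x (φ s) v).2 ≠ 0)
    {ν : EuclideanSpace ℝ (Fin (m + 1)) × ℝ} (hν : B (y s) ν.1 ν.1 + ν.2 * ν.2 = 1)
    (hνX : ∀ v, B (y s) ν.1 (fderiv ℝ x (φ s) v).1 + ν.2 * (fderiv ℝ x (φ s) v).2 = 0)
    {η : EuclideanSpace ℝ (Fin (m + 1))} (hη : B (y s) η η = 1)
    (hηy : ∀ v, B (y s) η (fderiv ℝ y s v) = 0)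
    {A : Matrix (Fin (m + 1)) (Fin (m + 1)) ℝ} (hA : A = (gramMatrix (G (φ s)))⁻¹
      * gramMatrix fun u v => hessianForm (productBilin B) x (φ s) u v ν)
    {AS : Matrix (Fin m) (Fin m) ℝ} (hAS : AS = (gramMatrix (GS s))⁻¹
      * gramMatrix fun u v => hessianForm B y s u v η)
    {c : ℝ} (hc : c = B (y s) ν.1 η) :
    c * A.trace * AS.trace ≥ 1 / 2 * weakScalarCurvature (productBilin B) x G (φ s)
          - 1 / 2 * ∑ j, ∑ k, inverseMetric GN j k (y s) * ricciCoord GN j k (y s)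
          + c ^ 2 * ∑ j, ∑ k, ricciCoord GN j k (y s) * η j * η k
          + ((m : ℝ) + 1) / (2 * m) * c ^ 2 * AS.trace ^ 2 ∧
      (c * A.trace * AS.trace = 1 / 2 * weakScalarCurvature (productBilin B) x G (φ s)
          - 1 / 2 * ∑ j, ∑ k, inverseMetric GN j k (y s) * ricciCoord GN j k (y s)
          + c ^ 2 * ∑ j, ∑ k, ricciCoord GN j k (y s) * η j * η k
          + ((m : ℝ) + 1) / (2 * m) * c ^ 2 * AS.trace ^ 2 ↔
        ∃ κ : ℝ, AS = κ • (1 : Matrix (Fin m) (Fin m) ℝ) ∧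
          m ≤ Module.finrank ℝ (Module.End.eigenspace (Matrix.toLin' A) (c * κ))) := by
  have hxd : ContDiffAt ℝ 2 x (φ s) :=
    hx.contDiffOn_map.contDiffAt (hx.isOpen_source.mem_nhds hφs)
  have hyV := hy.mapsTo hs
  have hxs : x (φ s) = (y s, ε) := hxy.eq_of_nhds
  have hXJ : ∀ v, fderiv ℝ x (φ s) (fderiv ℝ φ s v) = (fderiv ℝ y s v, 0) :=
    fderiv_slice (hφ.differentiableAt (by norm_num)) (hxd.differentiableAt (by norm_num)) hxy
  obtain ⟨h1, h2, h3, f, e, hf, hfη, hXe, hfe, hcomp⟩ := exists_adapted_frame (by simp)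
    (LinearMap.mk₂ ℝ (fun v w => B (y s) v w) (by simp) (by simp) (by simp) (by simp))
    (hy.symm _ hyV) hpos (X := (fderiv ℝ x (φ s)).toLinearMap) hX
    (J := (fderiv ℝ φ s).toLinearMap) hJ (fun v => congrArg Prod.snd (hXJ v)) hX2 hν hνX hη
    (fun v => (congrArg (fun u => B (y s) η u.1) (hXJ v)).trans (hηy v))
  simp only [LinearMap.mk₂_apply, ContinuousLinearMap.coe_coe, ← hc] at h1 h2 h3 hf hfη hXe hfe hcomp
  set w : Fin (m + 1) → EuclideanSpace ℝ (Fin (m + 1)) := Fin.cons e fun i => fderiv ℝ φ s (f i)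
    with hw
  have hG : G (φ s) = fun v u => B (y s) (fderiv ℝ x (φ s) v).1 (fderiv ℝ x (φ s) u).1
      + (fderiv ℝ x (φ s) v).2 * (fderiv ℝ x (φ s) u).2 := by
    funext v u
    rw [hx.eq_pullback _ hφs, productBilin_apply, hxs]
  have hGS : GS s = fun v u => B (y s) (fderiv ℝ x (φ s) (fderiv ℝ φ s v)).1
      (fderiv ℝ x (φ s) (fderiv ℝ φ s u)).1 := by
    funext v u
    rw [hy.eq_pullback _ hs, hXJ, hXJ]
  replace hfe : IsOrthonormalFrame (G (φ s)) w := by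
    rw [hG]
    exact hfe
  replace hf : IsOrthonormalFrame (GS s) f := by
    rw [hGS]
    exact hf
  have hGl : ∀ u, IsLinearMap ℝ fun v => G (φ s) v u := fun u => by
    rw [hG]
    constructor <;> intros <;> simp <;> ring
  have hGr : ∀ v, IsLinearMap ℝ (G (φ s) v) := fun v => by
    rw [hG]
    constructor <;> intros <;> simp <;> ring
  have hGSl : ∀ u, IsLinearMap ℝ fun v => GS s v u := fun u => by
    rw [hGS]
    constructor <;> intros <;> simp
  have hGSr : ∀ v, IsLinearMap ℝ (GS s v) := fun v => by
    rw [hGS]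
    constructor <;> intros <;> simp
  obtain ⟨P, Q, hPQ, hQP, hP⟩ := hfe.exists_conj hGl hGr
    (h := fun u v => hessianForm (productBilin B) x (φ s) u v ν)
    isLinearMap_hessianForm_left isLinearMap_hessianForm_right
  obtain ⟨P', Q', hPQ', hQP', hP'⟩ := hf.exists_conj hGSl hGSr
    (h := fun u v => hessianForm B y s u v η)
    isLinearMap_hessianForm_left isLinearMap_hessianForm_right
  rw [← hA] at hP
  rw [← hAS] at hP'
  set D : Matrix (Fin (m + 1)) (Fin (m + 1)) ℝ :=
    Matrix.of fun a c => hessianForm (productBilin B) x (φ s) (w a) (w c) ν with hD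
  set DS : Matrix (Fin m) (Fin m) ℝ := Matrix.of fun a c => hessianForm B y s (f a) (f c) η
    with hDS
  set β : Fin m → ℝ := fun i => hessianForm (productBilin B) x (φ s) e (fderiv ℝ φ s (f i)) ν
  -- Only the block `c DS` carries geometric information; corner and border are merely named.
  have hDb : D = borderedMatrix (hessianForm (productBilin B) x (φ s) e e ν) β c DS := by
    ext a b
    refine Fin.cases ?_ (fun a => ?_) a <;> refine Fin.cases ?_ (fun b => ?_) b
    · simp [hD, hw]
    · simp [hD, hw, β]
    · simp [hD, hw, β, hx.hessianForm_symm hφs _ e]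
    · simp only [hD, hw, Matrix.of_apply, Fin.cons_succ, borderedMatrix_succ_succ, hDS]
      refine hessianForm_productBilin hy.isOpen_target hy.contDiffOn_form hφ hxd hxy
        (by rw [hxs]; exact hyV) h1 (fun v => ?_) _ _
      have h := hνX v
      rw [hy.symm _ hyV] at h
      rw [productBilin_apply, hxs]
      linarith
  -- The contracted Gauss equation `R(g^M) = R(g) - 2c² Ric(η, η) + H² - |A|²`.
  have hR : weakScalarCurvature (productBilin B) x G (φ s)
      = ∑ j, ∑ k, inverseMetric GN j k (y s) * ricciCoord GN j k (y s)
        - 2 * c ^ 2 * ∑ j, ∑ k, ricciCoord GN j k (y s) * η j * η k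
        + ∑ b, ∑ a, (D b b * D a a - D a b * D a b) := by
    have hXe' : (fderiv ℝ x (φ s) (w 0)).1 = -ν.2 • η := congrArg Prod.fst hXe
    have hXs : ∀ i : Fin m, (fderiv ℝ x (φ s) (w i.succ)).1
        = (fderiv ℝ x (φ s) (fderiv ℝ φ s (f i))).1 := fun i => rfl
    rw [hx.weakScalarCurvature_eq hφs hfe (ν := ν) fun v => by
      simpa only [productBilin_apply, hxs] using hcomp v]
    have hsum := sum_frameCurvature_eq (hy.contDiffAt_form hs)
      (w := (Fin.cons η fun i => (fderiv ℝ x (φ s) (fderiv ℝ φ s (f i))).1 :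
        Fin (m + 1) → EuclideanSpace ℝ (Fin (m + 1)))) h2
      (v := fun a => (fderiv ℝ x (φ s) (w a)).1) hXe' hXs
    have hfη' : IsOrthonormalFrame (GN (y s)) (Fin.cons η fun i =>
        (fderiv ℝ x (φ s) (fderiv ℝ φ s (f i))).1 :
          Fin (m + 1) → EuclideanSpace ℝ (Fin (m + 1))) := fun i j => by
      rw [hGN _ hyV]
      exact hfη i j
    rw [sum_ricciCoord_mul hy.isOpen_target hy.contDiffOn_form hy.symm hGN hyV hfη',
      sum_inverseMetric_mul_ricciCoord hy.isOpen_target hy.contDiffOn_form hy.symm hGN hyV hfη',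
      ← hsum, ← Finset.sum_add_distrib]
    refine Finset.sum_congr rfl fun b _ => ?_
    rw [← Finset.sum_add_distrib]
    refine Finset.sum_congr rfl fun a _ => ?_
    rw [frameCurvature_productBilin hy.isOpen_target hy.contDiffOn_form
      (by rw [hxs]; exact hyV) h2 h1 hXe' hXs, hxs]
    simp only [hD, Matrix.of_apply]
    ring
  have htr := trace_eq_of_conj hPQ hQP hP
  have htr' := trace_eq_of_conj hPQ' hQP' hP'
  have hle := trace_mul_trace_sub_nonneg (hessianForm (productBilin B) x (φ s) e e ν) β c DS hm
  have hiff := trace_mul_trace_sub_eq_zero_iff (hessianForm (productBilin B) x (φ s) e e ν) β c DS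
    hm h3
  rw [← hDb] at hle hiff
  rw [htr, htr', hR]
  refine ⟨by linarith, ?_⟩
  rw [← sub_eq_zero]
  refine Iff.trans ?_ (hiff.trans (exists_congr fun κ => ?_))
  · rw [← sub_eq_zero, sub_zero]
    ring_nf
  · rw [eq_smul_one_iff_of_conj hPQ' hQP' hP']
    refine and_congr_right fun hκ => ?_
    rw [finrank_eigenspace_toLin'_eq_of_conj hPQ hQP hP, hDb]
    exact (le_finrank_eigenspace_borderedMatrix_iff _ β c DS κ hκ).symm

end HypersurfaceGeometry

/-! ### From coordinates to the manifold. -/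

namespace HypersurfaceGeometry

set_option maxSynthPendingDepth 3

section Hypersurface

variable {m : ℕ} {N : Type*} [TopologicalSpace N] [ChartedSpace (EuclideanSpace ℝ (Fin (m + 1))) N]
  [IsManifold (𝓡 (m + 1)) ∞ N]
  {g : Bundle.ContMDiffRiemannianMetric (𝓡 (m + 1)) ∞ (EuclideanSpace ℝ (Fin (m + 1)))
    (fun x : N => TangentSpace (𝓡 (m + 1)) x)}
  {M : Type*} [TopologicalSpace M] [ChartedSpace (EuclideanSpace ℝ (Fin (m + 1))) M]
  [IsManifold (𝓡 (m + 1)) 2 M] {F : M → N × ℝ}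

theorem contDiffOn_productBilin_coordBilin (P : N × ℝ) :
    ContDiffOn ℝ 2 (productBilin (coordBilin g P.1))
      (extChartAt ((𝓡 (m + 1)).prod 𝓘(ℝ, ℝ)) P).target := by
  rw [extChartAt_target_prod]
  exact contDiffOn_productBilin ((contDiffOn_coordBilin g P.1).of_le
    ENat.LEInfty.out)

theorem coordForm_productForm_metricForm (P : N × ℝ) :
    ∀ z ∈ (extChartAt ((𝓡 (m + 1)).prod 𝓘(ℝ, ℝ)) P).target, ∀ a b,
      coordForm ((𝓡 (m + 1)).prod 𝓘(ℝ, ℝ)) (productForm (𝓡 (m + 1)) (metricForm (𝓡 (m + 1)) g)) P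
        z a b = productBilin (coordBilin g P.1) z a b := by
  intro z hz a b
  have : IsManifold (𝓡 (m + 1)) 1 N := IsManifold.of_le (n := ∞) (by exact_mod_cast le_top)
  rw [extChartAt_target_prod] at hz
  rw [coordForm_productForm _ _ hz.1, productBilin_apply]
  rfl

theorem isPullbackOn_hypersurface
    (hF : ContMDiff (𝓡 (m + 1)) ((𝓡 (m + 1)).prod 𝓘(ℝ, ℝ)) 2 F) (p : M) :
    IsPullbackOn (productBilin (coordBilin g (F p).1))
      ((extChartAt (𝓡 (m + 1)) (F p).1).target ×ˢ Set.univ)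
      (chartMap (𝓡 (m + 1)) ((𝓡 (m + 1)).prod 𝓘(ℝ, ℝ)) F p)
      (chartDomain (𝓡 (m + 1)) ((𝓡 (m + 1)).prod 𝓘(ℝ, ℝ)) F p)
      (coordForm (𝓡 (m + 1)) (pullbackForm (𝓡 (m + 1)) ((𝓡 (m + 1)).prod 𝓘(ℝ, ℝ))
        (productForm (𝓡 (m + 1)) (metricForm (𝓡 (m + 1)) g)) F) p) := by
  have : IsManifold (𝓡 (m + 1)) 2 N := IsManifold.of_le (n := ∞)
    ENat.LEInfty.out
  have h := isPullbackOn_chartMap hF p (contDiffOn_productBilin_coordBilin (g := g) (F p))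
    (coordForm_productForm_metricForm (F p)) (productForm_symm (metricForm_symm g))
  rwa [extChartAt_target_prod] at h

theorem productForm_metricForm_pos (P : N × ℝ)
    (v : TangentSpace ((𝓡 (m + 1)).prod 𝓘(ℝ, ℝ)) P) (hv : v ≠ 0) :
    0 < productForm (𝓡 (m + 1)) (metricForm (𝓡 (m + 1)) g) P v v :=
  productForm_pos (fun q => by simp [metricForm]) (metricForm_pos g) P v hv

/-- The existence half, on the whole of `chartDomain`: there the induced metric is positive definite
because the differential of `F` is injective. -/
theorem hasScalarCurvatureAt_hypersurface
    (hF : IsC2Immersion (𝓡 (m + 1)) ((𝓡 (m + 1)).prod 𝓘(ℝ, ℝ)) F) (p : M) :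
    HasScalarCurvatureAt (pullbackForm (𝓡 (m + 1)) ((𝓡 (m + 1)).prod 𝓘(ℝ, ℝ))
      (productForm (𝓡 (m + 1)) (metricForm (𝓡 (m + 1)) g)) F) p
      (weakScalarCurvature (productBilin (coordBilin g (F p).1))
        (chartMap (𝓡 (m + 1)) ((𝓡 (m + 1)).prod 𝓘(ℝ, ℝ)) F p)
        (coordForm (𝓡 (m + 1)) (pullbackForm (𝓡 (m + 1)) ((𝓡 (m + 1)).prod 𝓘(ℝ, ℝ))
          (productForm (𝓡 (m + 1)) (metricForm (𝓡 (m + 1)) g)) F) p)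
        (extChartAt (𝓡 (m + 1)) p p)) := by
  have : IsManifold (𝓡 (m + 1)) 1 M := IsManifold.of_le (n := 2) one_le_two
  have H := isPullbackOn_hypersurface (g := g) hF.1 p
  have hdet : ∀ z ∈ chartDomain (𝓡 (m + 1)) ((𝓡 (m + 1)).prod 𝓘(ℝ, ℝ)) F p,
      (Matrix.of fun a b : Fin (m + 1) => coordForm (𝓡 (m + 1)) (pullbackForm (𝓡 (m + 1))
        ((𝓡 (m + 1)).prod 𝓘(ℝ, ℝ)) (productForm (𝓡 (m + 1)) (metricForm (𝓡 (m + 1)) g)) F) p z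
        (EuclideanSpace.single a 1) (EuclideanSpace.single b 1)).det ≠ 0 := by
    intro z hz
    have hb := H.eq_pullback z hz
    have h := det_ne_zero_of_pos (b := (productBilin (coordBilin g (F p).1)
      (chartMap (𝓡 (m + 1)) ((𝓡 (m + 1)).prod 𝓘(ℝ, ℝ)) F p z)).bilinearComp
        (fderiv ℝ (chartMap (𝓡 (m + 1)) ((𝓡 (m + 1)).prod 𝓘(ℝ, ℝ)) F p) z)
        (fderiv ℝ (chartMap (𝓡 (m + 1)) ((𝓡 (m + 1)).prod 𝓘(ℝ, ℝ)) F p) z))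
      (fun v w => H.symm _ (H.mapsTo hz) _ _) (fun v hv => by
        have h0 := coordForm_pos (pullbackForm_pos (productForm_metricForm_pos (g := g)) hF.2) p
          hz.1 hv
        rw [hb] at h0
        exact h0)
    simp only [hb]
    exact h
  exact ⟨_, H.isOpen_source, mem_chartDomain F p, Set.inter_subset_left, _,
    H.continuousOn_weakScalarCurvature hdet, rfl, H.isDistributionalScalarCurvatureOn hdet⟩

omit [IsManifold (𝓡 (m + 1)) ∞ N] [IsManifold (𝓡 (m + 1)) 2 M] in
theorem chartMap_comp_chartMap_slice {S : Type*} [TopologicalSpace S]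
    [ChartedSpace (EuclideanSpace ℝ (Fin m)) S] {ι : S → M} (hι : Continuous ι) {ε : ℝ}
    (hε : ∀ s, (F (ι s)).2 = ε) (s : S) :
    chartMap (𝓡 (m + 1)) ((𝓡 (m + 1)).prod 𝓘(ℝ, ℝ)) F (ι s) ∘ chartMap (𝓡 m) (𝓡 (m + 1)) ι s
      =ᶠ[𝓝 (extChartAt (𝓡 m) s s)]
        fun z => (chartMap (𝓡 m) (𝓡 (m + 1)) (fun s' => (F (ι s')).1) s z, ε) := by
  filter_upwards [(isOpen_chartDomain (I := 𝓡 m) (I' := 𝓡 (m + 1)) hι s).mem_nhds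
    (mem_chartDomain ι s)] with z hz
  have h : (extChartAt (𝓡 (m + 1)) (ι s)).symm (chartMap (𝓡 m) (𝓡 (m + 1)) ι s z)
      = ι ((extChartAt (𝓡 m) s).symm z) := (extChartAt (𝓡 (m + 1)) (ι s)).left_inv hz.2
  rw [Function.comp_apply, chartMap, h, extChartAt_prod]
  exact Prod.ext rfl (hε _)

/-- At the base points the differentials of the preferred charts are identities, so vectors and
metric values coincide with their coordinate expressions and the coordinate inequality can be read
on the manifold. -/
theorem hypersurface_inequality (hm : m ≠ 0)
    (hF : IsC2Immersion (𝓡 (m + 1)) ((𝓡 (m + 1)).prod 𝓘(ℝ, ℝ)) F) {ε : ℝ}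
    (hε : ∀ p : M, (F p).2 = ε →
      mfderiv (𝓡 (m + 1)) 𝓘(ℝ, ℝ) (fun q : M => (F q).2) p ≠ 0)
    {S : Type*} [TopologicalSpace S] [ChartedSpace (EuclideanSpace ℝ (Fin m)) S]
    [IsManifold (𝓡 m) 2 S] {ι : S → M} (hι : IsC2Immersion (𝓡 m) (𝓡 (m + 1)) ι)
    (hιε : ∀ s, (F (ι s)).2 = ε) (s : S)
    {ν : TangentSpace ((𝓡 (m + 1)).prod 𝓘(ℝ, ℝ)) (F (ι s))}
    (hν : IsUnitNormal (𝓡 (m + 1)) ((𝓡 (m + 1)).prod 𝓘(ℝ, ℝ))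
      (productForm (𝓡 (m + 1)) (metricForm (𝓡 (m + 1)) g)) F (ι s) ν)
    {η : TangentSpace (𝓡 (m + 1)) (F (ι s)).1}
    (hη : IsUnitNormal (𝓡 m) (𝓡 (m + 1)) (metricForm (𝓡 (m + 1)) g)
      (fun s' : S => (F (ι s')).1) s η)
    {RM : ℝ} (hRM : HasScalarCurvatureAt (pullbackForm (𝓡 (m + 1)) ((𝓡 (m + 1)).prod 𝓘(ℝ, ℝ))
      (productForm (𝓡 (m + 1)) (metricForm (𝓡 (m + 1)) g)) F) (ι s) RM) :
    let gN := metricForm (𝓡 (m + 1)) g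
    let gNR := productForm (𝓡 (m + 1)) gN
    let A := shapeOperator (m + 1) ((𝓡 (m + 1)).prod 𝓘(ℝ, ℝ)) gNR F (ι s) ν
    let AS := shapeOperator m (𝓡 (m + 1)) gN (fun s' : S => (F (ι s')).1) s η
    let c := gNR (F (ι s)) ν (sliceVector (𝓡 (m + 1)) (F (ι s)) η)
    c * A.trace * AS.trace ≥ 1 / 2 * RM - 1 / 2 * scalarCurvature gN (F (ι s)).1
        + c ^ 2 * ricciCurvature gN (F (ι s)).1 η η
        + ((m : ℝ) + 1) / (2 * m) * c ^ 2 * AS.trace ^ 2 ∧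
    (c * A.trace * AS.trace = 1 / 2 * RM - 1 / 2 * scalarCurvature gN (F (ι s)).1
        + c ^ 2 * ricciCurvature gN (F (ι s)).1 η η
        + ((m : ℝ) + 1) / (2 * m) * c ^ 2 * AS.trace ^ 2 ↔
      ∃ κ : ℝ, AS = κ • (1 : Matrix (Fin m) (Fin m) ℝ) ∧
        m ≤ Module.finrank ℝ (Module.End.eigenspace (Matrix.toLin' A) (c * κ))) := by
  intro gN gNR A AS c
  have : IsManifold (𝓡 (m + 1)) 2 N := IsManifold.of_le (n := ∞)
    ENat.LEInfty.out
  have : IsManifold (𝓡 (m + 1)) 1 N := IsManifold.of_le (n := ∞) (by exact_mod_cast le_top)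
  have : IsManifold (𝓡 (m + 1)) 1 M := IsManifold.of_le (n := 2) one_le_two
  have : IsManifold (𝓡 m) 1 S := IsManifold.of_le (n := 2) one_le_two
  -- By uniqueness `RM` is the explicit value to which the Gauss equation applies.
  rw [hRM.unique (hasScalarCurvatureAt_hypersurface hF (ι s))]
  set f : S → N := fun s' => (F (ι s')).1 with hf
  set x := chartMap (𝓡 (m + 1)) ((𝓡 (m + 1)).prod 𝓘(ℝ, ℝ)) F (ι s) with hxdef
  set φ := chartMap (𝓡 m) (𝓡 (m + 1)) ι s with hφdef
  set y := chartMap (𝓡 m) (𝓡 (m + 1)) f s with hydef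
  set s₀ := extChartAt (𝓡 m) s s with hs₀
  have hF2 : MDifferentiable (𝓡 (m + 1)) ((𝓡 (m + 1)).prod 𝓘(ℝ, ℝ)) F :=
    hF.1.mdifferentiable (by norm_num)
  have hfC : ContMDiff (𝓡 m) (𝓡 (m + 1)) 2 f := contMDiff_fst.comp (hF.1.comp hι.1)
  have hB : ContDiffOn ℝ 2 (coordBilin g (f s)) (extChartAt (𝓡 (m + 1)) (f s)).target :=
    (contDiffOn_coordBilin g (f s)).of_le ENat.LEInfty.out
  have Hx := isPullbackOn_hypersurface (g := g) hF.1 (ι s)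
  have Hy := isPullbackOn_chartMap (g := gN) hfC s hB (fun _ _ _ _ => rfl) (metricForm_symm g)
  have hφs : φ s₀ = extChartAt (𝓡 (m + 1)) (ι s) (ι s) := chartMap_self ι s
  have hys : y s₀ = extChartAt (𝓡 (m + 1)) (f s) (f s) := chartMap_self f s
  have hX : fderiv ℝ x (φ s₀) = mfderiv (𝓡 (m + 1)) ((𝓡 (m + 1)).prod 𝓘(ℝ, ℝ)) F (ι s) := by
    rw [hφs]
    exact fderiv_extChartAt_comp (hF2 (ι s))
  have hJ : fderiv ℝ φ s₀ = mfderiv (𝓡 m) (𝓡 (m + 1)) ι s :=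
    fderiv_extChartAt_comp (hι.1.mdifferentiableAt (by norm_num))
  have hY : fderiv ℝ y s₀ = mfderiv (𝓡 m) (𝓡 (m + 1)) f s :=
    fderiv_extChartAt_comp (hfC.mdifferentiableAt (by norm_num))
  have hBg : ∀ a b : EuclideanSpace ℝ (Fin (m + 1)),
      coordBilin g (f s) (y s₀) a b = gN (f s) a b := by
    intro a b
    rw [hys]
    exact coordForm_self gN (f s) a b
  have hprod : ∀ v w : EuclideanSpace ℝ (Fin (m + 1)) × ℝ, gNR (F (ι s)) v w
      = coordBilin g (f s) (y s₀) v.1 w.1 + v.2 * w.2 := by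
    intro v w
    rw [hBg]
    exact productForm_apply gN (F (ι s)) v w
  have hη' : (mfderiv (𝓡 (m + 1)) 𝓘(ℝ, EuclideanSpace ℝ (Fin (m + 1)))
      (extChartAt (𝓡 (m + 1)) (f s)) (f s) η : EuclideanSpace ℝ (Fin (m + 1))) = η := by
    rw [mfderiv_extChartAt_self]
    rfl
  -- Regularity of `ε` enters here; it is what excludes `c = 0`.
  have hX2 : ∃ v, (fderiv ℝ x (φ s₀) v).2 ≠ 0 := by
    by_contra! h0
    refine hε (ι s) (hιε s) ?_
    have h1 := mfderiv_comp (ι s) (mdifferentiableAt_snd (I := 𝓡 (m + 1)) (I' := 𝓘(ℝ, ℝ)))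
      (hF2 (ι s))
    refine h1.trans (ContinuousLinearMap.ext fun v => ?_)
    rw [mfderiv_snd]
    have h2 := h0 v
    rw [hX] at h2
    exact h2
  have hc : c = coordBilin g (f s) (y s₀) (Prod.fst (ν : EuclideanSpace ℝ (Fin (m + 1)) × ℝ)) η := by
    have h1 : c = gNR (F (ι s)) ν ((η, 0) : EuclideanSpace ℝ (Fin (m + 1)) × ℝ) :=
      congrArg (gNR (F (ι s)) ν) (sliceVector_eq (F (ι s)) η)
    rw [h1]
    refine (hprod ν (η, 0)).trans ?_
    simp
  have key := gauss_inequality_in_coordinates hm (GN := coordForm (𝓡 (m + 1)) gN (f s))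
    (fun _ _ _ _ => rfl) Hx Hy (φ := φ) (s := s₀) (mem_chartDomain f s)
    (by rw [hφs]; exact mem_chartDomain F (ι s))
    ((contDiffOn_chartMap hι.1 s).contDiffAt
      ((isOpen_chartDomain hι.1.continuous s).mem_nhds (mem_chartDomain ι s)))
    (chartMap_comp_chartMap_slice hι.1.continuous hιε s)
    (fun v hv => by rw [hBg]; exact g.pos (f s) v hv)
    (by rw [hX]; exact hF.2 (ι s)) (by rw [hJ]; exact hι.2 s) hX2
    (ν := ν) ((hprod ν ν).symm.trans hν.1)
    (fun v => by
      refine (hprod ν _).symm.trans ?_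
      rw [hX]
      exact hν.2 v)
    (η := η) ((hBg η η).trans hη.1)
    (fun v => by
      refine (hBg η _).trans ?_
      rw [hY]
      exact hη.2 v)
    (A := A) ?_ (AS := AS) ?_ hc
  · rw [hφs, show chartMap (𝓡 m) (𝓡 (m + 1)) f s s₀ = _ from hys] at key
    have hRic := congrArg (fun v : EuclideanSpace ℝ (Fin (m + 1)) =>
      ∑ j, ∑ k, ricciCoord (coordForm (𝓡 (m + 1)) gN (f s)) j k
        (extChartAt (𝓡 (m + 1)) (f s) (f s)) * v j * v k) hη'
    change ricciCurvature gN (f s) η η = _ at hRic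
    rw [show (F (ι s)).1 = f s from rfl, hRic]
    exact key
  · rw [hφs]
    refine congrArg₂ (· * ·) rfl (Matrix.ext fun k j => ?_)
    exact secondFundamentalForm_eq_hessianForm (contDiffOn_productBilin_coordBilin (F (ι s)))
      (coordForm_productForm_metricForm (F (ι s))) ν _ _
  · refine congrArg₂ (· * ·) rfl (Matrix.ext fun k j => ?_)
    exact secondFundamentalForm_eq_hessianForm (f := f) hB (fun _ _ _ _ => rfl) η _ _

end Hypersurface

end HypersurfaceGeometry

open HypersurfaceGeometry in
theorem theorem2
    {n : ℕ} (hn : 2 ≤ n)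
    -- the Riemannian manifold `(N, g)`
    {N : Type*} [TopologicalSpace N] [ChartedSpace (EuclideanSpace ℝ (Fin n)) N]
    [IsManifold (𝓡 n) ∞ N]
    (g : Bundle.ContMDiffRiemannianMetric (𝓡 n) ∞ (EuclideanSpace ℝ (Fin n))
      (fun x : N => TangentSpace (𝓡 n) x))
    -- the hypersurface `M`, given by an immersion `F` into `N × ℝ`
    {M : Type*} [TopologicalSpace M] [ChartedSpace (EuclideanSpace ℝ (Fin n)) M]
    [IsManifold (𝓡 n) 2 M]
    (F : M → N × ℝ) (hF : IsC2Immersion (𝓡 n) ((𝓡 n).prod 𝓘(ℝ, ℝ)) F)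
    -- the regular value `ε` of the height function
    (ε : ℝ)
    (hε : ∀ p : M, (F p).2 = ε → mfderiv (𝓡 n) 𝓘(ℝ, ℝ) (fun q : M => (F q).2) p ≠ 0)
    -- the level set `Σ = M ∩ {t = ε}`, with its structure of a `C^2` submanifold of `M`
    {S : Type*} [TopologicalSpace S] [ChartedSpace (EuclideanSpace ℝ (Fin (n - 1))) S]
    [IsManifold (𝓡 (n - 1)) 2 S]
    (ι : S → M) (hι : IsC2Immersion (𝓡 (n - 1)) (𝓡 n) ι) (hι_emb : Topology.IsEmbedding ι)
    (hι_range : Set.range ι = {p : M | (F p).2 = ε})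
    -- a point of `Σ`, and the unit normal vectors `ν` of `M` and `η` of `Σ` there
    (s : S)
    (ν : TangentSpace ((𝓡 n).prod 𝓘(ℝ, ℝ)) (F (ι s)))
    (hν : IsUnitNormal (𝓡 n) ((𝓡 n).prod 𝓘(ℝ, ℝ)) (productForm (𝓡 n) (metricForm (𝓡 n) g))
      F (ι s) ν)
    (η : TangentSpace (𝓡 n) (F (ι s)).1)
    (hη : IsUnitNormal (𝓡 (n - 1)) (𝓡 n) (metricForm (𝓡 n) g) (fun s' : S => (F (ι s')).1) s η) :
    let gN := metricForm (𝓡 n) g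
    let gNR := productForm (𝓡 n) gN
    let gM := pullbackForm (𝓡 n) ((𝓡 n).prod 𝓘(ℝ, ℝ)) gNR F
    let p := ι s
    let x := (F p).1
    let f : S → N := fun s' => (F (ι s')).1
    let A := shapeOperator n ((𝓡 n).prod 𝓘(ℝ, ℝ)) gNR F p ν
    let AS := shapeOperator (n - 1) (𝓡 n) gN f s η
    let H := meanCurvature n ((𝓡 n).prod 𝓘(ℝ, ℝ)) gNR F p ν
    let HS := meanCurvature (n - 1) (𝓡 n) gN f s η
    let c := gNR (F p) ν (sliceVector (𝓡 n) (F p) η)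
    -- the (continuous) scalar curvature of the induced metric exists
    (∃! RM : ℝ, HasScalarCurvatureAt gM p RM) ∧
    ∀ RM : ℝ, HasScalarCurvatureAt gM p RM →
      c * H * HS ≥ 1 / 2 * RM - 1 / 2 * scalarCurvature gN x + c ^ 2 * ricciCurvature gN x η η
          + (n : ℝ) / (2 * ((n : ℝ) - 1)) * c ^ 2 * HS ^ 2 ∧
      (c * H * HS = 1 / 2 * RM - 1 / 2 * scalarCurvature gN x + c ^ 2 * ricciCurvature gN x η η
          + (n : ℝ) / (2 * ((n : ℝ) - 1)) * c ^ 2 * HS ^ 2 ↔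
        ∃ κ : ℝ, AS = κ • (1 : Matrix (Fin (n - 1)) (Fin (n - 1)) ℝ) ∧
          n - 1 ≤ Module.finrank ℝ (Module.End.eigenspace (Matrix.toLin' A) (c * κ))) := by
  obtain ⟨m, rfl⟩ : ∃ m, n = m + 1 := ⟨n - 1, by omega⟩
  have hm : m ≠ 0 := by omega
  have hιε : ∀ s, (F (ι s)).2 = ε := fun s => by
    have h : ι s ∈ Set.range ι := ⟨s, rfl⟩
    rw [hι_range] at h
    exact h
  refine ⟨⟨_, hasScalarCurvatureAt_hypersurface hF (ι s),
    fun r hr => hr.unique (hasScalarCurvatureAt_hypersurface hF (ι s))⟩, fun RM hRM => ?_⟩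
  have hcast : ((m + 1 : ℕ) : ℝ) / (2 * (((m + 1 : ℕ) : ℝ) - 1)) = ((m : ℝ) + 1) / (2 * m) := by
    push_cast
    rw [add_sub_cancel_right]
  rw [hcast]
  -- `m + 1 - 1` reduces definitionally to `m`, so the structures on `S` carry over without a cast.
  let _ : ChartedSpace (EuclideanSpace ℝ (Fin m)) S :=
    inferInstanceAs (ChartedSpace (EuclideanSpace ℝ (Fin (m + 1 - 1))) S)
  have _ : IsManifold (𝓡 m) 2 S := inferInstanceAs (IsManifold (𝓡 (m + 1 - 1)) 2 S)
  exact hypersurface_inequality (S := S) hm hF hε hι hιε s hν hη hRM
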